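/- Let $d\in\mathbb{N}$, $t_0<t$, $\Delta t:=t-t_0$, and let $H:[t_0,t]\to\mathbb{C}^{d\times d}$ be a $C^\infty$ function with Hermitian values (one-sided derivatives at the end points); $\|\cdot\|$ is the spectral norm. Let $U(t,t_0)$ be the time evolution operator generated by $H$, that is, the value at $\tau=t$ of the unique solution of $i\,\partial_\tau U(\tau,t_0)=H(\tau)U(\tau,t_0)$, $U(t_0,t_0)=\mathbb{1}$ on $[t_0,t]$. Let $\Lambda:[t_0,t]\to\mathbb{R}$ be a continuous function with $$\Lambda(\tau)\ \ge\ \|H^{(j)}(\tau)\|^{1/(j+1)}\qquad\text{for all }\tau\in[t_0,t]\text{ and all integers } j\ge 0 .$$ Assume that $\Lambda$ is differentiable on $[t_0,t]$ and that $K\ge 0$ is a constant with $|\dot\Lambda(\tau)|\le K\Lambda(\tau)^2$ for all $\tau\in[t_0,t]$. Let $M\ge 1$, and let $k_1,\dots,k_M$ be positive integers and $a\in\mathbb{R}^M$ with $$\sum_{j=1}^M a_j=1,\qquad \sum_{j=1}^M a_j k_j^{-2m}=0\quad(1\le m\le M-1),\qquad \|a\|_1:=\sum_{j=1}^M|a_j|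 .$$ With the midpoint formula $U_2(t'',t'):=\exp\!\big(-iH(\tfrac{t'+t''}{2})(t''-t')\big)$, define the multiproduct formula $$U_{\vec k}(t'',t'):=\sum_{j=1}^M a_j\prod_{q=1}^{k_j}U_2\!\Big(t'+\tfrac{q}{k_j}(t''-t'),\ t'+\tfrac{q-1}{k_j}(t''-t')\Big).$$ All products are time-ordered, with later factors on the left. Let $\bar\Lambda:=\frac1{\Delta t}\int_{t_0}^t\Lambda(\tau)\,d\tau$. Then for every $\epsilon>0$ there are an integer $r$ and a mesh $t_0<t_1<\dots<t_r=t$ such that $$\Big\|U(t,t_0)-\prod_{i=1}^r U_{\vec k}(t_i,t_{i-1})\Big\|\le\epsilon$$ and $$r\ \le\ \max\left\{1,\ \Big(41\big(1+\tfrac32K\big)\bar\Lambda\,\Delta t\Big)^{1+\frac1{2M}}\Big(\frac{0.32\,\|a\|_1}{\epsilon}\Big)^{\frac1{2M}}\right\}.$$ Moreover, $\bar\Lambda\,\Delta t$ equals the $L^1$ norm $\int_{t_0}^t|\Lambda(\tau)|\,d\tau$ of $\Lambda$, so that the bound is expressed through $\|\Lambda\|_1$. -/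

import Mathlib

open Set MeasureTheory
open scoped Matrix.Norms.L2Operator ContDiff

noncomputable section

/-! Square complex matrices carry the spectral norm (the operator norm induced by the
Euclidean norm), through the scoped instances of `Matrix.Norms.L2Operator`. -/

/-- A `d × d` complex matrix. -/
abbrev CMat (d : ℕ) : Type := Matrix (Fin d) (Fin d) ℂ

/-- `V` solves the initial value problem `i V'(τ) = H(τ) V(τ)`, `V(t₀) = 1` on `[t₀, t]`
(the derivative is one-sided at the end points). -/
def IsPropagator {d : ℕ} (H : ℝ → CMat d) (t₀ t : ℝ) (V : ℝ → CMat d) : Prop :=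
  V t₀ = 1 ∧
    ∀ τ ∈ Icc t₀ t, HasDerivWithinAt V ((-Complex.I) • (H τ * V τ)) (Icc t₀ t) τ

/-- The time evolution operator `U(t, t₀)` generated by `H`: the value at `t` of the solution
of the initial value problem on `[t₀, t]`. For `H` continuous on `[t₀, t]` the solution exists
and is unique: see `exists_isPropagator` and `IsPropagator.eq_propagator`. -/
def propagator {d : ℕ} (H : ℝ → CMat d) (t₀ t : ℝ) : CMat d :=
  Classical.epsilon (IsPropagator H t₀ t) t

/-- The terms of the time-ordered (Dyson) series of `X' = A X`, `X(t₀) = 1`. -/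
def dysonTerm {E : Type*} [NormedRing E] [NormedAlgebra ℝ E]
    (A : ℝ → E) (t₀ : ℝ) : ℕ → ℝ → E
  | 0, _ => 1
  | n + 1, τ => ∫ s in t₀..τ, A s * dysonTerm A t₀ n s

theorem continuous_dysonTerm {E : Type*} [NormedRing E] [NormedAlgebra ℝ E] [CompleteSpace E]
    {A : ℝ → E} (hA : Continuous A) (t₀ : ℝ) (n : ℕ) : Continuous (dysonTerm A t₀ n) := by
  induction n with
  | zero => exact continuous_const
  | succ n ih =>
    exact intervalIntegral.continuous_primitive
      (fun a b => (hA.mul ih).intervalIntegrable a b) t₀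

theorem hasDerivAt_dysonTerm_succ {E : Type*} [NormedRing E] [NormedAlgebra ℝ E]
    [CompleteSpace E] {A : ℝ → E} (hA : Continuous A) (t₀ : ℝ) (n : ℕ) (τ : ℝ) :
    HasDerivAt (dysonTerm A t₀ (n + 1)) (A τ * dysonTerm A t₀ n τ) τ :=
  (hA.mul (continuous_dysonTerm hA t₀ n)).integral_hasStrictDerivAt t₀ τ |>.hasDerivAt

theorem norm_dysonTerm_le {E : Type*} [NormedRing E] [NormedAlgebra ℝ E] [CompleteSpace E]
    {A : ℝ → E} (hA : Continuous A) {C : ℝ} (hC : ∀ s, ‖A s‖ ≤ C) (t₀ : ℝ) (n : ℕ) (τ : ℝ) :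
    ‖dysonTerm A t₀ n τ‖ ≤ ‖(1 : E)‖ * ((C * |τ - t₀|) ^ n / n.factorial) := by
  have hC0 : 0 ≤ C := (norm_nonneg _).trans (hC 0)
  induction n generalizing τ with
  | zero => simp [dysonTerm]
  | succ n ih =>
    have hpt : ∀ s, ‖A s * dysonTerm A t₀ n s‖ ≤
        ‖(1 : E)‖ * C ^ (n + 1) / n.factorial * |s - t₀| ^ n := by
      intro s
      calc ‖A s * dysonTerm A t₀ n s‖ ≤ ‖A s‖ * ‖dysonTerm A t₀ n s‖ := norm_mul_le _ _
        _ ≤ C * (‖(1 : E)‖ * ((C * |s - t₀|) ^ n / n.factorial)) :=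
            mul_le_mul (hC s) (ih s) (norm_nonneg _) hC0
        _ = _ := by rw [mul_pow]; ring
    have hval : ‖(1 : E)‖ * ((C * |τ - t₀|) ^ (n + 1) / (n + 1).factorial) =
        ‖(1 : E)‖ * C ^ (n + 1) / n.factorial * (|τ - t₀| ^ (n + 1) / (n + 1)) := by
      rw [Nat.factorial_succ, mul_pow]
      have : (n.factorial : ℝ) ≠ 0 := by positivity
      push_cast
      field_simp
    rw [hval]
    change ‖∫ s in t₀..τ, A s * dysonTerm A t₀ n s‖ ≤ _
    rcases le_total t₀ τ with h | h
    · refine (intervalIntegral.norm_integral_le_of_norm_le (μ := volume) h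
        (g := fun s => ‖(1 : E)‖ * C ^ (n + 1) / n.factorial * (s - t₀) ^ n)
        (Filter.Eventually.of_forall fun s hs => ?_)
        (Continuous.intervalIntegrable (by fun_prop) _ _)).trans (le_of_eq ?_)
      · have := hpt s
        rwa [abs_of_pos (sub_pos.2 hs.1)] at this
      · rw [intervalIntegral.integral_const_mul, abs_of_nonneg (sub_nonneg.2 h),
          intervalIntegral.integral_comp_sub_right (fun x => x ^ n) t₀, integral_pow]
        simp
    · rw [intervalIntegral.integral_symm, norm_neg]
      refine (intervalIntegral.norm_integral_le_of_norm_le (μ := volume) h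
        (g := fun s => ‖(1 : E)‖ * C ^ (n + 1) / n.factorial * (t₀ - s) ^ n)
        (Filter.Eventually.of_forall fun s hs => ?_)
        (Continuous.intervalIntegrable (by fun_prop) _ _)).trans (le_of_eq ?_)
      · have := hpt s
        rwa [abs_of_nonpos (sub_nonpos.2 hs.2), neg_sub] at this
      · rw [intervalIntegral.integral_const_mul, abs_of_nonpos (sub_nonpos.2 h),
          intervalIntegral.integral_comp_sub_left (fun x => x ^ n) t₀, integral_pow]
        simp

/-- The Schrödinger initial value problem with continuous `H` has a solution. -/
theorem exists_isPropagator {d : ℕ} {H : ℝ → CMat d} {t₀ t : ℝ} (h : t₀ ≤ t)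
    (hH : ContinuousOn H (Icc t₀ t)) : ∃ V, IsPropagator H t₀ t V := by
  have : CompleteSpace (CMat d) := FiniteDimensional.complete ℂ _
  set A : ℝ → CMat d := fun s => (-Complex.I) • IccExtend h ((Icc t₀ t).domRestrict H) s with hAdef
  have hAc : Continuous A :=
    ((continuousOn_iff_continuous_domRestrict.1 hH).Icc_extend' (h := h)).const_smul (-Complex.I)
  have hAeq : ∀ τ ∈ Icc t₀ t, A τ = (-Complex.I) • H τ := fun τ hτ => by
    simp only [hAdef]; rw [IccExtend_of_mem h _ hτ]; rfl
  obtain ⟨C, hC⟩ : ∃ C, ∀ s, ‖A s‖ ≤ C := by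
    obtain ⟨C, hC⟩ := isCompact_Icc.exists_bound_of_continuousOn hH
    refine ⟨C, fun s => ?_⟩
    simp only [hAdef, norm_smul, norm_neg, Complex.norm_I, one_mul]
    exact hC _ (projIcc t₀ t h s).2
  have hC0 : 0 ≤ C := (norm_nonneg _).trans (hC 0)
  have hsum0 : ∀ τ, Summable fun n => dysonTerm A t₀ n τ := fun τ =>
    Summable.of_norm_bounded
      ((Real.summable_pow_div_factorial (C * |τ - t₀|)).mul_left ‖(1 : CMat d)‖)
      (fun n => norm_dysonTerm_le hAc hC t₀ n τ)
  have hderiv : ∀ τ, HasDerivAt (fun s => ∑' n, dysonTerm A t₀ n s)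
      (A τ * ∑' n, dysonTerm A t₀ n τ) τ := by
    intro τ
    set R : ℝ := |τ - t₀| + 1 with hR
    have hb : ∀ n y, y ∈ Metric.ball t₀ R →
        ‖A y * dysonTerm A t₀ n y‖ ≤ C * (‖(1 : CMat d)‖ * ((C * R) ^ n / n.factorial)) := by
      intro n y hy
      have hy' : |y - t₀| ≤ R := by
        have := Metric.mem_ball.1 hy
        rw [Real.dist_eq] at this
        exact this.le
      refine (norm_mul_le _ _).trans (mul_le_mul (hC y)
        ((norm_dysonTerm_le hAc hC t₀ n y).trans ?_) (norm_nonneg _) hC0)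
      gcongr
    have hτ : τ ∈ Metric.ball t₀ R := by
      rw [Metric.mem_ball, Real.dist_eq]; linarith
    have key := hasDerivAt_tsum_of_isPreconnected
      (g := fun n => dysonTerm A t₀ (n + 1)) (g' := fun n s => A s * dysonTerm A t₀ n s)
      (((Real.summable_pow_div_factorial (C * R)).mul_left ‖(1 : CMat d)‖).mul_left C)
      Metric.isOpen_ball (convex_ball t₀ R).isPreconnected
      (fun n y _ => hasDerivAt_dysonTerm_succ hAc t₀ n y) hb hτ
      ((summable_nat_add_iff 1).2 (hsum0 τ)) hτ
    have hsplit : (fun s => ∑' n, dysonTerm A t₀ n s) =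
        fun s => 1 + ∑' n, dysonTerm A t₀ (n + 1) s := by
      funext s
      rw [(hsum0 s).tsum_eq_zero_add]; rfl
    rw [hsplit]
    rw [(hsum0 τ).tsum_mul_left] at key
    exact key.const_add 1
  refine ⟨fun s => ∑' n, dysonTerm A t₀ n s, ?_, fun τ hτ => ?_⟩
  · change ∑' n, dysonTerm A t₀ n t₀ = 1
    rw [(hsum0 t₀).tsum_eq_zero_add]
    simp [dysonTerm]
  · have := (hderiv τ).hasDerivWithinAt (s := Icc t₀ t)
    rwa [hAeq τ hτ, smul_mul_assoc] at this

/-- Every solution of the initial value problem takes at `t` the value `propagator H t₀ t`. -/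
theorem IsPropagator.eq_propagator {d : ℕ} {H : ℝ → CMat d} {t₀ t : ℝ} (h : t₀ ≤ t)
    (hH : ContinuousOn H (Icc t₀ t)) {V : ℝ → CMat d} (hV : IsPropagator H t₀ t V) :
    V t = propagator H t₀ t := by
  have hW : IsPropagator H t₀ t (Classical.epsilon (IsPropagator H t₀ t)) :=
    Classical.epsilon_spec (exists_isPropagator h hH)
  obtain ⟨C, hC⟩ := isCompact_Icc.exists_bound_of_continuousOn hH
  have hder : ∀ {X : ℝ → CMat d}, IsPropagator H t₀ t X → ∀ τ ∈ Ico t₀ t,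
      HasDerivWithinAt X ((-Complex.I) • (H τ * X τ)) (Ici τ) τ := by
    intro X hX τ hτ
    have h1 := (hX.2 τ (Ico_subset_Icc_self hτ)).mono (Icc_subset_Icc_left hτ.1)
    exact h1.mono_of_mem_nhdsWithin (Icc_mem_nhdsGE hτ.2)
  refine ODE_solution_unique_of_mem_Icc_right
    (v := fun τ X => (-Complex.I) • (H τ * X)) (s := fun _ => univ) (K := C.toNNReal)
    (fun τ hτ => ?_) (fun τ hτ => (hV.2 τ hτ).continuousWithinAt) (hder hV)
    (fun _ _ => mem_univ _) (fun τ hτ => (hW.2 τ hτ).continuousWithinAt) (hder hW)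
    (fun _ _ => mem_univ _) (hV.1.trans hW.1.symm) (right_mem_Icc.2 h)
  refine LipschitzOnWith.of_dist_le_mul fun X _ Y _ => ?_
  rw [dist_eq_norm, dist_eq_norm, ← smul_sub, ← mul_sub, norm_smul, norm_neg, Complex.norm_I,
    one_mul]
  refine (norm_mul_le _ _).trans (mul_le_mul_of_nonneg_right ?_ (norm_nonneg _))
  exact (hC τ (Ico_subset_Icc_self hτ)).trans (Real.le_coe_toNNReal C)

/-- `Λ` is a `Λ`-bound for `H` on `[t₀, t]`: a continuous function that dominates
`‖H^{(j)}(τ)‖^{1/(j+1)}` for every order `j ≥ 0` and every `τ ∈ [t₀, t]`. -/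
def IsLambdaBound {d : ℕ} (H : ℝ → CMat d) (Λ : ℝ → ℝ) (t₀ t : ℝ) : Prop :=
  ContinuousOn Λ (Icc t₀ t) ∧
    ∀ τ ∈ Icc t₀ t, ∀ j : ℕ,
      ‖iteratedDerivWithin j H (Icc t₀ t) τ‖ ^ (1 / ((j : ℝ) + 1)) ≤ Λ τ

/-- The time average of `f` over `[t₀, t]`. -/
def timeAverage (f : ℝ → ℝ) (t₀ t : ℝ) : ℝ := 1 / (t - t₀) * ∫ τ in t₀..t, f τ

/-- The time-ordered product `F (n - 1) * ⋯ * F 1 * F 0` (later factors on the left). -/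
def timeOrderedProd {d n : ℕ} (F : Fin n → CMat d) : CMat d :=
  (List.ofFn F).reverse.prod

/-- The midpoint formula `U₂(t, s) = exp(-i H(s + (t - s)/2) (t - s))`. -/
def midpointFormula {d : ℕ} (H : ℝ → CMat d) (t s : ℝ) : CMat d :=
  NormedSpace.exp ((-Complex.I * ((t - s : ℝ) : ℂ)) • H (s + (t - s) / 2))

/-- `U₂^{(k)}(t, s)`: the time-ordered product of `k` midpoint formulas on the uniform
subdivision of `[s, t]` into `k` pieces. -/
def midpointPower {d : ℕ} (H : ℝ → CMat d) (k : ℕ) (t s : ℝ) : CMat d :=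
  timeOrderedProd fun q : Fin k =>
    midpointFormula H (s + (t - s) * ((q : ℝ) + 1) / k) (s + (t - s) * (q : ℝ) / k)

/-- The time-dependent multiproduct formula
`U_k(t, s) = ∑ j, a j • U₂^{(k j)}(t, s)` with base formula the midpoint formula. -/
def multiproductFormula {d M : ℕ} (H : ℝ → CMat d) (a : Fin M → ℝ) (k : Fin M → ℕ)
    (t s : ℝ) : CMat d :=
  ∑ j, (a j : ℂ) • midpointPower H (k j) t s

/-- `(a, k)` are coefficients of a multiproduct formula of order `2 M`: the `k j` are positive
integers and `∑ j, a j / (k j)^(2 m)` is `1` for `m = 0` and `0` for `1 ≤ m ≤ M - 1`. -/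
def IsMultiproductCoeff {M : ℕ} (a : Fin M → ℝ) (k : Fin M → ℕ) : Prop :=
  (∀ j, 0 < k j) ∧
    ∀ m : Fin M, ∑ j, a j / (k j : ℝ) ^ (2 * (m : ℕ)) = if (m : ℕ) = 0 then 1 else 0

/-- The `ℓ¹` norm of a vector. -/
def l1Norm {M : ℕ} (a : Fin M → ℝ) : ℝ := ∑ j, |a j|

end

/-! On a step `[s, s']` time is measured in units of `1/Λ(s)`. The coefficients `A j = -i H^(j)(s) /
(j! Λ(s)^(j+1))` satisfy `‖A j‖ ≤ 1/j!`, so the propagator and the multiproduct formula become power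
series in `θ = Λ(s)(s' - s)`, with bounds that no longer involve `H`.

The coefficient of `h^n` in a product of `k` midpoint exponentials of step `h` solves a difference
equation in `k`. It is therefore a polynomial in `k` of degree at most `n`, and its `k^n`
coefficient is the Taylor coefficient of the exact solution. Time symmetry of the midpoint rule
carries the equation over to negative `k` and gives the polynomial the parity of `n`. With `h = θ/k`
this is an expansion in `1/k²` (`exists_even_expansion`), and the moment conditions on `a` cancel
every error of order `n ≤ 2M` (`errCoeff_eq_zero`).

Higher orders are bounded in two ways. A Cauchy estimate gives a multiple of `‖a‖₁ 2^n`
(`norm_errCoeff_le`). A second bound is free of `‖a‖₁` (`norm_errCoeff_le_of_lt`): interpolation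
writes `a j` through the differences `k_j² - k_i²`, and integrality of the `k_i` gives `|a j|
k_j^(-2M) ≤ 2/(M!)²`, which absorbs the factor `n^(2M)` from the expansion.

The mesh equidistributes `∫ Λ`. Since `|Λ'| ≤ K Λ²`, each `θ` is at most `(1 + 3K/2)` times the
integral of `Λ` over the step (`mul_sub_le_integral_mul_exp`, `mul_exp_le`). Propagators are
contractions, so `r` steps with error `δ` each cost at most `(1 + δ)^r - 1`. If `ε ≥ 1 + ‖a‖₁`, any
single step will do. Otherwise the first bound suffices as long as `0.505 ε ≤ 186^M`. Beyond that,
`‖a‖₁ > ε - 1` is huge and the second bound gives `rδ ≤ 4M`, while `exp(4M) ≤ 186^M < ε`. -/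

noncomputable section

/-! ### Formal power series over a normed ring -/

section FormalExp

open Finset PowerSeries

variable {E : Type*} [NormedRing E]

/-- The partial sums of `∑ ‖coeff i P‖ h ^ i` are bounded by `C`. -/
def PSBound (P : PowerSeries E) (h C : ℝ) : Prop :=
  ∀ n, ∑ i ∈ range n, ‖coeff i P‖ * h ^ i ≤ C

theorem PSBound.nonneg {P : PowerSeries E} {h C : ℝ} (hP : PSBound P h C) : 0 ≤ C := by
  simpa using hP 0

theorem PSBound.mono {P : PowerSeries E} {h C D : ℝ} (hP : PSBound P h C) (hCD : C ≤ D) :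
    PSBound P h D := fun n => (hP n).trans hCD

theorem PSBound.norm_coeff_le {P : PowerSeries E} {h C : ℝ} (hP : PSBound P h C) (hh : 0 ≤ h)
    (n : ℕ) : ‖coeff n P‖ * h ^ n ≤ C :=
  (single_le_sum (f := fun i => ‖coeff i P‖ * h ^ i) (fun i _ => by positivity)
    (self_mem_range_succ n)).trans (hP (n + 1))

theorem PSBound.summable {P : PowerSeries E} {h C : ℝ} (hP : PSBound P h C) (hh : 0 ≤ h) :
    Summable fun n => ‖coeff n P‖ * h ^ n :=
  summable_of_sum_range_le (fun n => by positivity) hP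

theorem PSBound.one (h1 : ‖(1 : E)‖ ≤ 1) (h : ℝ) : PSBound (1 : PowerSeries E) h 1 := by
  intro n
  have : ∀ i, ‖coeff i (1 : PowerSeries E)‖ * h ^ i = if i = 0 then ‖(1 : E)‖ else 0 := by
    intro i
    rw [coeff_one]
    split_ifs with hi <;> simp [hi]
  simp only [this, sum_ite_eq']
  split_ifs <;> linarith

theorem PSBound.mul {P Q : PowerSeries E} {h C D : ℝ} (hh : 0 ≤ h) (hP : PSBound P h C)
    (hQ : PSBound Q h D) : PSBound (P * Q) h (C * D) := by
  intro n
  calc ∑ l ∈ range n, ‖coeff l (P * Q)‖ * h ^ l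
      ≤ ∑ l ∈ range n, ∑ i ∈ range (l + 1),
          (‖coeff i P‖ * h ^ i) * (‖coeff (l - i) Q‖ * h ^ (l - i)) := by
        refine sum_le_sum fun l _ => ?_
        rw [coeff_mul, Nat.sum_antidiagonal_eq_sum_range_succ_mk]
        refine (mul_le_mul_of_nonneg_right (norm_sum_le _ _) (by positivity)).trans ?_
        rw [sum_mul]
        refine sum_le_sum fun i hi => ?_
        have hi' : i ≤ l := by simpa [Nat.lt_succ_iff] using hi
        calc ‖coeff i P * coeff (l - i) Q‖ * h ^ l
            ≤ (‖coeff i P‖ * ‖coeff (l - i) Q‖) * h ^ l := by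
              gcongr; exact norm_mul_le _ _
          _ = _ := by
              rw [← Nat.add_sub_cancel' hi', pow_add]; simp; ring
    _ = ∑ i ∈ range n, ∑ j ∈ range (n - i),
          (‖coeff i P‖ * h ^ i) * (‖coeff j Q‖ * h ^ j) :=
        sum_range_diag_flip n fun i j => (‖coeff i P‖ * h ^ i) * (‖coeff j Q‖ * h ^ j)
    _ ≤ ∑ i ∈ range n, (‖coeff i P‖ * h ^ i) * D := by
        refine sum_le_sum fun i _ => ?_
        rw [← mul_sum]
        exact mul_le_mul_of_nonneg_left (hQ _) (by positivity)
    _ ≤ C * D := by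
        rw [← sum_mul]
        exact mul_le_mul_of_nonneg_right (hP n) hQ.nonneg

theorem PSBound.pow (h1 : ‖(1 : E)‖ ≤ 1) {P : PowerSeries E} {h C : ℝ} (hh : 0 ≤ h)
    (hP : PSBound P h C) (p : ℕ) : PSBound (P ^ p) h (C ^ p) := by
  induction p with
  | zero => simpa using PSBound.one h1 h
  | succ p ih => rw [pow_succ, pow_succ]; exact ih.mul hh hP

theorem coeff_pow_eq_zero_of_lt {R : Type*} [Ring R] {Z : PowerSeries R} (hZ : coeff 0 Z = 0)
    {l p : ℕ} (h : l < p) : coeff l (Z ^ p) = 0 := by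
  induction p generalizing l with
  | zero => omega
  | succ p ih =>
    rw [pow_succ, coeff_mul]
    refine sum_eq_zero fun ij hij => ?_
    rw [HasAntidiagonal.mem_antidiagonal] at hij
    by_cases hj : ij.2 = 0
    · rw [hj, hZ, mul_zero]
    · rw [ih (by omega), zero_mul]

variable [NormedAlgebra ℝ E]

/-- The formal exponential `∑ Z ^ p / p!` of a power series without constant term. -/
def formalExp (Z : PowerSeries E) : PowerSeries E :=
  PowerSeries.mk fun l => ∑ p ∈ range (l + 1), ((p.factorial : ℝ)⁻¹) • coeff l (Z ^ p)

theorem coeff_formalExp_of_le {Z : PowerSeries E} (hZ : coeff 0 Z = 0) {l n : ℕ} (h : l ≤ n) :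
    coeff l (formalExp Z) = ∑ p ∈ range (n + 1), ((p.factorial : ℝ)⁻¹) • coeff l (Z ^ p) := by
  rw [formalExp, coeff_mk]
  refine sum_subset (range_subset_range.2 (by omega)) fun p _ hp => ?_
  rw [coeff_pow_eq_zero_of_lt hZ (by simpa using hp), smul_zero]

/-- The binomial theorem for `(-1 + 1)^s`, divided by `s!`. -/
theorem sum_neg_one_pow_div_factorial (s : ℕ) :
    ∑ p ∈ range (s + 1), ((p.factorial : ℝ)⁻¹ * ((s - p).factorial : ℝ)⁻¹) * (-1) ^ p =
      if s = 0 then 1 else 0 := by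
  have h := add_pow (-1 : ℝ) 1 s
  have h2 : ∑ p ∈ range (s + 1), ((p.factorial : ℝ)⁻¹ * ((s - p).factorial : ℝ)⁻¹) * (-1) ^ p =
      (s.factorial : ℝ)⁻¹ * (-1 + 1) ^ s := by
    rw [h, mul_sum]
    refine sum_congr rfl fun p hp => ?_
    have hp' : p ≤ s := by simpa [Nat.lt_succ_iff] using hp
    rw [Nat.cast_choose ℝ hp']
    have := Nat.factorial_ne_zero s
    field_simp
    simp
  rw [h2]
  rcases eq_or_ne s 0 with rfl | hs
  · simp
  · simp [hs]

/-- The double sum is regrouped by total exponent `s = p + q`. Truncating at `l` loses nothing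
because `Z ^ p` starts in degree `p`. -/
theorem formalExp_neg_mul_formalExp {Z : PowerSeries E} (hZ : coeff 0 Z = 0) :
    formalExp (-Z) * formalExp Z = 1 := by
  ext l
  have hZ' : coeff 0 (-Z) = 0 := by rw [map_neg, hZ, neg_zero]
  calc coeff l (formalExp (-Z) * formalExp Z)
      = ∑ ij ∈ antidiagonal l, ∑ p ∈ range (l + 1), ∑ q ∈ range (l + 1),
          ((p.factorial : ℝ)⁻¹ * (q.factorial : ℝ)⁻¹) •
            (coeff ij.1 ((-Z) ^ p) * coeff ij.2 (Z ^ q)) := by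
        rw [coeff_mul]
        refine sum_congr rfl fun ij hij => ?_
        rw [HasAntidiagonal.mem_antidiagonal] at hij
        rw [coeff_formalExp_of_le hZ' (show ij.1 ≤ l by omega),
          coeff_formalExp_of_le hZ (show ij.2 ≤ l by omega), sum_mul_sum]
        refine sum_congr rfl fun p _ => sum_congr rfl fun q _ => ?_
        rw [smul_mul_smul_comm]
    _ = ∑ p ∈ range (l + 1), ∑ q ∈ range (l + 1),
          (((p.factorial : ℝ)⁻¹ * (q.factorial : ℝ)⁻¹) * (-1) ^ p) • coeff l (Z ^ (p + q)) := by
        rw [sum_comm]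
        refine sum_congr rfl fun p _ => ?_
        rw [sum_comm]
        refine sum_congr rfl fun q _ => ?_
        rw [← smul_sum, ← coeff_mul, neg_pow, mul_assoc, ← pow_add]
        rcases Nat.even_or_odd p with hp | hp <;> simp [hp.neg_one_pow]
    _ = ∑ p ∈ range (l + 1), ∑ q ∈ range (l + 1 - p),
          (((p.factorial : ℝ)⁻¹ * (q.factorial : ℝ)⁻¹) * (-1) ^ p) • coeff l (Z ^ (p + q)) := by
        refine sum_congr rfl fun p _ => (sum_subset (range_subset_range.2 (by omega)) ?_).symm
        intro q _ hq
        rw [coeff_pow_eq_zero_of_lt hZ (by simp at hq; omega), smul_zero]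
    _ = ∑ s ∈ range (l + 1), ∑ p ∈ range (s + 1),
          (((p.factorial : ℝ)⁻¹ * ((s - p).factorial : ℝ)⁻¹) * (-1) ^ p) •
            coeff l (Z ^ (p + (s - p))) :=
        (sum_range_diag_flip (l + 1) fun p q =>
          (((p.factorial : ℝ)⁻¹ * (q.factorial : ℝ)⁻¹) * (-1) ^ p) • coeff l (Z ^ (p + q))).symm
    _ = ∑ s ∈ range (l + 1), (if s = 0 then (1 : ℝ) else 0) • coeff l (Z ^ s) := by
        refine sum_congr rfl fun s _ => ?_
        rw [← sum_neg_one_pow_div_factorial, sum_smul]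
        refine sum_congr rfl fun p hp => ?_
        rw [Nat.add_sub_cancel' (by simpa [Nat.lt_succ_iff] using hp)]
    _ = coeff l 1 := by simp

theorem PSBound.formalExp (h1 : ‖(1 : E)‖ ≤ 1) {Z : PowerSeries E} {h C : ℝ} (hh : 0 ≤ h)
    (hZ : coeff 0 Z = 0) (hC : PSBound Z h C) : PSBound (formalExp Z) h (Real.exp C) := by
  intro n
  calc ∑ l ∈ range n, ‖coeff l (_root_.formalExp Z)‖ * h ^ l
      ≤ ∑ l ∈ range n, ∑ p ∈ range (n + 1),
          (p.factorial : ℝ)⁻¹ * (‖coeff l (Z ^ p)‖ * h ^ l) := by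
        refine sum_le_sum fun l hl => ?_
        rw [coeff_formalExp_of_le hZ (mem_range.1 hl).le]
        refine (mul_le_mul_of_nonneg_right (norm_sum_le _ _) (by positivity)).trans ?_
        rw [sum_mul]
        refine sum_le_sum fun p _ => le_of_eq ?_
        rw [norm_smul, norm_inv, RCLike.norm_natCast, mul_assoc]
    _ = ∑ p ∈ range (n + 1), (p.factorial : ℝ)⁻¹ * ∑ l ∈ range n, ‖coeff l (Z ^ p)‖ * h ^ l := by
        rw [sum_comm]; simp_rw [mul_sum]
    _ ≤ ∑ p ∈ range (n + 1), C ^ p / p.factorial := by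
        refine sum_le_sum fun p _ => ?_
        rw [div_eq_inv_mul]
        exact mul_le_mul_of_nonneg_left (hC.pow h1 hh p n) (by positivity)
    _ ≤ Real.exp C := Real.sum_le_exp_of_nonneg hC.nonneg _

/-- `x` is the value at `h` of the power series `P`. -/
def PSEval (P : PowerSeries E) (h : ℝ) (x : E) : Prop :=
  HasSum (fun n => h ^ n • coeff n P) x

theorem PSBound.summable_smul {P : PowerSeries E} {h C : ℝ} (hP : PSBound P h C) (hh : 0 ≤ h) :
    Summable fun n => ‖h ^ n • coeff n P‖ := by
  refine (hP.summable hh).congr fun n => ?_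
  rw [norm_smul, norm_pow, Real.norm_of_nonneg hh, mul_comm]

theorem PSEval.one (h : ℝ) : PSEval (1 : PowerSeries E) h 1 := by
  have := hasSum_single (f := fun n => h ^ n • coeff n (1 : PowerSeries E)) 0
    (fun n hn => by simp [coeff_one, hn])
  simpa [PSEval] using this

variable [CompleteSpace E]

theorem PSEval.mul {P Q : PowerSeries E} {h C D : ℝ} {x y : E} (hh : 0 ≤ h)
    (hP : PSBound P h C) (hQ : PSBound Q h D) (hx : PSEval P h x) (hy : PSEval Q h y) :
    PSEval (P * Q) h (x * y) := by
  have hP' := hP.summable_smul hh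
  have hQ' := hQ.summable_smul hh
  have h1 := (summable_norm_sum_mul_antidiagonal_of_summable_norm hP' hQ').of_norm.hasSum
  rw [← tsum_mul_tsum_eq_tsum_sum_antidiagonal_of_summable_norm hP' hQ', hx.tsum_eq,
    hy.tsum_eq] at h1
  have e : ∀ n, ∑ kl ∈ antidiagonal n, (h ^ kl.1 • coeff kl.1 P) * (h ^ kl.2 • coeff kl.2 Q) =
      h ^ n • coeff n (P * Q) := fun n => by
    rw [coeff_mul, smul_sum]
    refine sum_congr rfl fun ij hij => ?_
    rw [smul_mul_smul_comm, ← pow_add, HasAntidiagonal.mem_antidiagonal.1 hij]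
  simp only [e] at h1
  exact h1

theorem PSEval.pow (h1 : ‖(1 : E)‖ ≤ 1) {P : PowerSeries E} {h C : ℝ} {x : E} (hh : 0 ≤ h)
    (hP : PSBound P h C) (hx : PSEval P h x) (p : ℕ) : PSEval (P ^ p) h (x ^ p) := by
  induction p with
  | zero => simpa using PSEval.one h
  | succ p ih => rw [pow_succ, pow_succ]; exact ih.mul hh (hP.pow h1 hh p) hP hx

/-- The family indexed by exponent and degree is absolutely summable. Summing by exponent gives `exp
z`; summing by degree gives the coefficients of the formal exponential, as finite sums. -/
theorem PSEval.formalExp (h1 : ‖(1 : E)‖ ≤ 1) {Z : PowerSeries E} {h C : ℝ} {z : E}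
    (hh : 0 ≤ h) (hZ : coeff 0 Z = 0) (hC : PSBound Z h C) (hz : PSEval Z h z) :
    PSEval (formalExp Z) h (NormedSpace.exp z) := by
  set G : ℕ × ℕ → E := fun q => ((q.1.factorial : ℝ)⁻¹) • (h ^ q.2 • coeff q.2 (Z ^ q.1)) with hG
  have hnorm : ∀ q, ‖G q‖ = (q.1.factorial : ℝ)⁻¹ * (‖coeff q.2 (Z ^ q.1)‖ * h ^ q.2) := by
    intro q
    simp only [hG]
    rw [norm_smul, norm_smul, norm_inv, RCLike.norm_natCast, norm_pow, Real.norm_of_nonneg hh,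
      mul_comm (h ^ _)]
  have hin : ∀ p, Summable fun l => ‖G (p, l)‖ := fun p => by
    simp_rw [hnorm]
    exact ((hC.pow h1 hh p).summable hh).mul_left _
  have hsum : Summable fun q => ‖G q‖ := by
    refine (summable_prod_of_nonneg fun q => norm_nonneg _).2 ⟨hin, ?_⟩
    refine Summable.of_nonneg_of_le (fun p => tsum_nonneg fun l => norm_nonneg _) (fun p => ?_)
      (Real.summable_pow_div_factorial C)
    simp_rw [hnorm]
    rw [tsum_mul_left, div_eq_inv_mul]
    refine mul_le_mul_of_nonneg_left ?_ (by positivity)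
    exact Real.tsum_le_of_sum_range_le (fun n => by positivity) (hC.pow h1 hh p)
  have hS : Summable G := hsum.of_norm
  have hfib : ∀ p, HasSum (fun l => G (p, l)) (((p.factorial : ℝ)⁻¹) • z ^ p) := fun p =>
    (hz.pow h1 hh hC p).const_smul _
  have hval : ∑' q, G q = NormedSpace.exp z :=
    (hS.hasSum.prod_fiberwise hfib).unique (NormedSpace.exp_series_hasSum_exp' (𝕂 := ℝ) z)
  have hsw : HasSum (fun q : ℕ × ℕ => G q.swap) (NormedSpace.exp z) := by
    rw [← hval]
    exact ((Equiv.prodComm ℕ ℕ).hasSum_iff (f := G)).2 hS.hasSum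
  refine hsw.prod_fiberwise fun l => ?_
  have := hasSum_sum_of_ne_finset_zero (L := SummationFilter.unconditional ℕ) (f := fun p => G (p, l)) (s := range (l + 1))
    (fun p hp => by
      simp only [hG]
      rw [coeff_pow_eq_zero_of_lt hZ (by simpa using hp), smul_zero, smul_zero])
  have hl : h ^ l • coeff l (_root_.formalExp Z) = ∑ p ∈ range (l + 1), G (p, l) := by
    rw [coeff_formalExp_of_le hZ le_rfl, smul_sum]
    exact sum_congr rfl fun p _ => smul_comm _ _ _
  rw [hl]
  exact this

end FormalExp

/-! ### Vector valued polynomials with a weighted coefficient norm -/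

section PolyRep

open Finset PowerSeries

variable {E : Type*} [NormedRing E] [NormedAlgebra ℝ E]

/-- `p` is a polynomial function of degree at most `d` with coefficient `e` at degree `d` and
weighted coefficient norm `∑ ‖cᵢ‖ N ^ i ≤ C`. -/
def PolyRep (N : ℝ) (d : ℕ) (C : ℝ) (e : E) (p : ℝ → E) : Prop :=
  ∃ P : PowerSeries E, (∀ i, d < i → coeff i P = 0) ∧ coeff d P = e ∧ PSBound P N C ∧
    ∀ x, p x = ∑ i ∈ range (d + 1), x ^ i • coeff i P

theorem PolyRep.mono {N : ℝ} {d : ℕ} {C D : ℝ} {e : E} {p : ℝ → E} (h : PolyRep N d C e p)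
    (hCD : C ≤ D) : PolyRep N d D e p := by
  obtain ⟨P, h1, h2, h3, h4⟩ := h
  exact ⟨P, h1, h2, h3.mono hCD, h4⟩

theorem PolyRep.congr {N : ℝ} {d : ℕ} {C : ℝ} {e : E} {p q : ℝ → E} (h : PolyRep N d C e p)
    (hpq : ∀ x, q x = p x) : PolyRep N d C e q := by
  obtain ⟨P, h1, h2, h3, h4⟩ := h
  exact ⟨P, h1, h2, h3, fun x => (hpq x).trans (h4 x)⟩

theorem PolyRep.lift {N : ℝ} {d d' : ℕ} {C : ℝ} {e : E} {p : ℝ → E} (h : PolyRep N d C e p)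
    (hd : d < d') : PolyRep N d' C 0 p := by
  obtain ⟨P, h1, h2, h3, h4⟩ := h
  refine ⟨P, fun i hi => h1 i (hd.trans hi), h1 _ hd, h3, fun x => ?_⟩
  rw [h4]
  refine sum_subset (range_subset_range.2 (by omega)) fun i _ hi => ?_
  rw [h1 i (by simp at hi; omega), smul_zero]

theorem PolyRep.zero (N : ℝ) (d : ℕ) : PolyRep N d 0 (0 : E) fun _ => 0 :=
  ⟨0, by simp, by simp, fun n => by simp, by simp⟩

theorem PolyRep.add {N : ℝ} {d : ℕ} {C D : ℝ} {e f : E} {p q : ℝ → E} (hN : 0 ≤ N)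
    (hp : PolyRep N d C e p) (hq : PolyRep N d D f q) :
    PolyRep N d (C + D) (e + f) fun x => p x + q x := by
  obtain ⟨P, h1, h2, h3, h4⟩ := hp
  obtain ⟨Q, k1, k2, k3, k4⟩ := hq
  refine ⟨P + Q, fun i hi => by simp [h1 i hi, k1 i hi], by simp [h2, k2], fun n => ?_,
    fun x => by simp [h4, k4, sum_add_distrib]⟩
  refine le_trans ?_ (add_le_add (h3 n) (k3 n))
  rw [← sum_add_distrib]
  refine sum_le_sum fun i _ => ?_
  rw [← add_mul, map_add]
  exact mul_le_mul_of_nonneg_right (norm_add_le _ _) (by positivity)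

theorem PolyRep.sum {ι : Type*} {N : ℝ} {d : ℕ} (hN : 0 ≤ N) (s : Finset ι) {C : ι → ℝ}
    {e : ι → E} {p : ι → ℝ → E} (h : ∀ i ∈ s, PolyRep N d (C i) (e i) (p i)) :
    PolyRep N d (∑ i ∈ s, C i) (∑ i ∈ s, e i) fun x => ∑ i ∈ s, p i x := by
  classical
  induction s using Finset.induction_on with
  | empty => simpa using PolyRep.zero N d
  | insert a s ha ih =>
    simp only [sum_insert ha]
    exact (h a (mem_insert_self _ _)).add hN (ih fun i hi => h i (mem_insert_of_mem hi))

theorem PolyRep.smul_const {F : Type*} [NormedRing F] [NormedAlgebra ℝ F] {N : ℝ} {d : ℕ}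
    {C τ : ℝ} {p : ℝ → ℝ} (hp : PolyRep N d C τ p) (c : F) :
    PolyRep N d (C * ‖c‖) (τ • c) fun x => p x • c := by
  obtain ⟨P, h1, h2, h3, h4⟩ := hp
  refine ⟨PowerSeries.mk fun i => coeff i P • c, fun i hi => by simp [h1 i hi], by simp [h2],
    fun n => ?_, fun x => by simp [h4, sum_smul, mul_smul]⟩
  refine le_trans (le_of_eq ?_) (mul_le_mul_of_nonneg_right (h3 n) (norm_nonneg c))
  rw [sum_mul]
  refine sum_congr rfl fun i _ => ?_
  rw [coeff_mk, norm_smul]; ring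

theorem PolyRep.monomial (N : ℝ) (hN : 0 ≤ N) (d : ℕ) (c : E) :
    PolyRep N d (‖c‖ * N ^ d) c fun x => x ^ d • c := by
  refine ⟨PowerSeries.mk fun i => if i = d then c else 0, fun i hi => by simp [hi.ne'],
    by simp, fun n => ?_, fun x => by simp⟩
  have : ∀ i, ‖coeff i (PowerSeries.mk fun i => if i = d then c else 0)‖ * N ^ i =
      if i = d then ‖c‖ * N ^ d else 0 := by
    intro i
    rw [coeff_mk]
    split_ifs with hi <;> simp [hi]
  simp only [this, sum_ite_eq']
  split_ifs
  · rfl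
  · positivity

theorem PolyRep.mul {N : ℝ} {d d' : ℕ} {C D : ℝ} {e f : E} {p q : ℝ → E} (hN : 0 ≤ N)
    (hp : PolyRep N d C e p) (hq : PolyRep N d' D f q) :
    PolyRep N (d + d') (C * D) (e * f) fun x => p x * q x := by
  obtain ⟨P, h1, h2, h3, h4⟩ := hp
  obtain ⟨Q, k1, k2, k3, k4⟩ := hq
  refine ⟨P * Q, fun i hi => ?_, ?_, h3.mul hN k3, fun x => ?_⟩
  · rw [coeff_mul]
    refine sum_eq_zero fun ij hij => ?_
    rw [HasAntidiagonal.mem_antidiagonal] at hij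
    by_cases h : d < ij.1
    · rw [h1 _ h, zero_mul]
    · rw [k1 _ (by omega), mul_zero]
  · rw [coeff_mul, sum_eq_single (d, d')]
    · rw [h2, k2]
    · intro ij hij hne
      rw [HasAntidiagonal.mem_antidiagonal] at hij
      by_cases h : d < ij.1
      · rw [h1 _ h, zero_mul]
      · by_cases h' : d' < ij.2
        · rw [k1 _ h', mul_zero]
        · exact absurd (Prod.ext (by simp; omega) (by simp; omega)) hne
    · simp
  · have hP : p x = ∑ i ∈ range (d + d' + 1), x ^ i • coeff i P := by
      rw [h4]
      refine sum_subset (range_subset_range.2 (by omega)) fun i _ hi => ?_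
      rw [h1 i (by simp at hi; omega), smul_zero]
    change p x * q x = _
    rw [hP, sum_mul]
    calc ∑ i ∈ range (d + d' + 1), x ^ i • coeff i P * q x
        = ∑ i ∈ range (d + d' + 1), ∑ j ∈ range (d + d' + 1 - i),
            x ^ (i + j) • (coeff i P * coeff j Q) := by
          refine sum_congr rfl fun i hi => ?_
          by_cases h : d < i
          · simp [h1 i h]
          · rw [k4, mul_sum]
            calc ∑ j ∈ range (d' + 1), x ^ i • coeff i P * x ^ j • coeff j Q
                = ∑ j ∈ range (d' + 1), x ^ (i + j) • (coeff i P * coeff j Q) :=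
                  sum_congr rfl fun j _ => by rw [smul_mul_smul_comm, pow_add]
              _ = _ := by
                  refine sum_subset (range_subset_range.2 (by omega)) fun j _ hj => ?_
                  rw [k1 j (by simp at hj; omega), mul_zero, smul_zero]
      _ = ∑ l ∈ range (d + d' + 1), ∑ i ∈ range (l + 1),
            x ^ (i + (l - i)) • (coeff i P * coeff (l - i) Q) :=
          (sum_range_diag_flip _ fun i j => x ^ (i + j) • (coeff i P * coeff j Q)).symm
      _ = _ := by
          refine sum_congr rfl fun l _ => ?_
          rw [coeff_mul, Nat.sum_antidiagonal_eq_sum_range_succ_mk, smul_sum]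
          refine sum_congr rfl fun i hi => ?_
          rw [Nat.add_sub_cancel' (by simpa [Nat.lt_succ_iff] using hi)]

/-- A linear operation on polynomials that multiplies the weighted norm of each monomial by at most
`K` does so for all polynomials, and only the top monomial reaches the leading coefficient. It
serves for both the shift and the antidifference. -/
theorem PolyRep.linear {N K : ℝ} {d s : ℕ} (hN : 0 ≤ N) {P : PowerSeries E} {C : ℝ}
    (hP : PSBound P N C) {τ : ℕ → ℝ} {q : ℕ → ℝ → ℝ} (hK : 0 ≤ K)
    (hq : ∀ i ≤ d, PolyRep N (i + s) (K * N ^ i) (τ i) (q i)) :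
    PolyRep N (d + s) (K * C) (τ d • coeff d P)
      fun x => ∑ i ∈ range (d + 1), q i x • coeff i P := by
  have h1 : ∀ i ∈ range (d + 1), PolyRep N (d + s) (K * N ^ i * ‖coeff i P‖)
      (if i = d then τ d • coeff d P else 0) fun x => q i x • coeff i P := by
    intro i hi
    have hi' : i ≤ d := by simpa [Nat.lt_succ_iff] using hi
    have := (hq i hi').smul_const (coeff i P)
    split_ifs with h
    · subst h; exact this
    · exact this.lift (by omega)
  have h2 := PolyRep.sum hN _ h1
  have h3 : ∑ i ∈ range (d + 1), (if i = d then τ d • coeff d P else 0) = τ d • coeff d P := by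
    simp
  rw [h3] at h2
  refine h2.mono ?_
  calc ∑ i ∈ range (d + 1), K * N ^ i * ‖coeff i P‖
      = K * ∑ i ∈ range (d + 1), ‖coeff i P‖ * N ^ i := by
        rw [mul_sum]; exact sum_congr rfl fun i _ => by ring
    _ ≤ K * C := mul_le_mul_of_nonneg_left (hP _) hK

theorem polyRep_sub_half_pow {N : ℝ} (hN : 0 ≤ N) (i : ℕ) :
    PolyRep N i ((N + 1 / 2) ^ i) (1 : ℝ) fun x => (x - 1 / 2) ^ i := by
  induction i with
  | zero => simpa using PolyRep.monomial N hN 0 (1 : ℝ)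
  | succ i ih =>
    have h1 : PolyRep N 1 (N + 1 / 2) (1 : ℝ) fun x => x - 1 / 2 := by
      have a := PolyRep.monomial N hN 1 (1 : ℝ)
      have b := (PolyRep.monomial N hN 0 (-1 / 2 : ℝ)).lift Nat.zero_lt_one
      have ab := a.add hN b
      rw [add_zero] at ab
      refine (ab.mono ?_).congr fun x => ?_
      · norm_num
      · simp only [smul_eq_mul]; ring
    have := ih.mul hN h1
    simpa [pow_succ] using this

/-- A weight `N` at least as large as the degree makes a shift by `1/2` cost only `exp(1/2) < 1.65`.
-/
theorem add_half_pow_le {N : ℝ} {i : ℕ} (hN : 0 < N) (hi : (i : ℝ) ≤ N) :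
    (N + 1 / 2) ^ i ≤ 1.65 * N ^ i := by
  have h1 : (N + 1 / 2) = (1 / (2 * N) + 1) * N := by field_simp; ring
  rw [h1, mul_pow]
  refine mul_le_mul_of_nonneg_right ?_ (by positivity)
  calc (1 / (2 * N) + 1) ^ i ≤ (Real.exp (1 / (2 * N))) ^ i := by
        gcongr; exact Real.add_one_le_exp _
    _ = Real.exp (i * (1 / (2 * N))) := by rw [← Real.exp_nat_mul]
    _ ≤ Real.exp (1 / 2) := by
        rw [Real.exp_le_exp, mul_one_div, div_le_div_iff₀ (by positivity) two_pos]
        linarith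
    _ ≤ 1.65 := by
        have h := Real.exp_one_lt_d9
        have h2 : Real.exp (1 / 2) ^ 2 = Real.exp 1 := by rw [← Real.exp_nat_mul]; norm_num
        nlinarith [Real.exp_pos (1 / 2)]

theorem PolyRep.shift {N : ℝ} {d : ℕ} {C : ℝ} {e : E} {p : ℝ → E} (hN : 0 < N)
    (hd : (d : ℝ) ≤ N) (hp : PolyRep N d C e p) :
    PolyRep N d (1.65 * C) e fun x => p (x - 1 / 2) := by
  obtain ⟨P, h1, h2, h3, h4⟩ := hp
  have := PolyRep.linear (s := 0) (K := 1.65) (τ := fun _ => 1) (d := d) hN.le h3 (by norm_num)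
    (q := fun i x => (x - 1 / 2) ^ i) fun i hi =>
      (polyRep_sub_half_pow hN.le i).mono
        (add_half_pow_le hN (le_trans (by exact_mod_cast hi) hd))
  rw [one_smul, h2] at this
  exact this.congr fun x => h4 _

/-- Polynomial versions of `2 sinh y` and `2 cosh y` for `y = m u ≤ 1/2`. The constants slightly
exceed the Taylor coefficients (`0.174 > 1/6`, `1.0437 > 1`), and this slack closes the joint
induction in which each bound feeds the other. -/
theorem pow_sub_pow_le {u : ℝ} (hu : 0 ≤ u) (m : ℕ) (hm : m * u ≤ 1 / 2) :
    (1 + u) ^ m - (1 - u) ^ m ≤ 2 * (m * u) * (1 + 0.174 * (m * u) ^ 2) ∧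
      (1 + u) ^ m + (1 - u) ^ m ≤ 2 + 1.0437 * (m * u) ^ 2 := by
  induction m with
  | zero => norm_num
  | succ m ih =>
    push_cast at hm
    have hmu : (m : ℝ) * u ≤ 1 / 2 := by nlinarith
    obtain ⟨h1, h2⟩ := ih hmu
    have hm0 : (0 : ℝ) ≤ m := m.cast_nonneg
    set D := (1 + u) ^ m - (1 - u) ^ m
    set S := (1 + u) ^ m + (1 - u) ^ m
    have e1 : (1 + u) ^ (m + 1) - (1 - u) ^ (m + 1) = D + u * S := by simp only [D, S]; ring
    have e2 : (1 + u) ^ (m + 1) + (1 - u) ^ (m + 1) = S + u * D := by simp only [D, S]; ring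
    rw [e1, e2]
    push_cast
    set y := (m : ℝ) * u with hy
    have hy0 : 0 ≤ y := by positivity
    have e3 : ((m : ℝ) + 1) * u = y + u := by rw [hy]; ring
    rw [e3]
    have h3 := mul_le_mul_of_nonneg_left h1 hu
    have h4 := mul_le_mul_of_nonneg_left h2 hu
    have h5 : y ^ 2 ≤ 1 / 4 := by nlinarith
    have h6 : 0 ≤ u * y ^ 2 := by positivity
    have h7 : 0 ≤ u ^ 2 * y := by positivity
    have h8 : 0 ≤ u ^ 3 := by positivity
    have h9 : u * y * y ^ 2 ≤ u * y * (1 / 4) := mul_le_mul_of_nonneg_left h5 (by positivity)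
    constructor
    · nlinarith
    · nlinarith [mul_nonneg hu hy0]

/-- Coefficients of the central difference of `x ^ (j + 1) / (j + 1)`. -/
def centralCoeff (j i : ℕ) : ℝ :=
  (j + 1).choose i * (1 / 2) ^ (j + 1 - i) * (1 - (-1) ^ (j + 1 - i)) / (j + 1)

theorem centralCoeff_nonneg (j i : ℕ) : 0 ≤ centralCoeff j i := by
  unfold centralCoeff
  have : (0 : ℝ) ≤ 1 - (-1) ^ (j + 1 - i) := by
    rcases neg_one_pow_eq_or ℝ (j + 1 - i) with h | h <;> rw [h] <;> norm_num
  positivity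

theorem central_difference (j : ℕ) (x : ℝ) :
    (x + 1 / 2) ^ (j + 1) / (j + 1) - (x - 1 / 2) ^ (j + 1) / (j + 1) =
      x ^ j + ∑ i ∈ range j, centralCoeff j i * x ^ i := by
  have h1 : (x + 1 / 2) ^ (j + 1) / (j + 1) - (x - 1 / 2) ^ (j + 1) / (j + 1) =
      ∑ i ∈ range (j + 2), centralCoeff j i * x ^ i := by
    rw [add_pow, sub_eq_add_neg x, add_pow, ← sub_div, ← sum_sub_distrib, sum_div]
    refine sum_congr rfl fun i _ => ?_
    rw [centralCoeff, show (-(1 / 2) : ℝ) = (-1) * (1 / 2) by ring, mul_pow]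
    ring
  have h2 : centralCoeff j j = 1 := by
    have : (j : ℝ) + 1 ≠ 0 := by positivity
    simp [centralCoeff]
    field_simp
    norm_num
  have h3 : centralCoeff j (j + 1) = 0 := by simp [centralCoeff]
  rw [h1, sum_range_succ, sum_range_succ, h2, h3]
  ring

/-- The sum is the value at `x = N` of the central difference minus its leading term. The `sinh`
bound at `y ≤ 1/2` gives the ratio `1 + 0.174/4 = 1.0435`. -/
theorem sum_centralCoeff_le {N : ℝ} {j : ℕ} (hj : (j : ℝ) + 1 ≤ N) :
    ∑ i ∈ range j, centralCoeff j i * N ^ i ≤ 0.0435 * N ^ j := by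
  have hN : 0 < N := lt_of_lt_of_le (by positivity) hj
  have hj1 : (0 : ℝ) < j + 1 := by positivity
  have h1 := central_difference j N
  have hmu : ((j + 1 : ℕ) : ℝ) * (1 / (2 * N)) ≤ 1 / 2 := by
    push_cast
    rw [mul_one_div, div_le_div_iff₀ (by positivity) two_pos]; linarith
  have h2 := (pow_sub_pow_le (u := 1 / (2 * N)) (by positivity) (j + 1) hmu).1
  set y := ((j + 1 : ℕ) : ℝ) * (1 / (2 * N)) with hy
  have hy0 : 0 ≤ y := by positivity
  have h3 : (1 + 1 / (2 * N)) ^ (j + 1) - (1 - 1 / (2 * N)) ^ (j + 1) ≤ 2 * y * 1.0435 := by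
    refine h2.trans (mul_le_mul_of_nonneg_left ?_ (by positivity))
    nlinarith
  have e1 : (N + 1 / 2) = N * (1 + 1 / (2 * N)) := by field_simp
  have e2 : (N - 1 / 2) = N * (1 - 1 / (2 * N)) := by field_simp
  have h4 : (N + 1 / 2) ^ (j + 1) / (j + 1) - (N - 1 / 2) ^ (j + 1) / (j + 1) ≤
      1.0435 * N ^ j := by
    rw [e1, e2, mul_pow, mul_pow, ← sub_div, ← mul_sub, div_le_iff₀ hj1]
    refine (mul_le_mul_of_nonneg_left h3 (by positivity)).trans (le_of_eq ?_)
    rw [hy, pow_succ]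
    push_cast
    field_simp
  linarith

/-- The difference of `x^(j+1)/(j+1)` exceeds `x^j` by lower powers, which are removed with their
own antidifferences. The constant reproduces itself because `1 + 1.05 * 0.0435 ≤ 1.05`. -/
theorem exists_antidifference_pow {N : ℝ} (j : ℕ) (hj : (j : ℝ) + 1 ≤ N) :
    ∃ q : ℝ → ℝ, q 0 = 0 ∧ (∀ x, q (x + 1 / 2) - q (x - 1 / 2) = x ^ j) ∧
      PolyRep N (j + 1) (1.05 * N * N ^ j) (1 / ((j : ℝ) + 1)) q := by
  induction j using Nat.strong_induction_on with
  | _ j ih =>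
    have hj1 : (0 : ℝ) < j + 1 := by positivity
    have hN : 0 < N := lt_of_lt_of_le hj1 hj
    have hlt : ∀ i, i < j → (i : ℝ) + 1 ≤ N := fun i hi => by
      have : (i : ℝ) < j := by exact_mod_cast hi
      linarith
    have ih' : ∀ i, ∃ q : ℝ → ℝ, i < j → q 0 = 0 ∧ (∀ x, q (x + 1 / 2) - q (x - 1 / 2) = x ^ i) ∧
      PolyRep N (i + 1) (1.05 * N * N ^ i) (1 / ((i : ℝ) + 1)) q := by
      intro i
      by_cases hi : i < j
      · obtain ⟨q, hq⟩ := ih i hi (hlt i hi)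
        exact ⟨q, fun _ => hq⟩
      · exact ⟨0, fun h => absurd h hi⟩
    choose q hq using ih'
    refine ⟨fun x => x ^ (j + 1) • (1 / ((j : ℝ) + 1)) +
      ∑ i ∈ range j, q i x • (-centralCoeff j i), ?_, fun x => ?_, ?_⟩
    · simp only [smul_eq_mul]
      rw [sum_eq_zero fun i hi => by rw [(hq i (mem_range.1 hi)).1, zero_mul]]
      simp
    · have h1 : ∑ i ∈ range j, q i (x + 1 / 2) • (-centralCoeff j i) -
          ∑ i ∈ range j, q i (x - 1 / 2) • (-centralCoeff j i) =
          -∑ i ∈ range j, centralCoeff j i * x ^ i := by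
        rw [← sum_sub_distrib, ← sum_neg_distrib]
        refine sum_congr rfl fun i hi => ?_
        rw [← (hq i (mem_range.1 hi)).2.1 x, smul_eq_mul, smul_eq_mul]
        ring
      have h2 := central_difference j x
      simp only [smul_eq_mul] at h1 ⊢
      linear_combination h1 + h2
    · have h1 : ∀ i ∈ range j, PolyRep N (j + 1) (1.05 * N * N ^ i * ‖-centralCoeff j i‖) (0 : ℝ)
          fun x => q i x • (-centralCoeff j i) := fun i hi =>
        ((hq i (mem_range.1 hi)).2.2.smul_const _).lift (by have := mem_range.1 hi; omega)
      have h2 := (PolyRep.monomial N hN.le (j + 1) (1 / ((j : ℝ) + 1))).add hN.le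
        (PolyRep.sum hN.le _ h1)
      rw [sum_const_zero, add_zero] at h2
      refine h2.mono ?_
      have h3 : ∑ i ∈ range j, 1.05 * N * N ^ i * ‖-centralCoeff j i‖ =
          1.05 * N * ∑ i ∈ range j, centralCoeff j i * N ^ i := by
        rw [mul_sum]
        refine sum_congr rfl fun i _ => ?_
        rw [norm_neg, Real.norm_of_nonneg (centralCoeff_nonneg j i)]; ring
      have h4 : 1 / ((j : ℝ) + 1) ≤ 1 := by
        rw [div_le_one hj1]; linarith [(Nat.cast_nonneg j : (0 : ℝ) ≤ j)]
      have h5 := mul_le_mul_of_nonneg_left (sum_centralCoeff_le hj)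
        (show 0 ≤ 1.05 * N by positivity)
      rw [h3, Real.norm_of_nonneg (by positivity)]
      have h6 := mul_le_mul_of_nonneg_right h4 (show 0 ≤ N ^ (j + 1) by positivity)
      have h7 : 0 ≤ N ^ (j + 1) := by positivity
      have h8 : N * N ^ j = N ^ (j + 1) := by ring
      nlinarith

theorem PolyRep.exists_antidifference {N : ℝ} {d : ℕ} {C : ℝ} {e : E} {p : ℝ → E}
    (hd : (d : ℝ) + 1 ≤ N) (hp : PolyRep N d C e p) :
    ∃ q : ℝ → E, q 0 = 0 ∧ (∀ x, q (x + 1 / 2) - q (x - 1 / 2) = p x) ∧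
      PolyRep N (d + 1) (1.05 * N * C) ((1 / ((d : ℝ) + 1)) • e) q := by
  have hN : 0 < N := lt_of_lt_of_le (by positivity) hd
  obtain ⟨P, h1, h2, h3, h4⟩ := hp
  have hex : ∀ i, ∃ q : ℝ → ℝ, i ≤ d → q 0 = 0 ∧ (∀ x, q (x + 1 / 2) - q (x - 1 / 2) = x ^ i) ∧
      PolyRep N (i + 1) (1.05 * N * N ^ i) (1 / ((i : ℝ) + 1)) q := by
    intro i
    by_cases hi : i ≤ d
    · have : (i : ℝ) ≤ d := by exact_mod_cast hi
      obtain ⟨q, hq⟩ := exists_antidifference_pow (N := N) i (by linarith)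
      exact ⟨q, fun _ => hq⟩
    · exact ⟨0, fun h => absurd h hi⟩
  choose q hq using hex
  have hle : ∀ i ∈ range (d + 1), i ≤ d := fun i hi => by simpa [Nat.lt_succ_iff] using hi
  have := PolyRep.linear (s := 1) (K := 1.05 * N) (d := d) hN.le h3 (by positivity) (q := q)
    (τ := fun i => 1 / ((i : ℝ) + 1)) fun i hi => (hq i hi).2.2
  rw [h2] at this
  refine ⟨_, ?_, fun x => ?_, this⟩
  · exact sum_eq_zero fun i hi => by rw [(hq i (hle i hi)).1, zero_smul]
  · rw [h4, ← sum_sub_distrib]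
    exact sum_congr rfl fun i hi => by rw [← sub_smul, (hq i (hle i hi)).2.1]

end PolyRep

/-! ### The formal product of midpoint exponentials -/

section FormalProduct

open Finset PowerSeries

variable {E : Type*} [NormedRing E] [NormedAlgebra ℝ E]

/-- The exponent `∑ A j x ^ j h ^ (j + 1)` as a power series in the step size `h`. -/
def genSeries (A : ℕ → E) (x : ℝ) : PowerSeries E :=
  PowerSeries.mk fun l => Nat.casesOn l 0 fun j => x ^ j • A j

theorem coeff_zero_genSeries (A : ℕ → E) (x : ℝ) : coeff 0 (genSeries A x) = 0 := by
  rw [genSeries, coeff_mk]; rfl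

theorem coeff_succ_genSeries (A : ℕ → E) (x : ℝ) (j : ℕ) :
    coeff (j + 1) (genSeries A x) = x ^ j • A j := by
  rw [genSeries, coeff_mk]

/-- Homogeneity: a factor `h^(j+1)` comes with `x^j`, so `p` factors of total degree `l` in `h`
carry `x^(l-p)`. -/
theorem coeff_genSeries_pow (A : ℕ → E) (x : ℝ) (p l : ℕ) :
    coeff l (genSeries A x ^ p) = x ^ (l - p) • coeff l (genSeries A 1 ^ p) := by
  induction p generalizing l with
  | zero =>
    rcases eq_or_ne l 0 with rfl | h
    · simp
    · simp [coeff_one, h]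
  | succ p ih =>
    rw [pow_succ, pow_succ, coeff_mul, coeff_mul, smul_sum]
    refine sum_congr rfl fun ij hij => ?_
    rw [HasAntidiagonal.mem_antidiagonal] at hij
    obtain ⟨i, j⟩ := ij
    dsimp only at hij ⊢
    rcases j with _ | j
    · rw [coeff_zero_genSeries, coeff_zero_genSeries]; simp
    by_cases hip : i < p
    · rw [coeff_pow_eq_zero_of_lt (coeff_zero_genSeries A x) hip,
        coeff_pow_eq_zero_of_lt (coeff_zero_genSeries A 1) hip]
      simp
    · rw [ih, coeff_succ_genSeries, coeff_succ_genSeries, one_pow, one_smul,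
        smul_mul_smul_comm, ← pow_add]
      congr 2
      omega

/-- The power series in `h` of `exp (∑ A j x ^ j h ^ (j + 1))`. -/
def stepSeries (A : ℕ → E) (x : ℝ) : PowerSeries E := formalExp (genSeries A x)

theorem coeff_stepSeries (A : ℕ → E) (x : ℝ) (l : ℕ) :
    coeff l (stepSeries A x) = ∑ p ∈ range (l + 1),
      ((p.factorial : ℝ)⁻¹) • x ^ (l - p) • coeff l (genSeries A 1 ^ p) := by
  rw [stepSeries, coeff_formalExp_of_le (coeff_zero_genSeries A x) le_rfl]
  exact sum_congr rfl fun p _ => by rw [coeff_genSeries_pow]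

theorem coeff_zero_stepSeries (A : ℕ → E) (x : ℝ) : coeff 0 (stepSeries A x) = 1 := by
  rw [coeff_stepSeries]; simp

/-- The exponent at `-x` is minus the exponent at `x` with `h` replaced by `-h`. This is the time
symmetry of the midpoint rule. -/
theorem coeff_stepSeries_neg (A : ℕ → E) (x : ℝ) (l : ℕ) :
    coeff l (stepSeries A (-x)) = (-1 : ℝ) ^ l • coeff l (formalExp (-genSeries A x)) := by
  have h0 : coeff 0 (-genSeries A x) = 0 := by rw [map_neg, coeff_zero_genSeries, neg_zero]
  rw [coeff_stepSeries, coeff_formalExp_of_le h0 le_rfl, smul_sum]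
  refine sum_congr rfl fun p hp => ?_
  obtain ⟨m, rfl⟩ := Nat.exists_eq_add_of_le (show p ≤ l by simpa [Nat.lt_succ_iff] using hp)
  have h1 : coeff (p + m) ((-genSeries A x) ^ p) =
      (-1 : ℝ) ^ p • coeff (p + m) (genSeries A x ^ p) := by
    rw [neg_pow]
    rcases Nat.even_or_odd p with hp | hp <;> simp [hp.neg_one_pow]
  rw [h1, coeff_genSeries_pow A x, neg_pow x, Nat.add_sub_cancel_left]
  simp only [smul_smul]
  congr 1
  have : (-1 : ℝ) ^ p * (-1) ^ p = 1 := by rw [← mul_pow]; norm_num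
  rw [pow_add]
  linear_combination (-(p.factorial : ℝ)⁻¹ * (-1) ^ m * x ^ m) * this

/-- The formal product of `k` steps. -/
def prodSeries (A : ℕ → E) : ℕ → PowerSeries E
  | 0 => 1
  | k + 1 => stepSeries A (k + 1 / 2) * prodSeries A k

theorem coeff_zero_prodSeries (A : ℕ → E) (k : ℕ) : coeff 0 (prodSeries A k) = 1 := by
  induction k with
  | zero => simp [prodSeries]
  | succ k ih => rw [prodSeries, coeff_mul]; simp [coeff_zero_stepSeries, -coeff_zero_eq_constantCoeff, ih]

/-- The coefficients of `prodSeries`, extended to a negative number of steps by reflection. -/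
def intCoeff (A : ℕ → E) (n : ℕ) : ℤ → E
  | Int.ofNat k => coeff n (prodSeries A k)
  | Int.negSucc k => (-1 : ℝ) ^ n • coeff n (prodSeries A (k + 1))

theorem intCoeff_natCast (A : ℕ → E) (n k : ℕ) :
    intCoeff A n (k : ℤ) = coeff n (prodSeries A k) := rfl

theorem intCoeff_neg_natCast (A : ℕ → E) (n k : ℕ) :
    intCoeff A n (-(k : ℤ)) = (-1 : ℝ) ^ n • coeff n (prodSeries A k) := by
  rcases k with _ | k
  · change coeff n (prodSeries A 0) = _
    rw [prodSeries, coeff_one]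
    split_ifs with h <;> simp [h]
  · rfl

/-- The reflected continuation satisfies one recursion on all of `ℤ`. For negative `k` the reflected
step is the inverse of the last factor, with `h` replaced by `-h`, so it strips that factor off. -/
theorem intCoeff_add_one (A : ℕ → E) (n : ℕ) (k : ℤ) :
    intCoeff A n (k + 1) = ∑ ij ∈ antidiagonal n,
      coeff ij.1 (stepSeries A (k + 1 / 2)) * intCoeff A ij.2 k := by
  rcases k with k | k
  · change coeff n (prodSeries A (k + 1)) = _
    rw [prodSeries, coeff_mul]
    rfl
  · have h1 : Int.negSucc k + 1 = -(k : ℤ) := by rw [Int.negSucc_eq]; ring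
    have h2 : ((Int.negSucc k : ℤ) : ℝ) + 1 / 2 = -((k : ℝ) + 1 / 2) := by
      rw [Int.negSucc_eq]; push_cast; ring
    rw [h1, intCoeff_neg_natCast, h2]
    have h3 : prodSeries A k =
        formalExp (-genSeries A (k + 1 / 2)) * prodSeries A (k + 1) := by
      rw [prodSeries, ← mul_assoc, stepSeries,
        formalExp_neg_mul_formalExp (coeff_zero_genSeries A _), one_mul]
    rw [h3, coeff_mul, smul_sum]
    refine sum_congr rfl fun ij hij => ?_
    rw [HasAntidiagonal.mem_antidiagonal] at hij
    rw [coeff_stepSeries_neg]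
    change _ = _ * ((-1 : ℝ) ^ ij.2 • coeff ij.2 (prodSeries A (k + 1)))
    rw [smul_mul_smul_comm, ← pow_add, hij]

/-- Majorant coefficients of `stepSeries`. -/
def stepMajorant (A : ℕ → E) (l : ℕ) : ℝ :=
  ∑ p ∈ range (l + 1), ((p + 1).factorial : ℝ)⁻¹ * ‖coeff (l + 1) (genSeries A 1 ^ (p + 1))‖

theorem sum_stepMajorant_le (h1 : ‖(1 : E)‖ ≤ 1) {A : ℕ → E} {ρ C : ℝ} (hρ : 0 ≤ ρ)
    (hC : PSBound (genSeries A 1) ρ C) (n : ℕ) :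
    ∑ l ∈ range n, stepMajorant A l * ρ ^ (l + 1) ≤ Real.exp C - 1 := by
  calc ∑ l ∈ range n, stepMajorant A l * ρ ^ (l + 1)
      ≤ ∑ l ∈ range n, ∑ p ∈ range n,
          ((p + 1).factorial : ℝ)⁻¹ * (‖coeff (l + 1) (genSeries A 1 ^ (p + 1))‖ * ρ ^ (l + 1)) := by
        refine sum_le_sum fun l hl => ?_
        rw [stepMajorant, sum_mul]
        refine le_trans (le_of_eq (sum_congr rfl fun p _ => mul_assoc _ _ _)) ?_
        exact sum_le_sum_of_subset_of_nonneg
          (range_subset_range.2 (by have := mem_range.1 hl; omega)) fun _ _ _ => by positivity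
    _ = ∑ p ∈ range n, ((p + 1).factorial : ℝ)⁻¹ *
          ∑ l ∈ range n, ‖coeff (l + 1) (genSeries A 1 ^ (p + 1))‖ * ρ ^ (l + 1) := by
        rw [sum_comm]; simp_rw [mul_sum]
    _ ≤ ∑ p ∈ range n, C ^ (p + 1) / (p + 1).factorial := by
        refine sum_le_sum fun p _ => ?_
        rw [div_eq_inv_mul]
        refine mul_le_mul_of_nonneg_left ?_ (by positivity)
        refine le_trans ?_ (hC.pow h1 hρ (p + 1) (n + 1))
        rw [sum_range_succ' _ n]
        exact le_add_of_nonneg_right (by positivity)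
    _ ≤ Real.exp C - 1 := by
        have := Real.sum_le_exp_of_nonneg hC.nonneg (n + 1)
        rw [sum_range_succ'] at this
        simp at this ⊢
        linarith

/-- Only the linear term of the exponential reaches degree `l` in `x`, hence the leading coefficient
`A l`. The assumption `1 ≤ N` lets the lower powers of `N` be raised to `N ^ l`. -/
theorem polyRep_stepSeries (A : ℕ → E) {N : ℝ} (hN : 1 ≤ N) (l : ℕ) :
    PolyRep N l (N ^ l * stepMajorant A l) (A l) fun x => coeff (l + 1) (stepSeries A x) := by
  have hN0 : 0 ≤ N := zero_le_one.trans hN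
  set B : ℕ → E := fun p => ((p + 1).factorial : ℝ)⁻¹ • coeff (l + 1) (genSeries A 1 ^ (p + 1))
    with hB
  have h1 : ∀ p ∈ range (l + 1), PolyRep N l (‖B p‖ * N ^ l) (if p = 0 then A l else 0)
      fun x => x ^ (l - p) • B p := by
    intro p hp
    have hp' : p ≤ l := by simpa [Nat.lt_succ_iff] using hp
    have h := (PolyRep.monomial N hN0 (l - p) (B p)).mono
      (mul_le_mul_of_nonneg_left (pow_le_pow_right₀ hN (Nat.sub_le l p)) (norm_nonneg _))
    split_ifs with h0
    · subst h0
      have : B 0 = A l := by simp [hB, coeff_succ_genSeries]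
      rwa [Nat.sub_zero, this] at h ⊢
    · exact h.lift (by omega)
  have h2 := PolyRep.sum hN0 _ h1
  rw [sum_ite_eq' (range (l + 1)) 0 (fun _ => A l), if_pos (mem_range.2 (Nat.succ_pos l))] at h2
  refine (h2.mono ?_).congr fun x => ?_
  · rw [← sum_mul, mul_comm, stepMajorant]
    refine mul_le_mul_of_nonneg_left (sum_le_sum fun p _ => le_of_eq ?_) (by positivity)
    rw [hB, norm_smul, norm_inv, RCLike.norm_natCast]
  · rw [coeff_stepSeries, sum_range_succ', pow_zero, coeff_one, if_neg (Nat.succ_ne_zero l),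
      smul_zero, smul_zero, add_zero]
    refine sum_congr rfl fun p _ => ?_
    rw [smul_comm, Nat.add_sub_add_right]

/-- The Taylor coefficients of the solution of `U' = (∑ A j y ^ j) U`, `U 0 = 1`. -/
def solCoeff (A : ℕ → E) : ℕ → E
  | 0 => 1
  | n + 1 => (1 / ((n : ℝ) + 1)) • ∑ l : Fin (n + 1), A l * solCoeff A (n - l)
  decreasing_by omega

theorem solCoeff_succ (A : ℕ → E) (n : ℕ) :
    solCoeff A (n + 1) = (1 / ((n : ℝ) + 1)) • ∑ l ∈ range (n + 1), A l * solCoeff A (n - l) := by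
  rw [solCoeff, Finset.sum_range fun l => A l * solCoeff A (n - l)]

/-- The recursion gives the increment from `k` to `k + 1` as a polynomial in the midpoint `x = k +
1/2`, built from lower orders, so a central antidifference yields the next polynomial. The factor
`1.7325 = 1.65 * 1.05` is the cost of the shift times that of the antidifference; the smallness
condition on `C` keeps the bound `(N/ρ)^n` stable. -/
theorem exists_polyRep_intCoeff (h1 : ‖(1 : E)‖ ≤ 1) {A : ℕ → E} {ρ C : ℝ} (hρ : 0 < ρ)
    (hC : PSBound (genSeries A 1) ρ C) (hCρ : 1.7325 * (Real.exp C - 1) ≤ 1)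
    {N : ℝ} (hN : 1 ≤ N) (n : ℕ) (hn : (n : ℝ) ≤ N) :
    ∃ p : ℝ → E, PolyRep N n (N ^ n * (1 / ρ) ^ n) (solCoeff A n) p ∧
      ∀ k : ℤ, p k = intCoeff A n k := by
  induction n using Nat.strong_induction_on with
  | _ n ih =>
  rcases n with _ | n
  · refine ⟨fun _ => 1, ?_, fun k => ?_⟩
    · have := (PolyRep.monomial N (zero_le_one.trans hN) 0 (1 : E)).mono (D := 1) (by simpa using h1)
      simpa [solCoeff] using this
    · rcases k with k | k
      · exact (coeff_zero_prodSeries A k).symm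
      · change 1 = (-1 : ℝ) ^ 0 • coeff 0 (prodSeries A (k + 1))
        rw [coeff_zero_prodSeries]; simp
  · have hN0 : 0 < N := zero_lt_one.trans_le hN
    push_cast at hn
    have ih' : ∀ l, ∃ p : ℝ → E, l ≤ n → PolyRep N (n - l) (N ^ (n - l) * (1 / ρ) ^ (n - l))
        (solCoeff A (n - l)) p ∧ ∀ k : ℤ, p k = intCoeff A (n - l) k := by
      intro l
      have hle : ((n - l : ℕ) : ℝ) ≤ n := by exact_mod_cast Nat.sub_le n l
      obtain ⟨p, hp⟩ := ih (n - l) (by omega) (by linarith)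
      exact ⟨p, fun _ => hp⟩
    choose P hP using ih'
    have hle : ∀ l ∈ range (n + 1), l ≤ n := fun l hl => by simpa [Nat.lt_succ_iff] using hl
    have hg : ∀ l ∈ range (n + 1), PolyRep N n
        (1.65 * N ^ n * (1 / ρ) ^ (n + 1) * (stepMajorant A l * ρ ^ (l + 1)))
        (A l * solCoeff A (n - l))
        fun x => coeff (l + 1) (stepSeries A x) * P l (x - 1 / 2) := by
      intro l hl
      have hl' := hle l hl
      have hlr : ((n - l : ℕ) : ℝ) ≤ n := by exact_mod_cast Nat.sub_le n l
      have := (polyRep_stepSeries A hN l).mul hN0.le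
        ((hP l hl').1.shift hN0 (by linarith))
      rw [Nat.add_sub_cancel' hl'] at this
      refine this.mono (le_of_eq ?_)
      obtain ⟨m, rfl⟩ := Nat.exists_eq_add_of_le hl'
      rw [Nat.add_sub_cancel_left]
      have e : (1 / ρ) ^ (l + m + 1) * ρ ^ (l + 1) = (1 / ρ) ^ m := by
        rw [show l + m + 1 = m + (l + 1) by ring, pow_add, mul_assoc, ← mul_pow,
          one_div_mul_cancel hρ.ne', one_pow, mul_one]
      rw [← e]; ring
    have hg2 := PolyRep.sum hN0.le _ hg
    rw [← mul_sum] at hg2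
    obtain ⟨q, hq0, hq, hqr⟩ := (hg2.mono (mul_le_mul_of_nonneg_left
      (sum_stepMajorant_le h1 hρ.le hC (n + 1)) (by positivity))).exists_antidifference hn
    rw [← solCoeff_succ] at hqr
    refine ⟨q, hqr.mono ?_, ?_⟩
    · have h2 : 0 ≤ N ^ (n + 1) * (1 / ρ) ^ (n + 1) := by positivity
      have h3 := mul_le_mul_of_nonneg_left hCρ h2
      calc _ = N ^ (n + 1) * (1 / ρ) ^ (n + 1) * (1.7325 * (Real.exp C - 1)) := by
            rw [pow_succ N]; ring
        _ ≤ _ := by rwa [mul_one] at h3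
    · have hstep : ∀ k : ℤ, q ((k + 1 : ℤ) : ℝ) - q k =
          intCoeff A (n + 1) (k + 1) - intCoeff A (n + 1) k := by
        intro k
        have e1 := hq ((k : ℝ) + 1 / 2)
        rw [show (k : ℝ) + 1 / 2 + 1 / 2 = ((k + 1 : ℤ) : ℝ) by push_cast; ring,
          show (k : ℝ) + 1 / 2 - 1 / 2 = k by ring] at e1
        have e2 := intCoeff_add_one A (n + 1) k
        rw [Nat.sum_antidiagonal_eq_sum_range_succ_mk, sum_range_succ'] at e2
        dsimp only at e2
        rw [coeff_zero_stepSeries, one_mul, Nat.sub_zero] at e2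
        rw [e1, e2, add_sub_cancel_right]
        refine sum_congr rfl fun l hl => ?_
        rw [(hP l (hle l hl)).2, Nat.add_sub_add_right]
      -- Equal increments and a common value at `0` give equality on all integers, in both
      -- directions.
      intro k
      induction k using Int.induction_on with
      | zero =>
        have : intCoeff A (n + 1) 0 = 0 := by
          change coeff (n + 1) (prodSeries A 0) = 0
          rw [prodSeries, coeff_one, if_neg (Nat.succ_ne_zero n)]
        rw [this, Int.cast_zero, hq0]
      | succ i hi =>
        have := hstep i
        rw [hi] at this
        exact sub_left_injective this
      | pred i hi =>
        have := hstep (-(i : ℤ) - 1)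
        rw [sub_add_cancel, hi] at this
        exact sub_right_injective this

/-- Averaging the polynomial with its reflection leaves only the powers `k^(n-2m)`. The weight is
taken to be `N = n`, which turns the weighted norm bound into `n^(2m)`. -/
theorem exists_even_expansion (h1 : ‖(1 : E)‖ ≤ 1) {A : ℕ → E} {ρ C : ℝ} (hρ : 0 < ρ)
    (hC : PSBound (genSeries A 1) ρ C) (hCρ : 1.7325 * (Real.exp C - 1) ≤ 1)
    {n : ℕ} (hn : 1 ≤ n) :
    ∃ c : ℕ → E, c 0 = solCoeff A n ∧
      (∀ k : ℕ, 1 ≤ k → (1 / (k : ℝ)) ^ n • coeff n (prodSeries A k) =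
        ∑ m ∈ range ((n + 1) / 2), (1 / (k : ℝ) ^ 2) ^ m • c m) ∧
      ∀ m < (n + 1) / 2, ‖c m‖ ≤ (1 / ρ) ^ n * ((n : ℝ) ^ 2) ^ m := by
  have hnr : (1 : ℝ) ≤ n := by exact_mod_cast hn
  have hn0 : (0 : ℝ) < n := by linarith
  obtain ⟨p, ⟨P, -, hPn, hPb, hP⟩, hpk⟩ := exists_polyRep_intCoeff h1 hρ hC hCρ hnr n le_rfl
  -- At `k = 0` the product is empty. Without this, an even `n` would also contribute `m = n/2`, and
  -- for `n = 2M` the moment conditions would not remove that term.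
  have hP0 : coeff 0 P = 0 := by
    have e1 := hP 0
    have e2 := hpk 0
    rw [Int.cast_zero] at e2
    rw [sum_range_succ', sum_eq_zero fun i _ => by rw [zero_pow (Nat.succ_ne_zero i), zero_smul],
      pow_zero, one_smul, zero_add, e2] at e1
    rw [← e1]
    change coeff n (prodSeries A 0) = 0
    rw [prodSeries, coeff_one, if_neg (by omega)]
  refine ⟨fun m => coeff (n - 2 * m) P, by simpa using hPn, fun k hk => ?_, fun m hm => ?_⟩
  · have hk0 : (k : ℝ) ≠ 0 := by
      have : (1 : ℝ) ≤ k := by exact_mod_cast hk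
      linarith
    have e1 : p k = coeff n (prodSeries A k) := by
      have := hpk (k : ℤ); rwa [intCoeff_natCast, Int.cast_natCast] at this
    have e2 : (-1 : ℝ) ^ n • p (-k) = coeff n (prodSeries A k) := by
      have := hpk (-(k : ℤ))
      rw [intCoeff_neg_natCast, Int.cast_neg, Int.cast_natCast] at this
      rw [this, smul_smul, ← mul_pow]; norm_num
    have e3 : coeff n (prodSeries A k) = (1 / 2 : ℝ) • (p k + (-1 : ℝ) ^ n • p (-k)) := by
      rw [e1, e2, ← two_smul ℝ, smul_smul]; norm_num
    have e4 : coeff n (prodSeries A k) = ∑ m ∈ range (n + 1),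
        if Even m then (k : ℝ) ^ (n - m) • coeff (n - m) P else 0 := by
      rw [e3, hP, hP, smul_sum, ← sum_add_distrib, smul_sum, ← sum_range_reflect]
      refine sum_congr rfl fun m hm => ?_
      have hm' : m ≤ n := by simpa [Nat.lt_succ_iff] using hm
      rw [show n + 1 - 1 - m = n - m by omega]
      obtain ⟨i, rfl⟩ := Nat.exists_eq_add_of_le hm'
      rw [Nat.add_sub_cancel_left, smul_smul, ← add_smul, smul_smul]
      have hi : (-1 : ℝ) ^ i * (-1) ^ i = 1 := by rw [← mul_pow]; norm_num
      have hx : (1 / 2 : ℝ) * ((k : ℝ) ^ i + (-1) ^ (m + i) * (-(k : ℝ)) ^ i) =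
          (1 / 2) * (1 + (-1) ^ m) * (k : ℝ) ^ i := by
        rw [neg_pow, pow_add]
        linear_combination ((1 / 2) * (-1) ^ m * (k : ℝ) ^ i) * hi
      rw [hx]
      split_ifs with hev
      · rw [hev.neg_one_pow]; norm_num
      · rw [(Nat.not_even_iff_odd.1 hev).neg_one_pow]; norm_num
    rw [e4, sum_range_succ, Nat.sub_self, hP0, smul_zero, ite_self, add_zero, ← sum_filter,
      smul_sum]
    symm
    refine sum_nbij' (fun m => 2 * m) (fun m => m / 2) ?_ ?_ ?_ ?_ ?_
    · intro m hm; simp at hm ⊢; omega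
    · intro m hm
      simp only [Finset.mem_filter, Finset.mem_range] at hm ⊢
      obtain ⟨h, j, hj⟩ := hm
      omega
    · intro m _; simp
    · intro m hm
      simp only [Finset.mem_filter] at hm
      obtain ⟨h, j, hj⟩ := hm
      omega
    · intro m hm
      have hm' : 2 * m ≤ n := by simp at hm; omega
      obtain ⟨i, hi⟩ := Nat.exists_eq_add_of_le hm'
      rw [smul_smul]
      congr 1
      rw [hi, Nat.add_sub_cancel_left, pow_add, pow_mul, mul_assoc, ← mul_pow,
        one_div_mul_cancel hk0, one_pow, mul_one]
      simp
  · have hb := hPb.norm_coeff_le hn0.le (n - 2 * m)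
    have hm' : 2 * m ≤ n := by omega
    have e : (n : ℝ) ^ n = ((n : ℝ) ^ 2) ^ m * (n : ℝ) ^ (n - 2 * m) := by
      rw [← pow_mul, ← pow_add, Nat.add_sub_cancel' hm']
    rw [e] at hb
    have hpos : 0 < (n : ℝ) ^ (n - 2 * m) := by positivity
    refine le_of_mul_le_mul_right (hb.trans (le_of_eq ?_)) hpos
    ring

end FormalProduct

/-! ### Coefficients of multiproduct formulas -/

section MultiproductCoeff

open Finset

theorem factorial_card_le_prod (s : Finset ℕ) (hs : ∀ x ∈ s, 0 < x) :
    s.card.factorial ≤ ∏ x ∈ s, x := by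
  induction s using Finset.induction_on_max with
  | empty => simp
  | insert a s ha ih =>
    have hna : a ∉ s := fun h => lt_irrefl _ (ha a h)
    rw [card_insert_of_notMem hna, prod_insert hna, Nat.factorial_succ]
    refine Nat.mul_le_mul ?_ (ih fun x hx => hs x (mem_insert_of_mem hx))
    have hsub : insert a s ⊆ Finset.Icc 1 a := by
      intro x hx
      rw [Finset.mem_Icc]
      refine ⟨hs x hx, ?_⟩
      rcases mem_insert.1 hx with rfl | h
      · exact le_rfl
      · exact (ha x h).le
    simpa [card_insert_of_notMem hna] using Finset.card_le_card hsub

/-- The central binomial coefficient is the largest in its row. -/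
theorem sq_factorial_le_factorial_mul {a b M : ℕ} (h : a + b = 2 * M) :
    M.factorial ^ 2 ≤ a.factorial * b.factorial := by
  have h1 := Nat.choose_le_centralBinom a M
  have h2 := Nat.choose_mul_factorial_mul_factorial (show a ≤ 2 * M by omega)
  have h3 := Nat.choose_mul_factorial_mul_factorial (show M ≤ 2 * M by omega)
  rw [show 2 * M - a = b by omega] at h2
  rw [show 2 * M - M = M by omega, ← Nat.centralBinom_eq_two_mul_choose] at h3
  have h4 := Nat.choose_pos (show a ≤ 2 * M by omega)
  refine Nat.le_of_mul_le_mul_left ?_ (Nat.centralBinom_pos M)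
  calc M.centralBinom * M.factorial ^ 2 = (2 * M).choose a * (a.factorial * b.factorial) := by
        rw [← mul_assoc, h2, ← h3]; ring
    _ ≤ _ := Nat.mul_le_mul_right _ h1

/-- Among the positive members, and among the negative ones, absolute values are distinct. Each
group thus contributes at least the factorial of its size. -/
theorem sq_factorial_le_prod_natAbs (Z : Finset ℤ) (hZ : ∀ z ∈ Z, z ≠ 0) {M : ℕ}
    (hM : Z.card = 2 * M) : M.factorial ^ 2 ≤ ∏ z ∈ Z, z.natAbs := by
  have hp := prod_filter_mul_prod_filter_not Z (fun z => 0 < z) fun z => z.natAbs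
  have hc := card_filter_add_card_filter_not (s := Z) (fun z => 0 < z)
  have key : ∀ Y : Finset ℤ, (∀ z ∈ Y, z ≠ 0) → Set.InjOn Int.natAbs (Y : Set ℤ) →
      Y.card.factorial ≤ ∏ z ∈ Y, z.natAbs := by
    intro Y h0 hinj
    have := factorial_card_le_prod (Y.image Int.natAbs) fun x hx => by
      obtain ⟨z, hz, rfl⟩ := mem_image.1 hx
      exact Int.natAbs_pos.2 (h0 z hz)
    rwa [card_image_of_injOn hinj, prod_image hinj] at this
  rw [← hp]
  refine (sq_factorial_le_factorial_mul (hc.trans hM)).trans (Nat.mul_le_mul ?_ ?_)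
  · refine key _ (fun z hz => hZ z (mem_filter.1 hz).1) fun x hx y hy hxy => ?_
    have hx' := (mem_filter.1 (mem_coe.1 hx)).2
    have hy' := (mem_filter.1 (mem_coe.1 hy)).2
    omega
  · refine key _ (fun z hz => hZ z (mem_filter.1 hz).1) fun x hx y hy hxy => ?_
    have hx' := (mem_filter.1 (mem_coe.1 hx)).2
    have hy' := (mem_filter.1 (mem_coe.1 hy)).2
    have hx0 := hZ x (mem_filter.1 (mem_coe.1 hx)).1
    have hy0 := hZ y (mem_filter.1 (mem_coe.1 hy)).1
    omega

/-- The `2M` integers `k_j`, `2 k_j` and `k_j ± k_i` for `i ≠ j` are distinct and nonzero; their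
product is, up to sign, the right-hand side. In `φ` the value `k_j` replaces the zero difference at
`i = j`. -/
theorem sq_factorial_le_prod_sq_sub {M : ℕ} {k : Fin M → ℕ} (hk : ∀ j, 0 < k j)
    (hinj : Function.Injective k) (j : Fin M) :
    ((M.factorial : ℝ)) ^ 2 ≤
      2 * (k j : ℝ) ^ 2 * ∏ i ∈ univ.erase j, |(k j : ℝ) ^ 2 - (k i : ℝ) ^ 2| := by
  set φ : Fin M ⊕ Fin M → ℤ :=
    Sum.elim (fun i => if i = j then (k j : ℤ) else k j - k i) fun i => k j + k i with hφ
  have hne : ∀ i, i ≠ j → k i ≠ k j := fun i hi h => hi (hinj h)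
  have hφinj : Function.Injective φ := by
    rintro (x | x) (y | y) h <;> simp only [hφ, Sum.elim_inl, Sum.elim_inr] at h
    · congr 1
      have hx := hk x
      have hy := hk y
      split_ifs at h with h1 h2 h2
      · rw [h1, h2]
      · omega
      · omega
      · exact hinj (by omega)
    · have hx := hk x
      have hy := hk y
      split_ifs at h <;> omega
    · have hx := hk x
      have hy := hk y
      split_ifs at h <;> omega
    · congr 1
      exact hinj (by omega)
  have hφ0 : ∀ x, φ x ≠ 0 := by
    have hj := hk j
    rintro (x | x) <;> simp only [hφ, Sum.elim_inl, Sum.elim_inr]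
    · split_ifs with h
      · omega
      · have := hne x h; omega
    · omega
  have h1 := sq_factorial_le_prod_natAbs (univ.image φ)
    (fun z hz => by obtain ⟨x, -, rfl⟩ := mem_image.1 hz; exact hφ0 x) (M := M)
    (by rw [card_image_of_injective _ hφinj, card_univ, Fintype.card_sum, Fintype.card_fin]; ring)
  rw [prod_image hφinj.injOn, Fintype.prod_sum_type] at h1
  have h2 : ((M.factorial : ℝ)) ^ 2 ≤ (∏ x, |((φ (Sum.inl x) : ℤ) : ℝ)|) *
      ∏ x, |((φ (Sum.inr x) : ℤ) : ℝ)| := by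
    have : ((M.factorial ^ 2 : ℕ) : ℝ) ≤ _ := Nat.cast_le.2 h1
    push_cast [Nat.cast_natAbs] at this
    exact this
  refine h2.trans (le_of_eq ?_)
  rw [← prod_mul_distrib, ← mul_prod_erase univ _ (mem_univ j)]
  congr 1
  · simp only [hφ, Sum.elim_inl, Sum.elim_inr, if_true]
    push_cast
    rw [Nat.abs_cast, abs_of_nonneg (by positivity)]
    ring
  · refine prod_congr rfl fun i hi => ?_
    have hi' := (mem_erase.1 hi).1
    simp only [hφ, Sum.elim_inl, Sum.elim_inr, if_neg hi']
    rw [← abs_mul]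
    congr 1
    push_cast
    ring

variable {M : ℕ} {a : Fin M → ℝ} {k : Fin M → ℕ}

theorem IsMultiproductCoeff.sum_eval (h : IsMultiproductCoeff a k)
    {Q : Polynomial ℝ} (hQ : Q.natDegree < M) :
    ∑ j, a j * Q.eval (1 / (k j : ℝ) ^ 2) = Q.eval 0 := by
  simp_rw [Polynomial.eval_eq_sum_range' hQ, mul_sum]
  rw [sum_comm]
  refine sum_congr rfl fun m hm => ?_
  have h1 := h.2 ⟨m, mem_range.1 hm⟩
  dsimp only at h1
  have h2 : ∑ j, a j * (Q.coeff m * (1 / (k j : ℝ) ^ 2) ^ m) =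
      Q.coeff m * ∑ j, a j / (k j : ℝ) ^ (2 * m) := by
    rw [mul_sum]
    refine sum_congr rfl fun j _ => ?_
    rw [one_div, inv_pow, ← pow_mul]; ring
  rw [h2, h1]
  split_ifs with h0 <;> simp [h0]

theorem IsMultiproductCoeff.sum_mul_pow (h : IsMultiproductCoeff a k) {m : ℕ} (hm : m < M) :
    ∑ j, a j * (1 / (k j : ℝ) ^ 2) ^ m = if m = 0 then 1 else 0 := by
  rw [← h.2 ⟨m, hm⟩]
  refine sum_congr rfl fun j _ => ?_
  rw [one_div, inv_pow, ← pow_mul]; rfl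

/-- The weights `a` evaluate polynomials of degree below `M` at `0` from the nodes `1/k_i²`. The
polynomial `∏_{i ≠ j} (1 - k_i² x)` equals `1` at `0` and vanishes at every node other than the
`j`-th. -/
theorem IsMultiproductCoeff.mul_prod_eq (h : IsMultiproductCoeff a k) (hM : 1 ≤ M) (j : Fin M) :
    a j * ∏ i ∈ univ.erase j, ((k j : ℝ) ^ 2 - (k i : ℝ) ^ 2) = ((k j : ℝ) ^ 2) ^ (M - 1) := by
  have hk : ∀ i, (k i : ℝ) ≠ 0 := fun i => Nat.cast_ne_zero.2 (h.1 i).ne'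
  set Q : Polynomial ℝ := ∏ i ∈ univ.erase j,
    (Polynomial.C (-(k i : ℝ) ^ 2) * Polynomial.X + Polynomial.C 1) with hQ
  have hcard : (univ.erase j).card = M - 1 := by
    rw [card_erase_of_mem (mem_univ j), card_univ, Fintype.card_fin]
  have hdeg : Q.natDegree < M := by
    refine lt_of_le_of_lt ((Polynomial.natDegree_prod_le _ _).trans
      (sum_le_card_nsmul _ _ 1 fun i _ => Polynomial.natDegree_linear_le)) ?_
    rw [hcard, smul_eq_mul, mul_one]
    omega
  have hev : ∀ x, Q.eval x = ∏ i ∈ univ.erase j, (-(k i : ℝ) ^ 2 * x + 1) := fun x => by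
    rw [hQ, Polynomial.eval_prod]
    simp
  have h1 := h.sum_eval hdeg
  rw [hev 0, prod_congr rfl fun i _ => by rw [mul_zero, zero_add], prod_const_one,
    sum_eq_single j] at h1
  · rw [hev] at h1
    have h2 : ∏ i ∈ univ.erase j, ((k j : ℝ) ^ 2 - (k i : ℝ) ^ 2) =
        ((k j : ℝ) ^ 2) ^ (M - 1) *
          ∏ i ∈ univ.erase j, (-(k i : ℝ) ^ 2 * (1 / (k j : ℝ) ^ 2) + 1) := by
      rw [← hcard, ← prod_const, ← prod_mul_distrib]
      refine prod_congr rfl fun i _ => ?_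
      have := hk j
      field_simp
      ring
    rw [h2, mul_left_comm, h1, mul_one]
  · intro i _ hij
    rw [hev, prod_eq_zero (mem_erase.2 ⟨hij, mem_univ i⟩), mul_zero]
    have := hk i
    field_simp
    ring
  · simp

/-- A repeated node would annihilate the left side of `mul_prod_eq`, whose right side is positive.
-/
theorem IsMultiproductCoeff.injective (h : IsMultiproductCoeff a k) (hM : 1 ≤ M) :
    Function.Injective k := by
  intro i j hij
  by_contra hne
  have h1 := h.mul_prod_eq hM j
  rw [prod_eq_zero (mem_erase.2 ⟨hne, mem_univ i⟩) (by rw [hij, sub_self]), mul_zero] at h1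
  have : (k j : ℝ) ≠ 0 := Nat.cast_ne_zero.2 (h.1 j).ne'
  exact (pow_ne_zero _ (pow_ne_zero _ this)) h1.symm

theorem IsMultiproductCoeff.abs_mul_sq_factorial_le (h : IsMultiproductCoeff a k) (hM : 1 ≤ M)
    (j : Fin M) : |a j| * (1 / (k j : ℝ) ^ 2) ^ M ≤ 2 / (M.factorial : ℝ) ^ 2 := by
  have hk : (0 : ℝ) < k j := Nat.cast_pos.2 (h.1 j)
  have h1 := sq_factorial_le_prod_sq_sub h.1 (h.injective hM) j
  have h2 := congrArg abs (h.mul_prod_eq hM j)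
  rw [abs_mul, abs_prod, abs_of_nonneg (by positivity : (0 : ℝ) ≤ ((k j : ℝ) ^ 2) ^ (M - 1))] at h2
  have h3 := mul_le_mul_of_nonneg_left h1 (abs_nonneg (a j))
  rw [mul_left_comm, h2, mul_assoc, ← pow_succ', Nat.sub_add_cancel hM] at h3
  rw [le_div_iff₀ (by positivity), one_div, inv_pow, mul_assoc, mul_comm (_⁻¹), ← mul_assoc,
    ← div_eq_mul_inv, div_le_iff₀ (by positivity)]
  exact h3

theorem IsMultiproductCoeff.sum_abs_mul_le (h : IsMultiproductCoeff a k) (hM : 1 ≤ M) :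
    ∑ j, |a j| * (1 / (k j : ℝ) ^ 2) ^ M ≤ 2 * M / (M.factorial : ℝ) ^ 2 := by
  refine (sum_le_card_nsmul _ _ _ fun j _ => h.abs_mul_sq_factorial_le hM j).trans (le_of_eq ?_)
  rw [card_univ, Fintype.card_fin, nsmul_eq_mul]; ring

/-- Combines `(2M)! ≤ 4^M (M!)²` with `n^(2M)/(2M)! ≤ exp n`. -/
theorem pow_div_sq_factorial_le (M n : ℕ) :
    ((n : ℝ) ^ 2) ^ M / (M.factorial : ℝ) ^ 2 ≤ 4 ^ M * Real.exp n := by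
  have h1 : ((2 * M).factorial : ℝ) ≤ 4 ^ M * (M.factorial : ℝ) ^ 2 := by
    have h3 := Nat.choose_mul_factorial_mul_factorial (show M ≤ 2 * M by omega)
    rw [show 2 * M - M = M by omega, ← Nat.centralBinom_eq_two_mul_choose] at h3
    have h4 := Nat.centralBinom_le_four_pow M
    have : (2 * M).factorial ≤ 4 ^ M * M.factorial ^ 2 := by
      rw [← h3, mul_assoc, ← sq]; exact Nat.mul_le_mul_right _ h4
    exact_mod_cast this
  have h2 := Real.pow_div_factorial_le_exp (n : ℝ) n.cast_nonneg (2 * M)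
  rw [div_le_iff₀ (by positivity)] at h2 ⊢
  rw [← pow_mul]
  calc (n : ℝ) ^ (2 * M) ≤ Real.exp n * (2 * M).factorial := h2
    _ ≤ Real.exp n * (4 ^ M * (M.factorial : ℝ) ^ 2) := by gcongr
    _ = _ := by ring

theorem IsMultiproductCoeff.one_le_l1Norm (h : IsMultiproductCoeff a k) (hM : 1 ≤ M) :
    1 ≤ l1Norm a := by
  have h0 := h.sum_mul_pow (m := 0) hM
  simp only [pow_zero, mul_one, if_true] at h0
  rw [← h0]
  exact sum_le_sum fun j _ => le_abs_self _

end MultiproductCoeff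

/-! ### Error of one multiproduct step in normalized form -/

section NormalizedStep

open Finset PowerSeries

variable {E : Type*} [NormedRing E] [NormedAlgebra ℝ E]

theorem psBound_genSeries {A : ℕ → E} (hA : ∀ j, ‖A j‖ ≤ 1 / j.factorial) {x h : ℝ}
    (hx : 0 ≤ x) (hh : 0 ≤ h) : PSBound (genSeries A x) h (h * Real.exp (x * h)) := by
  intro n
  have hpos : 0 ≤ h * Real.exp (x * h) := by positivity
  rcases n with _ | n
  · simpa using hpos
  rw [sum_range_succ', coeff_zero_genSeries, norm_zero, zero_mul, add_zero]
  refine le_trans ?_ (mul_le_mul_of_nonneg_left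
    (Real.sum_le_exp_of_nonneg (mul_nonneg hx hh) n) hh)
  rw [mul_sum]
  refine sum_le_sum fun j _ => ?_
  rw [coeff_succ_genSeries, norm_smul, norm_pow, Real.norm_of_nonneg hx]
  calc x ^ j * ‖A j‖ * h ^ (j + 1) ≤ x ^ j * (1 / j.factorial) * h ^ (j + 1) := by
        gcongr; exact hA j
    _ = _ := by rw [mul_pow]; ring

theorem psBound_prodSeries (h1 : ‖(1 : E)‖ ≤ 1) {A : ℕ → E} (hA : ∀ j, ‖A j‖ ≤ 1 / j.factorial)
    {h y : ℝ} (hh : 0 ≤ h) (k : ℕ) (hy : k * h ≤ y) :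
    PSBound (prodSeries A k) h (Real.exp (k * (h * Real.exp y))) := by
  induction k with
  | zero => simpa [prodSeries] using PSBound.one h1 h
  | succ k ih =>
    push_cast at hy
    have e : ((k + 1 : ℕ) : ℝ) * (h * Real.exp y) =
        h * Real.exp y + k * (h * Real.exp y) := by push_cast; ring
    rw [prodSeries, e, Real.exp_add]
    refine PSBound.mul hh ?_ (ih (by linarith))
    refine (PSBound.formalExp h1 hh (coeff_zero_genSeries A _)
      (psBound_genSeries hA (by positivity) hh)).mono ?_
    gcongr
    linarith

/-- A Cauchy estimate at step size `ρ/k`: the total length is `ρ` whatever `k` is, so the bound is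
uniform in `k`. -/
theorem norm_coeff_prodSeries_le (h1 : ‖(1 : E)‖ ≤ 1) {A : ℕ → E}
    (hA : ∀ j, ‖A j‖ ≤ 1 / j.factorial) {ρ : ℝ} (hρ : 0 < ρ) {k : ℕ} (hk : 1 ≤ k) (n : ℕ) :
    ‖(1 / (k : ℝ)) ^ n • coeff n (prodSeries A k)‖ ≤
      Real.exp (ρ * Real.exp ρ) * (1 / ρ) ^ n := by
  have hk0 : (0 : ℝ) < k := by exact_mod_cast hk
  have h2 := (psBound_prodSeries h1 hA (h := ρ / k) (y := ρ) (by positivity) k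
    (le_of_eq (by field_simp))).norm_coeff_le (by positivity) n
  have e : (k : ℝ) * (ρ / k * Real.exp ρ) = ρ * Real.exp ρ := by field_simp
  rw [e] at h2
  rw [norm_smul, norm_pow, Real.norm_of_nonneg (by positivity)]
  have h3 := mul_le_mul_of_nonneg_right h2 (show 0 ≤ (1 / ρ) ^ n by positivity)
  refine le_trans (le_of_eq ?_) h3
  rw [mul_assoc, ← mul_pow, show ρ / k * (1 / ρ) = 1 / k by field_simp, mul_comm]

theorem norm_solCoeff_le (h1 : ‖(1 : E)‖ ≤ 1) {A : ℕ → E} (hA : ∀ j, ‖A j‖ ≤ 1 / j.factorial)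
    (n : ℕ) : ‖solCoeff A n‖ ≤ 1 := by
  induction n using Nat.strong_induction_on with
  | _ n ih =>
  rcases n with _ | n
  · simpa [solCoeff] using h1
  rw [solCoeff_succ, norm_smul, Real.norm_of_nonneg (by positivity), one_div,
    inv_mul_le_iff₀ (by positivity), mul_one]
  refine (norm_sum_le _ _).trans ((sum_le_card_nsmul _ _ 1 fun l hl => ?_).trans (le_of_eq ?_))
  · refine (norm_mul_le _ _).trans (mul_le_one₀ ((hA l).trans ?_) (norm_nonneg _)
      (ih _ (by omega)))
    rw [div_le_one (by positivity)]
    exact_mod_cast Nat.one_le_iff_ne_zero.2 (Nat.factorial_ne_zero l)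
  · simp

/-- The `n`-th coefficient of the error of one multiproduct step. -/
def errCoeff {M : ℕ} (A : ℕ → E) (a : Fin M → ℝ) (k : Fin M → ℕ) (n : ℕ) : E :=
  ∑ j, a j • (1 / (k j : ℝ)) ^ n • coeff n (prodSeries A (k j)) - solCoeff A n

/-- The radius `0.32` is admissible in `exists_even_expansion` because `1.7325 * 0.577 ≤ 1`. -/
theorem exp_032_le : Real.exp (0.32 * Real.exp 0.32) ≤ 1.577 := by
  have h1 : Real.exp 0.32 ≤ 1.38 := by
    refine (Real.exp_bound' (n := 4) (by norm_num) (by norm_num) (by norm_num)).trans ?_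
    norm_num [sum_range_succ, Nat.factorial]
  have h2 : Real.exp 0.4416 ≤ 1.577 := by
    refine (Real.exp_bound' (n := 4) (by norm_num) (by norm_num) (by norm_num)).trans ?_
    norm_num [sum_range_succ, Nat.factorial]
  refine le_trans (Real.exp_le_exp.2 ?_) h2
  linarith

theorem exp_half_le : Real.exp (1 / 2 * Real.exp (1 / 2)) ≤ 2.29 := by
  have h1 : Real.exp (1 / 2) ≤ 1.65 := by
    refine (Real.exp_bound' (n := 5) (by norm_num) (by norm_num) (by norm_num)).trans ?_
    norm_num [sum_range_succ, Nat.factorial]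
  have h2 : Real.exp 0.825 ≤ 2.29 := by
    refine (Real.exp_bound' (n := 6) (by norm_num) (by norm_num) (by norm_num)).trans ?_
    norm_num [sum_range_succ, Nat.factorial]
  refine le_trans (Real.exp_le_exp.2 ?_) h2
  linarith

theorem exists_even_expansion_of_norm_le (h1 : ‖(1 : E)‖ ≤ 1) {A : ℕ → E}
    (hA : ∀ j, ‖A j‖ ≤ 1 / j.factorial) {n : ℕ} (hn : 1 ≤ n) :
    ∃ c : ℕ → E, c 0 = solCoeff A n ∧
      (∀ k : ℕ, 1 ≤ k → (1 / (k : ℝ)) ^ n • coeff n (prodSeries A k) =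
        ∑ m ∈ range ((n + 1) / 2), (1 / (k : ℝ) ^ 2) ^ m • c m) ∧
      ∀ m < (n + 1) / 2, ‖c m‖ ≤ (1 / 0.32) ^ n * ((n : ℝ) ^ 2) ^ m := by
  have hC := psBound_genSeries hA (x := 1) (h := 0.32) (by norm_num) (by norm_num)
  rw [one_mul] at hC
  refine exists_even_expansion h1 (by norm_num) hC ?_ hn
  have := exp_032_le
  linarith

variable {M : ℕ} {a : Fin M → ℝ} {k : Fin M → ℕ}

theorem sum_smul_expansion (hak : IsMultiproductCoeff a k) (hM : 1 ≤ M) (c : ℕ → E) {D : ℕ}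
    (hD : 1 ≤ D) (hDM : D ≤ M) :
    ∑ j, a j • ∑ m ∈ range D, (1 / (k j : ℝ) ^ 2) ^ m • c m = c 0 := by
  simp_rw [smul_sum, smul_smul]
  rw [sum_comm]
  simp_rw [← sum_smul]
  rw [sum_eq_single_of_mem 0 (mem_range.2 hD)]
  · rw [hak.sum_mul_pow hM, if_pos rfl, one_smul]
  · intro m hm hm0
    rw [hak.sum_mul_pow ((mem_range.1 hm).trans_le hDM), if_neg hm0, zero_smul]

/-- For `1 ≤ n ≤ 2M` the even expansion has `(n + 1)/2 ≤ M` terms, so the moment conditions leave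
only its constant term, the exact coefficient. -/
theorem errCoeff_eq_zero (h1 : ‖(1 : E)‖ ≤ 1) {A : ℕ → E} (hA : ∀ j, ‖A j‖ ≤ 1 / j.factorial)
    (hak : IsMultiproductCoeff a k) (hM : 1 ≤ M) {n : ℕ} (hn : n < 2 * M + 1) :
    errCoeff A a k n = 0 := by
  rcases Nat.eq_zero_or_pos n with rfl | hn0
  · have h0 := hak.sum_mul_pow (m := 0) hM
    simp only [pow_zero, mul_one, if_true] at h0
    simp_rw [errCoeff, coeff_zero_prodSeries, pow_zero, one_smul, ← sum_smul, h0, one_smul]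
    rw [solCoeff, sub_self]
  · obtain ⟨c, hc0, hc, -⟩ := exists_even_expansion_of_norm_le h1 hA hn0
    rw [errCoeff, sum_congr rfl fun j _ => by rw [hc (k j) (hak.1 j)],
      sum_smul_expansion hak hM c (by omega) (by omega), hc0, sub_self]

theorem norm_errCoeff_le (h1 : ‖(1 : E)‖ ≤ 1) {A : ℕ → E} (hA : ∀ j, ‖A j‖ ≤ 1 / j.factorial)
    (hak : IsMultiproductCoeff a k) (hM : 1 ≤ M) {n : ℕ} (hn : 3 ≤ n) :
    ‖errCoeff A a k n‖ ≤ 2.5 * l1Norm a * 2 ^ n := by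
  have h2 : ∀ j, ‖(1 / (k j : ℝ)) ^ n • coeff n (prodSeries A (k j))‖ ≤ 2.29 * 2 ^ n := fun j => by
    refine (norm_coeff_prodSeries_le h1 hA (ρ := 1 / 2) (by norm_num) (hak.1 j) n).trans ?_
    have := exp_half_le
    norm_num at this ⊢
    linarith
  have h3 : ‖∑ j, a j • (1 / (k j : ℝ)) ^ n • coeff n (prodSeries A (k j))‖ ≤
      l1Norm a * (2.29 * 2 ^ n) := by
    refine (norm_sum_le _ _).trans ?_
    rw [l1Norm, sum_mul]
    refine sum_le_sum fun j _ => ?_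
    rw [norm_smul, Real.norm_eq_abs]
    exact mul_le_mul_of_nonneg_left (h2 j) (abs_nonneg _)
  have h4 := norm_solCoeff_le h1 hA n
  have h5 := hak.one_le_l1Norm hM
  have h6 : (8 : ℝ) ≤ 2 ^ n := by
    calc (8 : ℝ) = 2 ^ 3 := by norm_num
      _ ≤ 2 ^ n := pow_le_pow_right₀ (by norm_num) hn
  refine (norm_sub_le _ _).trans ?_
  nlinarith

/-- If `x y ≤ 0.8`, the tail is geometric. Otherwise `1.25 x y > 1`, and bounding `v` and the first
`M` terms separately costs `2 + 5 = 7`. Either way the factor `y ^ M` appears, which later pairs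
with `|a j|`. -/
theorem norm_expansion_remainder_le {c : ℕ → E} {v : E} {b x y : ℝ} {D M : ℕ} (hb : 0 ≤ b)
    (hx : 0 ≤ x) (hy : 0 ≤ y) (hMD : M ≤ D) (hc : ∀ m < D, ‖c m‖ ≤ b * x ^ m)
    (hv : v = ∑ m ∈ range D, y ^ m • c m) (hvb : ‖v‖ ≤ 2 * b) :
    ‖v - ∑ m ∈ range M, y ^ m • c m‖ ≤ 7 * b * (1.25 * x) ^ M * y ^ M := by
  have hterm : ∀ m < D, ‖y ^ m • c m‖ ≤ b * (x * y) ^ m := fun m hm => by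
    rw [norm_smul, norm_pow, Real.norm_of_nonneg hy, mul_pow]
    calc y ^ m * ‖c m‖ ≤ y ^ m * (b * x ^ m) := by gcongr; exact hc m hm
      _ = _ := by ring
  set t := x * y with ht
  have ht0 : 0 ≤ t := mul_nonneg hx hy
  have e : 7 * b * (1.25 * x) ^ M * y ^ M = 7 * b * (1.25 * t) ^ M := by
    rw [ht, mul_assoc, ← mul_pow, mul_assoc 1.25]
  rw [e]
  rcases le_or_gt t 0.8 with h | h
  · have h2 : v - ∑ m ∈ range M, y ^ m • c m = ∑ m ∈ Finset.Ico M D, y ^ m • c m := by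
      rw [hv, sum_Ico_eq_sub _ hMD]
    rw [h2, sum_Ico_eq_sum_range]
    have h3 : ‖∑ i ∈ range (D - M), y ^ (M + i) • c (M + i)‖ ≤
        ∑ i ∈ range (D - M), b * t ^ M * 0.8 ^ i := by
      refine norm_sum_le_of_le _ fun i hi => ?_
      refine (hterm (M + i) (by have := mem_range.1 hi; omega)).trans ?_
      rw [pow_add, ← mul_assoc]
      gcongr
    have h4 : ∑ i ∈ range (D - M), (0.8 : ℝ) ^ i ≤ 5 := by
      rw [geom_sum_eq (by norm_num)]
      have : (0 : ℝ) ≤ 0.8 ^ (D - M) := by positivity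
      rw [div_le_iff_of_neg (by norm_num)]
      linarith
    rw [← mul_sum] at h3
    have h5 : t ^ M ≤ (1.25 * t) ^ M := by gcongr; linarith
    have h6 : 0 ≤ t ^ M := by positivity
    calc _ ≤ b * t ^ M * 5 := h3.trans (mul_le_mul_of_nonneg_left h4 (by positivity))
      _ ≤ b * (1.25 * t) ^ M * 7 := by gcongr; norm_num
      _ = _ := by ring
  · have hτ : 1 ≤ 1.25 * t := by linarith
    have h3 : ‖∑ m ∈ range M, y ^ m • c m‖ ≤ ∑ m ∈ range M, b * (1.25 * t) ^ M * 0.8 ^ m := by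
      refine norm_sum_le_of_le _ fun m hm => ?_
      have hm' := mem_range.1 hm
      refine (hterm m (hm'.trans_le hMD)).trans ?_
      have e2 : t ^ m = (1.25 * t) ^ m * 0.8 ^ m := by rw [← mul_pow]; congr 1; ring
      rw [e2, ← mul_assoc]
      gcongr
    have h4 : ∑ i ∈ range M, (0.8 : ℝ) ^ i ≤ 5 := by
      rw [geom_sum_eq (by norm_num)]
      have : (0 : ℝ) ≤ 0.8 ^ M := by positivity
      rw [div_le_iff_of_neg (by norm_num)]
      linarith
    rw [← mul_sum] at h3
    have h5 : 1 ≤ (1.25 * t) ^ M := one_le_pow₀ hτ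
    have h6 := h3.trans (mul_le_mul_of_nonneg_left h4 (by positivity))
    have h7 := mul_le_mul_of_nonneg_left h5 hb
    refine (norm_sub_le _ _).trans ?_
    linarith

/-- After weighting by `a`, the first `M` terms reproduce the exact coefficient; the remainders
carry `k_j^(-2M)` and are summed with `sum_abs_mul_le`, so `‖a‖₁` never enters. The rate is `8.5 >
e/0.32`. -/
theorem norm_errCoeff_le_of_lt (h1 : ‖(1 : E)‖ ≤ 1) {A : ℕ → E}
    (hA : ∀ j, ‖A j‖ ≤ 1 / j.factorial) (hak : IsMultiproductCoeff a k) (hM : 1 ≤ M) {n : ℕ}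
    (hn : 2 * M + 1 ≤ n) : ‖errCoeff A a k n‖ ≤ 14 * M * 5 ^ M * 8.5 ^ n := by
  obtain ⟨c, hc0, hc, hcb⟩ := exists_even_expansion_of_norm_le h1 hA (show 1 ≤ n by omega)
  set b : ℝ := (1 / 0.32) ^ n with hb
  have hb0 : 0 ≤ b := by positivity
  set r : Fin M → E := fun j => (1 / (k j : ℝ)) ^ n • coeff n (prodSeries A (k j)) -
    ∑ m ∈ range M, (1 / (k j : ℝ) ^ 2) ^ m • c m with hr
  have hrb : ∀ j, ‖r j‖ ≤ 7 * b * (1.25 * (n : ℝ) ^ 2) ^ M * (1 / (k j : ℝ) ^ 2) ^ M := fun j => by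
    refine norm_expansion_remainder_le hb0 (by positivity) (by positivity)
      (show M ≤ (n + 1) / 2 by omega) hcb (hc (k j) (hak.1 j)) ?_
    refine (norm_coeff_prodSeries_le h1 hA (ρ := 0.32) (by norm_num) (hak.1 j) n).trans ?_
    have := exp_032_le
    exact mul_le_mul_of_nonneg_right (by linarith) hb0
  have e1 : errCoeff A a k n = ∑ j, a j • r j := by
    have e2 : ∑ j, a j • r j = ∑ j, a j • (1 / (k j : ℝ)) ^ n • coeff n (prodSeries A (k j)) -
        ∑ j, a j • ∑ m ∈ range M, (1 / (k j : ℝ) ^ 2) ^ m • c m := by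
      rw [← sum_sub_distrib]
      exact sum_congr rfl fun j _ => smul_sub _ _ _
    rw [e2, sum_smul_expansion hak hM c hM le_rfl, hc0, errCoeff]
  rw [e1]
  calc ‖∑ j, a j • r j‖
      ≤ ∑ j, 7 * b * (1.25 * (n : ℝ) ^ 2) ^ M * (|a j| * (1 / (k j : ℝ) ^ 2) ^ M) := by
        refine norm_sum_le_of_le _ fun j _ => ?_
        rw [norm_smul, Real.norm_eq_abs]
        refine (mul_le_mul_of_nonneg_left (hrb j) (abs_nonneg _)).trans (le_of_eq ?_)
        ring
    _ ≤ 7 * b * (1.25 * (n : ℝ) ^ 2) ^ M * (2 * M / (M.factorial : ℝ) ^ 2) := by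
        rw [← mul_sum]
        exact mul_le_mul_of_nonneg_left (hak.sum_abs_mul_le hM) (by positivity)
    _ = 14 * M * 1.25 ^ M * b * (((n : ℝ) ^ 2) ^ M / (M.factorial : ℝ) ^ 2) := by
        rw [mul_pow]; ring
    _ ≤ 14 * M * 1.25 ^ M * b * (4 ^ M * Real.exp n) :=
        mul_le_mul_of_nonneg_left (pow_div_sq_factorial_le M n) (by positivity)
    _ = 14 * M * 5 ^ M * ((1 / 0.32) ^ n * Real.exp n) := by
        rw [show (5 : ℝ) = 1.25 * 4 by norm_num, mul_pow]; ring
    _ ≤ _ := by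
        refine mul_le_mul_of_nonneg_left ?_ (by positivity)
        rw [← mul_one (n : ℝ), Real.exp_nat_mul, ← mul_pow]
        have := Real.exp_one_lt_d9
        gcongr
        norm_num at this ⊢
        linarith

theorem norm_hasSum_le_of_eq_zero {e : ℕ → E} {x : E} {θ D κ : ℝ} {m : ℕ} (hθ : 0 ≤ θ)
    (hκ : 0 ≤ κ) (hκθ : κ * θ < 1) (h0 : ∀ n < m, e n = 0) (hm : ∀ n, m ≤ n → ‖e n‖ ≤ D * κ ^ n)
    (hx : HasSum (fun n => θ ^ n • e n) x) : ‖x‖ ≤ D * (κ * θ) ^ m / (1 - κ * θ) := by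
  have hq : 0 ≤ κ * θ := mul_nonneg hκ hθ
  have h2 : HasSum (fun n => θ ^ (n + m) • e (n + m)) x := by
    have := (hasSum_nat_add_iff' (f := fun n => θ ^ n • e n) m).2 hx
    rwa [sum_eq_zero fun n hn => by rw [h0 n (mem_range.1 hn), smul_zero], sub_zero] at this
  have h3 : HasSum (fun n => D * (κ * θ) ^ m * (κ * θ) ^ n) (D * (κ * θ) ^ m * (1 - κ * θ)⁻¹) :=
    (hasSum_geometric_of_lt_one hq hκθ).mul_left _
  rw [div_eq_mul_inv, ← h2.tsum_eq]
  refine tsum_of_norm_bounded h3 fun n => ?_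
  rw [norm_smul, norm_pow, Real.norm_of_nonneg hθ]
  calc θ ^ (n + m) * ‖e (n + m)‖ ≤ θ ^ (n + m) * (D * κ ^ (n + m)) := by
        gcongr; exact hm _ (by omega)
    _ = _ := by rw [mul_pow, mul_pow, pow_add, pow_add]; ring

variable [CompleteSpace E]

/-- The product of the `k` midpoint exponentials with generator `f` and step size `h`. -/
def stepProd (f : ℝ → E) (h : ℝ) : ℕ → E
  | 0 => 1
  | k + 1 => NormedSpace.exp (h • f ((k + 1 / 2) * h)) * stepProd f h k

theorem psEval_prodSeries (h1 : ‖(1 : E)‖ ≤ 1) {A : ℕ → E} (hA : ∀ j, ‖A j‖ ≤ 1 / j.factorial)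
    {h : ℝ} (hh : 0 ≤ h) (k : ℕ) {f : ℝ → E}
    (hf : ∀ q < k, HasSum (fun j => (((q : ℝ) + 1 / 2) * h) ^ j • A j) (f ((q + 1 / 2) * h))) :
    PSEval (prodSeries A k) h (stepProd f h k) := by
  induction k with
  | zero => exact PSEval.one h
  | succ k ih =>
    have hx : (0 : ℝ) ≤ k + 1 / 2 := by positivity
    have hb := psBound_genSeries hA hx hh
    refine PSEval.mul hh (PSBound.formalExp h1 hh (coeff_zero_genSeries A _) hb)
      (psBound_prodSeries h1 hA hh k le_rfl) ?_ (ih fun q hq => hf q (hq.trans (Nat.lt_succ_self k)))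
    refine PSEval.formalExp h1 hh (coeff_zero_genSeries A _) hb ?_
    have h2 := (hf k (Nat.lt_succ_self k)).const_smul h
    have h3 : HasSum (fun j => h ^ (j + 1) • coeff (j + 1) (genSeries A (k + 1 / 2)))
        (h • f ((k + 1 / 2) * h)) := by
      have e : (fun j => h ^ (j + 1) • coeff (j + 1) (genSeries A ((k : ℝ) + 1 / 2))) =
          fun j => h • (((k : ℝ) + 1 / 2) * h) ^ j • A j := by
        funext j
        rw [coeff_succ_genSeries, smul_smul, smul_smul, mul_pow]
        congr 1; ring
      rw [e]; exact h2
    have h4 := (hasSum_nat_add_iff (f := fun j => h ^ j • coeff j (genSeries A ((k : ℝ) + 1 / 2))) 1).1 h3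
    rw [sum_range_one, coeff_zero_genSeries, smul_zero, add_zero] at h4
    exact h4

theorem hasSum_errCoeff (h1 : ‖(1 : E)‖ ≤ 1) {A : ℕ → E} (hA : ∀ j, ‖A j‖ ≤ 1 / j.factorial)
    (hak : IsMultiproductCoeff a k) {θ : ℝ} (hθ : 0 ≤ θ) {f : ℝ → E} {u : E}
    (hf : ∀ y, 0 ≤ y → y ≤ θ → HasSum (fun j => y ^ j • A j) (f y))
    (hu : HasSum (fun n => θ ^ n • solCoeff A n) u) :
    HasSum (fun n => θ ^ n • errCoeff A a k n)
      (∑ j, a j • stepProd f (θ / k j) (k j) - u) := by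
  have h2 : ∀ j, HasSum (fun n => a j • θ ^ n • (1 / (k j : ℝ)) ^ n • coeff n (prodSeries A (k j)))
      (a j • stepProd f (θ / k j) (k j)) := fun j => by
    have hk : (1 : ℝ) ≤ k j := by exact_mod_cast hak.1 j
    have hk0 : (0 : ℝ) < k j := by linarith
    refine HasSum.const_smul _ ?_
    have := psEval_prodSeries h1 hA (h := θ / k j) (by positivity) (k j) (f := f) fun q hq => by
      have hq' : (q : ℝ) + 1 ≤ k j := by exact_mod_cast hq
      refine hf _ (by positivity) ?_
      calc ((q : ℝ) + 1 / 2) * (θ / k j) ≤ k j * (θ / k j) := by gcongr; linarith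
        _ = θ := by field_simp
    have e : (fun n => (θ / k j) ^ n • coeff n (prodSeries A (k j))) =
        fun n => θ ^ n • (1 / (k j : ℝ)) ^ n • coeff n (prodSeries A (k j)) := by
      funext n
      rw [smul_smul, ← mul_pow, mul_one_div]
    rw [PSEval, e] at this
    exact this
  have h3 := (hasSum_sum fun j (_ : j ∈ (univ : Finset (Fin M))) => h2 j).sub hu
  have e : (fun n => θ ^ n • errCoeff A a k n) = fun n =>
      ∑ j, a j • θ ^ n • (1 / (k j : ℝ)) ^ n • coeff n (prodSeries A (k j)) -
        θ ^ n • solCoeff A n := by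
    funext n
    rw [errCoeff, smul_sub, smul_sum]
    congr 1
    exact sum_congr rfl fun j _ => smul_comm _ _ _
  rw [e]; exact h3

end NormalizedStep

/-! ### Local solutions and propagators -/

section LocalSolution

open Finset

variable {E : Type*} [NormedRing E]

theorem norm_le_one_of_le_inv_factorial {A : ℕ → E} (hA : ∀ j, ‖A j‖ ≤ 1 / j.factorial) (j : ℕ) :
    ‖A j‖ ≤ 1 := by
  refine (hA j).trans ?_
  rw [div_le_one (by positivity)]
  exact_mod_cast Nat.one_le_iff_ne_zero.2 (Nat.factorial_ne_zero j)

variable [NormedAlgebra ℝ E]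

theorem summable_norm_pow_smul {A : ℕ → E} (hA : ∀ j, ‖A j‖ ≤ 1) {x : ℝ} (hx : |x| < 1) :
    Summable fun j => ‖x ^ j • A j‖ := by
  refine Summable.of_nonneg_of_le (fun _ => norm_nonneg _) (fun j => ?_)
    (summable_geometric_of_lt_one (abs_nonneg x) hx)
  rw [norm_smul, norm_pow, Real.norm_eq_abs]
  exact mul_le_of_le_one_right (by positivity) (hA j)

variable [CompleteSpace E]

theorem hasDerivAt_tsum_solCoeff (h1 : ‖(1 : E)‖ ≤ 1) {A : ℕ → E}
    (hA : ∀ j, ‖A j‖ ≤ 1 / j.factorial) {x : ℝ} (hx : |x| < 1) :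
    HasDerivAt (fun y : ℝ => ∑' n, y ^ n • solCoeff A n)
      ((∑' j, x ^ j • A j) * ∑' n, x ^ n • solCoeff A n) x := by
  obtain ⟨r, hxr, hr1⟩ := exists_between hx
  have hr0 : 0 ≤ r := (abs_nonneg x).trans hxr.le
  have hA1 := norm_le_one_of_le_inv_factorial hA
  have hu := norm_solCoeff_le h1 hA
  have hS : ∀ y : ℝ, |y| < 1 → Summable fun n => y ^ n • solCoeff A n := fun y hy =>
    (summable_norm_pow_smul hu hy).of_norm
  set c : ℕ → E := fun n => ∑ l ∈ range (n + 1), A l * solCoeff A (n - l) with hc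
  have hcb : ∀ n, ‖c n‖ ≤ n + 1 := fun n => by
    refine (norm_sum_le _ _).trans ((sum_le_card_nsmul _ _ 1 fun l _ => ?_).trans (le_of_eq ?_))
    · exact (norm_mul_le _ _).trans (mul_le_one₀ (hA1 l) (norm_nonneg _) (hu _))
    · simp
  have hg : ∀ n, ∀ y : ℝ, HasDerivAt (fun y : ℝ => y ^ (n + 1) • solCoeff A (n + 1))
      (y ^ n • c n) y := fun n y => by
    have h := (hasDerivAt_pow (n + 1) y).smul_const (solCoeff A (n + 1))
    have e : (((n + 1 : ℕ) : ℝ) * y ^ (n + 1 - 1)) • solCoeff A (n + 1) = y ^ n • c n := by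
      rw [solCoeff_succ, smul_smul, Nat.add_sub_cancel]
      congr 1
      push_cast
      field_simp
    rw [e] at h
    exact h
  have hball : ∀ y ∈ Metric.ball (0 : ℝ) r, |y| < r := fun y hy => by simpa using hy
  have hsum : Summable fun n : ℕ => ((n : ℝ) + 1) * r ^ n := by
    have h := summable_pow_mul_geometric_of_norm_lt_one (R := ℝ) 1
      (r := r) (by rwa [Real.norm_of_nonneg hr0])
    have h' := summable_geometric_of_lt_one hr0 hr1
    refine (h.add h').congr fun n => ?_
    rw [pow_one]; ring
  have key := hasDerivAt_tsum_of_isPreconnected hsum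
    (g := fun n y => y ^ (n + 1) • solCoeff A (n + 1)) (g' := fun n y => y ^ n • c n)
    Metric.isOpen_ball (convex_ball (0 : ℝ) r).isPreconnected
    (fun n y _ => hg n y) (fun n y hy => by
      rw [norm_smul, norm_pow, Real.norm_eq_abs, mul_comm]
      gcongr
      · exact hcb n
      · exact (hball y hy).le)
    (y₀ := x) (by simpa using hxr) ((summable_nat_add_iff 1).2 (hS x hx)) (by simpa using hxr)
  have e1 : (fun y : ℝ => ∑' n, y ^ n • solCoeff A n) =ᶠ[nhds x]
      fun y => solCoeff A 0 + ∑' n, y ^ (n + 1) • solCoeff A (n + 1) := by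
    have : ∀ᶠ y in nhds x, |y| < 1 := continuous_abs.continuousAt.eventually_lt_const hx
    filter_upwards [this] with y hy
    rw [(hS y hy).tsum_eq_zero_add, pow_zero, one_smul]
  have e2 : (∑' j, x ^ j • A j) * ∑' n, x ^ n • solCoeff A n = ∑' n, x ^ n • c n := by
    rw [tsum_mul_tsum_eq_tsum_sum_range_of_summable_norm (summable_norm_pow_smul hA1 hx)
      (summable_norm_pow_smul hu hx)]
    refine tsum_congr fun n => ?_
    rw [hc, smul_sum]
    refine sum_congr rfl fun l hl => ?_
    rw [smul_mul_smul_comm, ← pow_add, Nat.add_sub_cancel' (by simpa [Nat.lt_succ_iff] using hl)]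
  rw [e2]
  exact (key.const_add (solCoeff A 0)).congr_of_eventuallyEq e1

/-- Derivative bounds without a factorial make the Lagrange remainder `O(C^n (x - a)^n / n!)`, so
the Taylor series converges on the whole interval. -/
theorem hasSum_taylor_of_norm_le {F : Type*} [NormedAddCommGroup F] [NormedSpace ℝ F]
    [CompleteSpace F] {f : ℝ → F} {a b C : ℝ} (hab : a ≤ b)
    (hf : ContDiffOn ℝ ∞ f (Set.Icc a b))
    (hC : ∀ j, ∀ y ∈ Set.Icc a b, ‖iteratedDerivWithin j f (Set.Icc a b) y‖ ≤ C ^ (j + 1))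
    {x : ℝ} (hx : x ∈ Set.Icc a b) :
    HasSum (fun j => ((j.factorial : ℝ)⁻¹ * (x - a) ^ j) •
      iteratedDerivWithin j f (Set.Icc a b) a) (f x) := by
  have hxa : 0 ≤ x - a := sub_nonneg.2 hx.1
  have hsummable : Summable fun j => ((j.factorial : ℝ)⁻¹ * (x - a) ^ j) •
      iteratedDerivWithin j f (Set.Icc a b) a := by
    refine Summable.of_norm_bounded
      ((Real.summable_pow_div_factorial (C * (x - a))).mul_left C) fun j => ?_
    rw [norm_smul, Real.norm_of_nonneg (by positivity)]
    refine (mul_le_mul_of_nonneg_left (hC j a (left_mem_Icc.2 hab)) (by positivity)).trans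
      (le_of_eq ?_)
    rw [mul_pow]; ring
  refine (hsummable.hasSum_iff_tendsto_nat).2 ?_
  have h1 : Filter.Tendsto (fun n => ∑ k ∈ range (n + 1), ((k.factorial : ℝ)⁻¹ * (x - a) ^ k) •
      iteratedDerivWithin k f (Set.Icc a b) a) Filter.atTop (nhds (f x)) := by
    rw [tendsto_iff_norm_sub_tendsto_zero]
    have h2 : Filter.Tendsto (fun n : ℕ => C ^ 2 * (x - a) * ((C * (x - a)) ^ n / n.factorial))
        Filter.atTop (nhds 0) := by
      have := (FloorSemiring.tendsto_pow_div_factorial_atTop (C * (x - a))).const_mul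
        (C ^ 2 * (x - a))
      rwa [mul_zero] at this
    refine squeeze_zero (fun _ => norm_nonneg _) (fun n => ?_) h2
    have := taylor_mean_remainder_bound (n := n) hab (hf.of_le (by exact_mod_cast le_top)) hx
      (hC (n + 1))
    rw [taylor_within_apply] at this
    rw [norm_sub_rev]
    refine this.trans (le_of_eq ?_)
    rw [mul_pow]; ring
  exact (Filter.tendsto_add_atTop_iff_nat 1).1 h1

end LocalSolution

/-! ### Unitarity, composition of propagators and accumulation of errors. -/

section Propagators

variable {d : ℕ}

theorem CMat.norm_one_le : ‖(1 : CMat d)‖ ≤ 1 := by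
  rcases isEmpty_or_nonempty (Fin d) with h | h
  · rw [Subsingleton.elim (1 : CMat d) 0, norm_zero]; exact zero_le_one
  · exact (CStarRing.norm_one (E := CMat d)).le

theorem CMat.norm_le_one_of_star_mul_self {U : CMat d} (h : star U * U = 1) : ‖U‖ ≤ 1 := by
  have h1 := CStarRing.norm_star_mul_self (x := U)
  rw [h] at h1
  have h2 := CMat.norm_one_le (d := d)
  nlinarith [norm_nonneg U]

/-- The two contributions to the derivative of `P* V` cancel because `H` is Hermitian. Taking `V =
P` gives unitarity; taking a restricted global solution for `V` gives the composition law. -/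
theorem star_mul_eq_of_schrodinger {H P V : ℝ → CMat d} {s s' : ℝ} (hs : s ≤ s')
    (hH : ∀ τ ∈ Icc s s', (H τ).IsHermitian)
    (hP : ∀ τ ∈ Icc s s', HasDerivWithinAt P ((-Complex.I) • (H τ * P τ)) (Icc s s') τ)
    (hV : ∀ τ ∈ Icc s s', HasDerivWithinAt V ((-Complex.I) • (H τ * V τ)) (Icc s s') τ) :
    star (P s') * V s' = star (P s) * V s := by
  have hd : ∀ τ ∈ Icc s s', HasDerivWithinAt (fun τ => star (P τ) * V τ) 0 (Icc s s') τ := by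
    intro τ hτ
    have h := ((hP τ hτ).star).mul (hV τ hτ)
    have e : star ((-Complex.I) • (H τ * P τ)) * V τ + star (P τ) * ((-Complex.I) • (H τ * V τ)) =
        0 := by
      have hh : star (H τ) = H τ := hH τ hτ
      rw [star_smul, star_mul, hh, smul_mul_assoc, mul_smul_comm, mul_assoc, ← add_smul]
      simp
    rw [e] at h
    exact h
  exact constant_of_derivWithin_zero (fun τ hτ => (hd τ hτ).differentiableWithinAt)
    (fun τ hτ => by
      rcases eq_or_lt_of_le hs with rfl | hlt
      · simp at hτ
      · exact (hd τ (Ico_subset_Icc_self hτ)).derivWithin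
          (uniqueDiffOn_Icc hlt τ (Ico_subset_Icc_self hτ))) s' (right_mem_Icc.2 hs)

theorem IsPropagator.star_mul_self {H P : ℝ → CMat d} {s s' : ℝ} (hs : s ≤ s')
    (hH : ∀ τ ∈ Icc s s', (H τ).IsHermitian) (hP : IsPropagator H s s' P) :
    star (P s') * P s' = 1 := by
  rw [star_mul_eq_of_schrodinger hs hH hP.2 hP.2, hP.1, star_one, one_mul]

theorem norm_propagator_le {H : ℝ → CMat d} {s s' : ℝ} (hs : s ≤ s')
    (hH : ∀ τ ∈ Icc s s', (H τ).IsHermitian) (hc : ContinuousOn H (Icc s s')) :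
    ‖propagator H s s'‖ ≤ 1 := by
  obtain ⟨P, hP⟩ := exists_isPropagator hs hc
  rw [← hP.eq_propagator hs hc]
  exact CMat.norm_le_one_of_star_mul_self (hP.star_mul_self hs hH)

theorem IsPropagator.eq_propagator_mul {H V : ℝ → CMat d} {t₀ t s s' : ℝ} (hs0 : t₀ ≤ s)
    (hs : s ≤ s') (hst : s' ≤ t) (hH : ∀ τ ∈ Icc t₀ t, (H τ).IsHermitian)
    (hc : ContinuousOn H (Icc t₀ t)) (hV : IsPropagator H t₀ t V) :
    V s' = propagator H s s' * V s := by
  have hsub : Icc s s' ⊆ Icc t₀ t := Icc_subset_Icc hs0 hst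
  have hc' := hc.mono hsub
  have hH' : ∀ τ ∈ Icc s s', (H τ).IsHermitian := fun τ hτ => hH τ (hsub hτ)
  obtain ⟨P, hP⟩ := exists_isPropagator hs hc'
  rw [← hP.eq_propagator hs hc']
  have h1 := star_mul_eq_of_schrodinger hs hH' hP.2 fun τ hτ => (hV.2 τ (hsub hτ)).mono hsub
  rw [hP.1, star_one, one_mul] at h1
  rw [← h1, ← mul_assoc, mul_eq_one_comm.1 (hP.star_mul_self hs hH'), one_mul]

theorem timeOrderedProd_succ {n : ℕ} (F : Fin (n + 1) → CMat d) :
    timeOrderedProd F = F (Fin.last n) * timeOrderedProd fun i => F i.castSucc := by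
  simp only [timeOrderedProd, List.ofFn_succ', List.concat_eq_append, List.reverse_append,
    List.reverse_cons, List.reverse_nil, List.nil_append, List.singleton_append, List.prod_cons]

theorem propagator_eq_timeOrderedProd {H : ℝ → CMat d} {t₀ t : ℝ} (ht : t₀ ≤ t)
    (hH : ∀ τ ∈ Icc t₀ t, (H τ).IsHermitian) (hc : ContinuousOn H (Icc t₀ t)) {r : ℕ}
    (mesh : Fin (r + 1) → ℝ) (hmono : Monotone mesh) (h0 : mesh 0 = t₀)
    (hr : mesh (Fin.last r) = t) :
    propagator H t₀ t =
      timeOrderedProd fun i : Fin r => propagator H (mesh i.castSucc) (mesh i.succ) := by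
  obtain ⟨V, hV⟩ := exists_isPropagator ht hc
  have key : ∀ n (hn : n ≤ r), V (mesh ⟨n, Nat.lt_succ_of_le hn⟩) =
      timeOrderedProd fun i : Fin n => propagator H (mesh (i.castLE hn).castSucc)
        (mesh (i.castLE hn).succ) := by
    intro n
    induction n with
    | zero =>
      intro hn
      have : V (mesh 0) = 1 := by rw [h0, hV.1]
      simpa [timeOrderedProd] using this
    | succ n ih =>
      intro hn
      rw [timeOrderedProd_succ]
      have h1 := ih (Nat.le_of_succ_le hn)
      have h2 := hV.eq_propagator_mul (s := mesh ⟨n, by omega⟩) (s' := mesh ⟨n + 1, by omega⟩)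
        (by rw [← h0]; exact hmono (Fin.zero_le _)) (hmono (by simp))
        (by rw [← hr]; exact hmono (Fin.le_last _)) hH hc
      rw [h2, h1]
      rfl
  have := key r le_rfl
  rw [← hV.eq_propagator ht hc, ← hr]
  exact this

theorem norm_timeOrderedProd_le_pow {n : ℕ} {F : Fin n → CMat d} {C : ℝ}
    (hF : ∀ i, ‖F i‖ ≤ C) : ‖timeOrderedProd F‖ ≤ C ^ n := by
  induction n with
  | zero => simpa [timeOrderedProd] using CMat.norm_one_le (d := d)
  | succ n ih =>
    rw [timeOrderedProd_succ, pow_succ']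
    have hC : 0 ≤ C := (norm_nonneg _).trans (hF (Fin.last n))
    exact (norm_mul_le _ _).trans
      (mul_le_mul (hF _) (ih fun i => hF _) (norm_nonneg _) hC)

/-- Telescoping. Only the exact factors are contractions; the approximate ones have norm at most `1
+ δ`, hence the compound growth. -/
theorem norm_timeOrderedProd_sub_le {n : ℕ} {F G : Fin n → CMat d} {δ : ℝ}
    (hF : ∀ i, ‖F i‖ ≤ 1) (hFG : ∀ i, ‖G i - F i‖ ≤ δ) :
    ‖timeOrderedProd F - timeOrderedProd G‖ ≤ (1 + δ) ^ n - 1 := by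
  induction n with
  | zero => simp [timeOrderedProd]
  | succ n ih =>
    have hδ : 0 ≤ δ := (norm_nonneg _).trans (hFG (Fin.last n))
    rw [timeOrderedProd_succ, timeOrderedProd_succ G]
    set a := F (Fin.last n)
    set b := G (Fin.last n)
    set P := timeOrderedProd fun i : Fin n => F i.castSucc
    set Q := timeOrderedProd fun i : Fin n => G i.castSucc
    have h1 : ‖P - Q‖ ≤ (1 + δ) ^ n - 1 := ih (fun i => hF _) fun i => hFG _
    have h2 : ‖P‖ ≤ 1 := by
      have := norm_timeOrderedProd_le_pow (F := fun i : Fin n => F i.castSucc) fun i => hF _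
      rwa [one_pow] at this
    have h3 : ‖b‖ ≤ 1 + δ := by
      have : b = a + (b - a) := by abel
      rw [this]
      exact (norm_add_le _ _).trans (add_le_add (hF _) (hFG _))
    have e : a * P - b * Q = b * (P - Q) - (b - a) * P := by noncomm_ring
    rw [e]
    have h4 : ‖b * (P - Q)‖ ≤ (1 + δ) * ((1 + δ) ^ n - 1) :=
      (norm_mul_le _ _).trans (mul_le_mul h3 h1 (norm_nonneg _) (by positivity))
    have h5 : ‖(b - a) * P‖ ≤ δ * 1 :=
      (norm_mul_le _ _).trans (mul_le_mul (hFG _) h2 (norm_nonneg _) hδ)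
    refine (norm_sub_le _ _).trans ?_
    rw [pow_succ]
    linarith

end Propagators

/-! ### One step of the multiproduct formula -/

section Step

variable {d : ℕ} {H : ℝ → CMat d} {Λ : ℝ → ℝ} {t₀ t : ℝ}

theorem IsLambdaBound.nonneg (hΛ : IsLambdaBound H Λ t₀ t) {τ : ℝ} (hτ : τ ∈ Icc t₀ t) :
    0 ≤ Λ τ :=
  (Real.rpow_nonneg (norm_nonneg _) _).trans (hΛ.2 τ hτ 0)

theorem IsLambdaBound.norm_le (hΛ : IsLambdaBound H Λ t₀ t) {τ : ℝ} (hτ : τ ∈ Icc t₀ t) (j : ℕ) :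
    ‖iteratedDerivWithin j H (Icc t₀ t) τ‖ ≤ Λ τ ^ (j + 1) := by
  have h := hΛ.2 τ hτ j
  have e : (1 / ((j : ℝ) + 1)) = ((j + 1 : ℕ) : ℝ)⁻¹ := by push_cast; rw [one_div]
  rw [e] at h
  calc ‖iteratedDerivWithin j H (Icc t₀ t) τ‖
      = (‖iteratedDerivWithin j H (Icc t₀ t) τ‖ ^ (((j + 1 : ℕ) : ℝ)⁻¹)) ^ (j + 1) :=
        (Real.rpow_inv_natCast_pow (norm_nonneg _) (Nat.succ_ne_zero j)).symm
    _ ≤ Λ τ ^ (j + 1) := by gcongr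

theorem iteratedDerivWithin_Icc_of_subset {F : Type*} [NormedAddCommGroup F] [NormedSpace ℝ F]
    {f : ℝ → F} {a b s s' : ℝ} (hf : ContDiffOn ℝ ∞ f (Icc a b)) (hs0 : a ≤ s)
    (hs : s < s') (hst : s' ≤ b) (j : ℕ) {y : ℝ} (hy : y ∈ Icc s s') :
    iteratedDerivWithin j f (Icc s s') y = iteratedDerivWithin j f (Icc a b) y := by
  have h : (j : WithTop ℕ∞) ≤ ∞ := by exact_mod_cast le_top
  rw [iteratedDerivWithin, iteratedDerivWithin, iteratedFDerivWithin_subset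
    (Icc_subset_Icc hs0 hst) (uniqueDiffOn_Icc hs)
    (uniqueDiffOn_Icc ((hs0.trans_lt hs).trans_le hst)) (hf.of_le h) hy]

theorem timeOrderedProd_exp_eq_stepProd (f : ℝ → CMat d) (h : ℝ) (n : ℕ) :
    (timeOrderedProd fun q : Fin n => NormedSpace.exp (h • f (((q : ℝ) + 1 / 2) * h))) =
      stepProd f h n := by
  induction n with
  | zero => rfl
  | succ n ih =>
    rw [timeOrderedProd_succ, stepProd, ← ih]
    rfl

theorem exists_hasSum_errCoeff (hSmooth : ContDiffOn ℝ ∞ H (Icc t₀ t))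
    (hΛ : IsLambdaBound H Λ t₀ t) {M : ℕ} {a : Fin M → ℝ} {k : Fin M → ℕ}
    (hak : IsMultiproductCoeff a k) {s s' : ℝ} (hs0 : t₀ ≤ s) (hs : s < s') (hst : s' ≤ t)
    (hθ : Λ s * (s' - s) < 1) :
    ∃ A : ℕ → CMat d, (∀ j, ‖A j‖ ≤ 1 / j.factorial) ∧
      HasSum (fun n => (Λ s * (s' - s)) ^ n • errCoeff A a k n)
        (multiproductFormula H a k s' s - propagator H s s') := by
  have : CompleteSpace (CMat d) := FiniteDimensional.complete ℂ _
  have hsub : Icc s s' ⊆ Icc t₀ t := Icc_subset_Icc hs0 hst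
  have hsI : s ∈ Icc t₀ t := hsub (left_mem_Icc.2 hs.le)
  set l := Λ s with hl
  have hl0 : 0 ≤ l := hΛ.nonneg hsI
  set D : ℕ → CMat d := fun j => iteratedDerivWithin j H (Icc t₀ t) s with hD
  have hDb : ∀ j, ‖D j‖ ≤ l ^ (j + 1) := fun j => hΛ.norm_le hsI j
  -- If `l = 0`, the inverse is `0` by convention and `A = 0`. The identity `hAD` survives because
  -- the derivatives at `s` then vanish too.
  set A : ℕ → CMat d := fun j =>
    ((l ^ (j + 1))⁻¹ * (j.factorial : ℝ)⁻¹) • ((-Complex.I) • D j) with hA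
  have hI : ∀ X : CMat d, ‖(-Complex.I) • X‖ = ‖X‖ := fun X => by
    rw [norm_smul, norm_neg, Complex.norm_I, one_mul]
  have hAb : ∀ j, ‖A j‖ ≤ 1 / j.factorial := fun j => by
    rw [hA, norm_smul, hI, Real.norm_of_nonneg (by positivity)]
    calc (l ^ (j + 1))⁻¹ * (j.factorial : ℝ)⁻¹ * ‖D j‖
        ≤ (l ^ (j + 1))⁻¹ * (j.factorial : ℝ)⁻¹ * l ^ (j + 1) := by gcongr; exact hDb j
      _ = (l ^ (j + 1))⁻¹ * l ^ (j + 1) * (1 / j.factorial) := by ring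
      _ ≤ 1 * (1 / j.factorial) := by gcongr; exact inv_mul_le_one
      _ = _ := one_mul _
  have hAD : ∀ j, l ^ (j + 1) • A j = (j.factorial : ℝ)⁻¹ • ((-Complex.I) • D j) := fun j => by
    rcases eq_or_ne (l ^ (j + 1)) 0 with h0 | h0
    · have h1 := hDb j
      rw [h0] at h1
      rw [h0, zero_smul, norm_le_zero_iff.1 h1, smul_zero, smul_zero]
    · rw [hA, smul_smul, mul_inv_cancel_left₀ h0]
  clear_value A
  have hA1 := norm_le_one_of_le_inv_factorial hAb
  set f : ℝ → CMat d := fun x => ∑' j, x ^ j • A j with hf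
  have hfs : ∀ x, |x| < 1 → HasSum (fun j => x ^ j • A j) (f x) := fun x hx =>
    (summable_norm_pow_smul hA1 hx).of_norm.hasSum
  have hx1 : ∀ τ ∈ Icc s s', 0 ≤ l * (τ - s) ∧ |l * (τ - s)| < 1 := fun τ hτ => by
    have h0 : 0 ≤ τ - s := sub_nonneg.2 hτ.1
    have h1 : 0 ≤ l * (τ - s) := mul_nonneg hl0 h0
    refine ⟨h1, ?_⟩
    rw [abs_of_nonneg h1]
    exact (mul_le_mul_of_nonneg_left (sub_le_sub_right hτ.2 s) hl0).trans_lt hθ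
  -- A bound for `Λ` on the whole step is needed only for convergence of the Taylor series; the
  -- coefficient estimates use `Λ s` alone.
  obtain ⟨C, hC⟩ := isCompact_Icc.exists_bound_of_continuousOn (hΛ.1.mono hsub)
  have hfH : ∀ τ ∈ Icc s s', l • f (l * (τ - s)) = (-Complex.I) • H τ := fun τ hτ => by
    have h1 := (hfs _ (hx1 τ hτ).2).const_smul l
    have h2 := (hasSum_taylor_of_norm_le hs.le (hSmooth.mono hsub) (C := C) (fun j y hy => by
      rw [iteratedDerivWithin_Icc_of_subset hSmooth hs0 hs hst j hy]
      refine (hΛ.norm_le (hsub hy) j).trans ?_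
      have := hΛ.nonneg (hsub hy)
      gcongr
      exact (le_abs_self _).trans (hC y hy)) hτ).const_smul (-Complex.I)
    have e : (fun j => l • (l * (τ - s)) ^ j • A j) = fun j => (-Complex.I) •
        ((j.factorial : ℝ)⁻¹ * (τ - s) ^ j) • iteratedDerivWithin j H (Icc s s') s := by
      funext j
      rw [iteratedDerivWithin_Icc_of_subset hSmooth hs0 hs hst j (left_mem_Icc.2 hs.le)]
      calc l • (l * (τ - s)) ^ j • A j = (τ - s) ^ j • l ^ (j + 1) • A j := by
            rw [smul_smul, smul_smul, mul_pow]; congr 1; ring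
        _ = (τ - s) ^ j • (j.factorial : ℝ)⁻¹ • ((-Complex.I) • D j) := by rw [hAD]
        _ = _ := by rw [smul_smul, mul_comm, smul_comm]
    rw [e] at h1
    exact h1.unique h2
  set U : ℝ → CMat d := fun x => ∑' n, x ^ n • solCoeff A n with hU
  have hUs : ∀ x, |x| < 1 → HasSum (fun n => x ^ n • solCoeff A n) (U x) := fun x hx =>
    (summable_norm_pow_smul (norm_solCoeff_le CMat.norm_one_le hAb) hx).of_norm.hasSum
  have hprop : IsPropagator H s s' fun τ => U (l * (τ - s)) := by
    refine ⟨?_, fun τ hτ => ?_⟩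
    · have h1 := hUs 0 (by simp)
      have h2 := hasSum_single (f := fun n => (0 : ℝ) ^ n • solCoeff A n) 0
        (fun n hn => by rw [zero_pow hn, zero_smul])
      change U (l * (s - s)) = 1
      rw [sub_self, mul_zero, h1.unique h2, pow_zero, one_smul, solCoeff]
    · have h1 := hasDerivAt_tsum_solCoeff CMat.norm_one_le hAb (hx1 τ hτ).2
      have h2 : HasDerivAt (fun τ => l * (τ - s)) l τ := by
        simpa using ((hasDerivAt_id τ).sub_const s).const_mul l
      have h3 := (h1.scomp τ h2).hasDerivWithinAt (s := Icc s s')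
      have e : l • (f (l * (τ - s)) * U (l * (τ - s))) =
          (-Complex.I) • (H τ * U (l * (τ - s))) := by
        rw [← smul_mul_assoc, hfH τ hτ, smul_mul_assoc]
      rw [← e]
      exact h3
  have hend := hx1 s' (right_mem_Icc.2 hs.le)
  refine ⟨A, hAb, ?_⟩
  have key := hasSum_errCoeff CMat.norm_one_le hAb hak hend.1 (f := f)
    (fun y hy0 hy => hfs y (by rw [abs_of_nonneg hy0]; exact hy.trans_lt hθ)) (hUs _ hend.2)
  have hcont : ContinuousOn H (Icc s s') := hSmooth.continuousOn.mono hsub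
  rw [hprop.eq_propagator hs.le hcont] at key
  have hmp : ∀ j, stepProd f (l * (s' - s) / k j) (k j) = midpointPower H (k j) s' s := fun j => by
    have hk : (1 : ℝ) ≤ k j := by exact_mod_cast hak.1 j
    have hk0 : (0 : ℝ) < k j := by linarith
    rw [← timeOrderedProd_exp_eq_stepProd, midpointPower]
    congr 1
    funext q
    have hq : (q : ℝ) + 1 ≤ k j := by exact_mod_cast q.2
    rw [midpointFormula]
    congr 1
    set τ : ℝ := s + (s' - s) * ((q : ℝ) + 1 / 2) / k j with hτ
    have hδ : 0 < s' - s := sub_pos.2 hs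
    have hτI : τ ∈ Icc s s' := by
      constructor
      · rw [hτ]; have : 0 ≤ (s' - s) * ((q : ℝ) + 1 / 2) / k j := by positivity
        linarith
      · have : (s' - s) * ((q : ℝ) + 1 / 2) / k j ≤ s' - s := by
          rw [div_le_iff₀ hk0]
          refine mul_le_mul_of_nonneg_left (by linarith) hδ.le
        rw [hτ]; linarith
    have e1 : s + (s' - s) * (q : ℝ) / k j + (s + (s' - s) * ((q : ℝ) + 1) / k j -
        (s + (s' - s) * (q : ℝ) / k j)) / 2 = τ := by rw [hτ]; ring
    have e2 : s + (s' - s) * ((q : ℝ) + 1) / k j - (s + (s' - s) * (q : ℝ) / k j) =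
        (s' - s) / k j := by ring
    have e3 : ((q : ℝ) + 1 / 2) * (l * (s' - s) / k j) = l * (τ - s) := by rw [hτ]; ring
    rw [e1, e2, e3, show l * (s' - s) / k j = (s' - s) / k j * l by ring, mul_smul, hfH τ hτI,
      mul_comm, mul_smul]
    exact (Complex.coe_smul _ _).symm
  have hsum : ∑ j, a j • stepProd f (l * (s' - s) / k j) (k j) = multiproductFormula H a k s' s := by
    rw [multiproductFormula]
    refine Finset.sum_congr rfl fun j _ => ?_
    rw [hmp]
    exact (Complex.coe_smul _ _).symm
  rw [hsum] at key
  exact key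

/-- The geometric tail gives `2.5 / (1 - 10/41) ≤ 3.31`. -/
theorem norm_multiproductFormula_sub_le (hSmooth : ContDiffOn ℝ ∞ H (Icc t₀ t))
    (hΛ : IsLambdaBound H Λ t₀ t) {M : ℕ} (hM : 1 ≤ M) {a : Fin M → ℝ} {k : Fin M → ℕ}
    (hak : IsMultiproductCoeff a k) {s s' : ℝ} (hs0 : t₀ ≤ s) (hs : s < s') (hst : s' ≤ t)
    {θ : ℝ} (hle : Λ s * (s' - s) ≤ θ) (hθ : θ ≤ 5 / 41) :
    ‖multiproductFormula H a k s' s - propagator H s s'‖ ≤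
      3.31 * l1Norm a * (2 * θ) ^ (2 * M + 1) := by
  have hsI : s ∈ Icc t₀ t := ⟨hs0, hs.le.trans hst⟩
  have h0 : 0 ≤ Λ s * (s' - s) := mul_nonneg (hΛ.nonneg hsI) (sub_nonneg.2 hs.le)
  obtain ⟨A, hA, hsum⟩ := exists_hasSum_errCoeff hSmooth hΛ hak hs0 hs hst (by linarith)
  have hl1 := hak.one_le_l1Norm hM
  have h := norm_hasSum_le_of_eq_zero (m := 2 * M + 1) h0 (κ := 2) (by norm_num) (by linarith)
    (fun n hn => errCoeff_eq_zero CMat.norm_one_le hA hak hM hn)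
    (fun n hn => norm_errCoeff_le CMat.norm_one_le hA hak hM (by omega)) hsum
  refine h.trans ?_
  rw [div_le_iff₀ (by linarith)]
  have h2 : (2 * (Λ s * (s' - s))) ^ (2 * M + 1) ≤ (2 * θ) ^ (2 * M + 1) := by gcongr
  have h3 : 0 ≤ (2 * θ) ^ (2 * M + 1) := le_trans (by positivity) h2
  have h4 : 0 ≤ l1Norm a * (2 * θ) ^ (2 * M + 1) := by positivity
  calc 2.5 * l1Norm a * (2 * (Λ s * (s' - s))) ^ (2 * M + 1)
      ≤ 2.5 * l1Norm a * (2 * θ) ^ (2 * M + 1) := by gcongr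
    _ ≤ _ := by nlinarith

/-- Here `14 / (1 - 8.5 * 1.6/41) ≤ 21`. -/
theorem norm_multiproductFormula_sub_le' (hSmooth : ContDiffOn ℝ ∞ H (Icc t₀ t))
    (hΛ : IsLambdaBound H Λ t₀ t) {M : ℕ} (hM : 1 ≤ M) {a : Fin M → ℝ} {k : Fin M → ℕ}
    (hak : IsMultiproductCoeff a k) {s s' : ℝ} (hs0 : t₀ ≤ s) (hs : s < s') (hst : s' ≤ t)
    {θ : ℝ} (hle : Λ s * (s' - s) ≤ θ) (hθ : θ ≤ 1.6 / 41) :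
    ‖multiproductFormula H a k s' s - propagator H s s'‖ ≤
      21 * M * 5 ^ M * (8.5 * θ) ^ (2 * M + 1) := by
  have hsI : s ∈ Icc t₀ t := ⟨hs0, hs.le.trans hst⟩
  have h0 : 0 ≤ Λ s * (s' - s) := mul_nonneg (hΛ.nonneg hsI) (sub_nonneg.2 hs.le)
  obtain ⟨A, hA, hsum⟩ := exists_hasSum_errCoeff hSmooth hΛ hak hs0 hs hst (by linarith)
  have h := norm_hasSum_le_of_eq_zero (m := 2 * M + 1) h0 (κ := 8.5) (by norm_num) (by linarith)
    (fun n hn => errCoeff_eq_zero CMat.norm_one_le hA hak hM hn)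
    (fun n hn => norm_errCoeff_le_of_lt CMat.norm_one_le hA hak hM hn) hsum
  refine h.trans ?_
  rw [div_le_iff₀ (by linarith)]
  have h2 : (8.5 * (Λ s * (s' - s))) ^ (2 * M + 1) ≤ (8.5 * θ) ^ (2 * M + 1) := by gcongr
  have h3 : 0 ≤ (8.5 * θ) ^ (2 * M + 1) := le_trans (by positivity) h2
  have h4 : 0 ≤ M * 5 ^ M * (8.5 * θ) ^ (2 * M + 1) := by positivity
  calc 14 * M * 5 ^ M * (8.5 * (Λ s * (s' - s))) ^ (2 * M + 1)
      ≤ 14 * M * 5 ^ M * (8.5 * θ) ^ (2 * M + 1) := by gcongr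
    _ ≤ _ := by nlinarith

theorem norm_midpointFormula_le {s s' : ℝ} (hH : (H (s + (s' - s) / 2)).IsHermitian) :
    ‖midpointFormula H s' s‖ ≤ 1 := by
  have : CompleteSpace (CMat d) := FiniteDimensional.complete ℂ _
  rw [midpointFormula]
  have hskew : (-Complex.I * ((s' - s : ℝ) : ℂ)) • H (s + (s' - s) / 2) ∈
      skewAdjoint (CMat d) := by
    rw [skewAdjoint.mem_iff, star_smul, show star (H (s + (s' - s) / 2)) = _ from hH, ← neg_smul]
    congr 1
    simp
  let : NormedAlgebra ℚ (CMat d) := NormedAlgebra.restrictScalars ℚ ℂ _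
  have := NormedSpace.exp_mem_unitary_of_mem_skewAdjoint hskew
  exact CMat.norm_le_one_of_star_mul_self (Unitary.star_mul_self_of_mem this)

theorem norm_multiproductFormula_le {s s' : ℝ} (hs : s ≤ s')
    (hH : ∀ τ ∈ Icc s s', (H τ).IsHermitian) {M : ℕ} {a : Fin M → ℝ} {k : Fin M → ℕ}
    (hk : ∀ j, 0 < k j) : ‖multiproductFormula H a k s' s‖ ≤ l1Norm a := by
  rw [multiproductFormula, l1Norm]
  refine norm_sum_le_of_le _ fun j _ => ?_
  rw [norm_smul, Complex.norm_real, Real.norm_eq_abs]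
  refine mul_le_of_le_one_right (abs_nonneg _) ?_
  refine (norm_timeOrderedProd_le_pow (C := 1) fun q =>
    norm_midpointFormula_le (hH _ ?_)).trans (one_pow _).le
  have hk1 : (0 : ℝ) < k j := by exact_mod_cast hk j
  have hq : (q : ℝ) + 1 ≤ k j := by exact_mod_cast q.2
  have hδ : 0 ≤ s' - s := sub_nonneg.2 hs
  have e : s + (s' - s) * (q : ℝ) / k j + (s + (s' - s) * ((q : ℝ) + 1) / k j -
        (s + (s' - s) * (q : ℝ) / k j)) / 2 = s + (s' - s) * ((q : ℝ) + 1 / 2) / k j := by ring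
  rw [e]
  constructor
  · have : 0 ≤ (s' - s) * ((q : ℝ) + 1 / 2) / k j := by positivity
    linarith
  · have : (s' - s) * ((q : ℝ) + 1 / 2) / k j ≤ s' - s := by
      rw [div_le_iff₀ hk1]
      exact mul_le_mul_of_nonneg_left (by linarith) hδ
    linarith

end Step

/-! ### The mesh and the number of steps -/

section Mesh

variable {Λ : ℝ → ℝ} {t₀ t : ℝ}

theorem intervalIntegrable_of_mem_Icc (hc : ContinuousOn Λ (Icc t₀ t)) {s s' : ℝ}
    (hs : s ∈ Icc t₀ t) (hs' : s' ∈ Icc t₀ t) : IntervalIntegrable Λ volume s s' :=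
  (hc.mono (uIcc_subset_Icc hs hs')).intervalIntegrable

/-- Since `Λ' ≥ -K Λ²`, the function `Λ exp(K ∫ Λ)` is nondecreasing. So `Λ s` is at most `Λ τ`
times the exponential over the whole step; integrate in `τ`. -/
theorem mul_sub_le_integral_mul_exp (hc : ContinuousOn Λ (Icc t₀ t))
    (h0 : ∀ τ ∈ Icc t₀ t, 0 ≤ Λ τ) (hd : DifferentiableOn ℝ Λ (Icc t₀ t)) {K : ℝ} (hK : 0 ≤ K)
    (hΛK : ∀ τ ∈ Icc t₀ t, |derivWithin Λ (Icc t₀ t) τ| ≤ K * Λ τ ^ 2) {s s' : ℝ}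
    (hs0 : t₀ ≤ s) (hs : s ≤ s') (hst : s' ≤ t) :
    Λ s * (s' - s) ≤ (∫ τ in s..s', Λ τ) * Real.exp (K * ∫ τ in s..s', Λ τ) := by
  have hsub : Icc s s' ⊆ Icc t₀ t := Icc_subset_Icc hs0 hst
  have hsI := hsub (left_mem_Icc.2 hs)
  set Φ : ℝ → ℝ := fun τ => ∫ x in s..τ, Λ x with hΦ
  have hint : ∀ τ ∈ Icc s s', IntervalIntegrable Λ volume s τ := fun τ hτ =>
    intervalIntegrable_of_mem_Icc hc hsI (hsub hτ)
  have hΦc : ContinuousOn Φ (Icc s s') := by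
    have := intervalIntegral.continuousOn_primitive_interval'
      (intervalIntegrable_of_mem_Icc hc hsI (hsub (right_mem_Icc.2 hs))) left_mem_uIcc
    rwa [uIcc_of_le hs] at this
  have hmono : MonotoneOn (fun τ => Λ τ * Real.exp (K * Φ τ)) (Icc s s') := by
    have hder : ∀ τ ∈ Ioo s s', HasDerivAt (fun τ => Λ τ * Real.exp (K * Φ τ))
        (derivWithin Λ (Icc t₀ t) τ * Real.exp (K * Φ τ) +
          Λ τ * (Real.exp (K * Φ τ) * (K * Λ τ))) τ := by
      intro τ hτ
      have hτI : τ ∈ Ioo t₀ t := ⟨hs0.trans_lt hτ.1, hτ.2.trans_le hst⟩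
      have hn : Icc t₀ t ∈ nhds τ := Icc_mem_nhds hτI.1 hτI.2
      have h1 : HasDerivAt Λ (derivWithin Λ (Icc t₀ t) τ) τ :=
        (hd τ (Ioo_subset_Icc_self hτI)).hasDerivWithinAt.hasDerivAt hn
      have h2 : HasDerivAt Φ (Λ τ) τ :=
        intervalIntegral.integral_hasDerivAt_right (hint τ (Ioo_subset_Icc_self hτ))
          ((hc.mono Ioo_subset_Icc_self).stronglyMeasurableAtFilter isOpen_Ioo τ hτI)
          (hc.continuousAt hn)
      exact h1.mul ((h2.const_mul K).exp)
    refine monotoneOn_of_deriv_nonneg (convex_Icc s s') ?_ ?_ ?_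
    · exact (hc.mono hsub).mul (Real.continuous_exp.comp_continuousOn (hΦc.const_smul K))
    · rw [interior_Icc]
      exact fun τ hτ => (hder τ hτ).differentiableAt.differentiableWithinAt
    · rw [interior_Icc]
      intro τ hτ
      rw [(hder τ hτ).deriv]
      have h3 := (abs_le.1 (hΛK τ (hsub (Ioo_subset_Icc_self hτ)))).1
      have h4 : 0 ≤ (derivWithin Λ (Icc t₀ t) τ + K * Λ τ ^ 2) * Real.exp (K * Φ τ) :=
        mul_nonneg (by linarith) (Real.exp_pos _).le
      linarith
  have hΦs : Φ s = 0 := intervalIntegral.integral_same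
  have hle : ∀ τ ∈ Icc s s', Λ s ≤ Λ τ * Real.exp (K * Φ s') := fun τ hτ => by
    have h1 := hmono (left_mem_Icc.2 hs) hτ hτ.1
    simp only [hΦs, mul_zero, Real.exp_zero, mul_one] at h1
    refine h1.trans (mul_le_mul_of_nonneg_left (Real.exp_le_exp.2
      (mul_le_mul_of_nonneg_left ?_ hK)) (h0 τ (hsub hτ)))
    have h2 : Φ s' - Φ τ = ∫ x in τ..s', Λ x :=
      intervalIntegral.integral_interval_sub_left (hint s' (right_mem_Icc.2 hs)) (hint τ hτ)
    have h3 : 0 ≤ ∫ x in τ..s', Λ x := intervalIntegral.integral_nonneg hτ.2 fun x hx =>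
      h0 x (hsub ⟨hτ.1.trans hx.1, hx.2⟩)
    linarith
  have hfin := intervalIntegral.integral_mono_on hs (f := fun _ => Λ s)
    (g := fun τ => Λ τ * Real.exp (K * Φ s')) intervalIntegrable_const
    ((hint s' (right_mem_Icc.2 hs)).mul_const _) hle
  rw [intervalIntegral.integral_const, intervalIntegral.integral_mul_const, smul_eq_mul,
    mul_comm] at hfin
  exact hfin

/-- Writing `c = 1 + 3K/2`, the condition `c l ≤ 3/2` gives `c (1 - K l) ≥ 1`, and `(1 - K l) exp(K
l) ≤ 1` always holds. -/
theorem mul_exp_le {K l : ℝ} (hK : 0 ≤ K) (hl : 0 ≤ l) (h : (1 + 3 / 2 * K) * l ≤ 3 / 2) :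
    l * Real.exp (K * l) ≤ (1 + 3 / 2 * K) * l := by
  rw [mul_comm]
  refine mul_le_mul_of_nonneg_right ?_ hl
  set c := 1 + 3 / 2 * K with hc
  have hc1 : 1 ≤ c * (1 - K * l) := by nlinarith
  have h1 : (1 - K * l) * Real.exp (K * l) ≤ 1 := by
    have h2 := Real.add_one_le_exp (-(K * l))
    have h3 : Real.exp (-(K * l)) * Real.exp (K * l) = 1 := by
      rw [← Real.exp_add, neg_add_cancel, Real.exp_zero]
    nlinarith [Real.exp_pos (K * l)]
  have hc0 : 0 ≤ c := by positivity
  calc Real.exp (K * l) = 1 * Real.exp (K * l) := (one_mul _).symm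
    _ ≤ c * (1 - K * l) * Real.exp (K * l) := by gcongr
    _ = c * ((1 - K * l) * Real.exp (K * l)) := by ring
    _ ≤ c * 1 := by gcongr
    _ = c := mul_one c

theorem exists_mesh (ht : t₀ < t) (hc : ContinuousOn Λ (Icc t₀ t))
    (h0 : ∀ τ ∈ Icc t₀ t, 0 ≤ Λ τ) {r : ℕ} (hr : 1 ≤ r)
    (hL : r = 1 ∨ 0 < ∫ τ in t₀..t, Λ τ) :
    ∃ mesh : Fin (r + 1) → ℝ, StrictMono mesh ∧ mesh 0 = t₀ ∧ mesh (Fin.last r) = t ∧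
      ∀ i : Fin r, (∫ τ in mesh i.castSucc..mesh i.succ, Λ τ) = (∫ τ in t₀..t, Λ τ) / r := by
  have hleft : t₀ ∈ Icc t₀ t := left_mem_Icc.2 ht.le
  have hright : t ∈ Icc t₀ t := right_mem_Icc.2 ht.le
  rcases hL with rfl | hL
  · refine ⟨![t₀, t], ?_, rfl, rfl, fun i => ?_⟩
    · rw [Fin.strictMono_iff_lt_succ]
      intro i
      fin_cases i
      exact ht
    · fin_cases i
      simp
  · set L := ∫ τ in t₀..t, Λ τ with hLdef
    set F : ℝ → ℝ := fun τ => ∫ x in t₀..τ, Λ x with hF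
    have hr0 : (0 : ℝ) < r := by exact_mod_cast hr
    have hint : ∀ τ ∈ Icc t₀ t, IntervalIntegrable Λ volume t₀ τ := fun τ hτ =>
      intervalIntegrable_of_mem_Icc hc hleft hτ
    have hFc : ContinuousOn F (Icc t₀ t) := by
      have := intervalIntegral.continuousOn_primitive_interval' (hint t hright) left_mem_uIcc
      rwa [uIcc_of_le ht.le] at this
    have hFt₀ : F t₀ = 0 := intervalIntegral.integral_same
    have hsub : ∀ x ∈ Icc t₀ t, ∀ y ∈ Icc t₀ t, ∫ τ in x..y, Λ τ = F y - F x :=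
      fun x hx y hy => (intervalIntegral.integral_interval_sub_left (hint y hy) (hint x hx)).symm
    have hlt : ∀ x ∈ Icc t₀ t, ∀ y ∈ Icc t₀ t, F x < F y → x < y := by
      intro x hx y hy hxy
      by_contra hcon
      have hyx := not_lt.1 hcon
      have h1 : 0 ≤ ∫ τ in y..x, Λ τ := intervalIntegral.integral_nonneg hyx fun z hz =>
        h0 z ⟨hy.1.trans hz.1, hz.2.trans hx.2⟩
      rw [hsub y hy x hx] at h1
      linarith
    -- The end points are prescribed separately, because `F` is constant wherever `Λ` vanishes and
    -- the intermediate value theorem need not return them.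
    have hex : ∀ i : Fin (r + 1), ∃ τ ∈ Icc t₀ t, F τ = i * L / r ∧ (i = 0 → τ = t₀) ∧
        (i = Fin.last r → τ = t) := by
      intro i
      rcases eq_or_ne i 0 with rfl | hi0
      · refine ⟨t₀, hleft, by simp [hFt₀], fun _ => rfl, fun h => ?_⟩
        have := congrArg Fin.val h
        simp at this
        omega
      · rcases eq_or_ne i (Fin.last r) with rfl | hil
        · refine ⟨t, hright, ?_, fun h => absurd h hi0, fun _ => rfl⟩
          rw [Fin.val_last]
          change L = _
          field_simp
        · have hir : (i : ℝ) ≤ r := by exact_mod_cast Nat.lt_succ_iff.1 i.2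
          obtain ⟨τ, hτ, hFτ⟩ := intermediate_value_Icc ht.le hFc
            (show (i : ℝ) * L / r ∈ Icc (F t₀) (F t) by
              rw [hFt₀]
              refine ⟨by positivity, ?_⟩
              change _ ≤ L
              rw [div_le_iff₀ hr0, mul_comm]
              exact mul_le_mul_of_nonneg_left hir hL.le)
          exact ⟨τ, hτ, hFτ, fun h => absurd h hi0, fun h => absurd h hil⟩
    choose mesh hmI hmF hm0 hmr using hex
    refine ⟨mesh, ?_, hm0 0 rfl, hmr _ rfl, fun i => ?_⟩
    · rw [Fin.strictMono_iff_lt_succ]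
      intro i
      refine hlt _ (hmI _) _ (hmI _) ?_
      rw [hmF, hmF, Fin.val_castSucc, Fin.val_succ]
      push_cast
      gcongr
      linarith
    · rw [hsub _ (hmI _) _ (hmI _), hmF, hmF, Fin.val_castSucc, Fin.val_succ]
      push_cast
      ring

end Mesh

/-! ### Choice of the number of steps and the numerical error budget. -/

section StepNumber

theorem rpow_bound_pow {x y : ℝ} (hx : 0 ≤ x) (hy : 0 ≤ y) {M : ℕ} (hM : 1 ≤ M) :
    (x ^ (1 + 1 / (2 * (M : ℝ))) * y ^ (1 / (2 * (M : ℝ)))) ^ (2 * M) = x ^ (2 * M + 1) * y := by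
  have hM0 : (M : ℝ) ≠ 0 := by exact_mod_cast (show M ≠ 0 by omega)
  rw [mul_pow, ← Real.rpow_natCast, ← Real.rpow_natCast (y ^ _), ← Real.rpow_mul hx,
    ← Real.rpow_mul hy, ← Real.rpow_natCast x]
  congr 1
  · congr 1
    push_cast
    field_simp
  · rw [show 1 / (2 * (M : ℝ)) * ((2 * M : ℕ) : ℝ) = 1 by push_cast; field_simp, Real.rpow_one]

/-- Rounding down respects the stated bound on `r`. It costs `X < 2` when `r = 1`, and `X < r + 1 ≤
1.5 r` otherwise. -/
theorem exists_step_number {X : ℝ} (hX : 0 ≤ X) (M : ℕ) :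
    ∃ r : ℕ, 1 ≤ r ∧ (r : ℝ) ≤ max 1 X ∧
      ((r = 1 ∧ X ^ (2 * M) ≤ 4 ^ M) ∨ (2 ≤ r ∧ X ^ (2 * M) ≤ 2.25 ^ M * (r : ℝ) ^ (2 * M))) := by
  rcases lt_or_ge X 2 with h | h
  · refine ⟨1, le_rfl, by simp, Or.inl ⟨rfl, ?_⟩⟩
    calc X ^ (2 * M) ≤ 2 ^ (2 * M) := by gcongr
      _ = 4 ^ M := by rw [pow_mul]; norm_num
  · have h2 : 2 ≤ ⌊X⌋₊ := Nat.le_floor (by exact_mod_cast h)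
    have h2' : (2 : ℝ) ≤ ⌊X⌋₊ := by exact_mod_cast h2
    refine ⟨⌊X⌋₊, by omega, (Nat.floor_le hX).trans (le_max_right _ _), Or.inr ⟨h2, ?_⟩⟩
    have h3 := Nat.lt_floor_add_one X
    calc X ^ (2 * M) ≤ (1.5 * (⌊X⌋₊ : ℝ)) ^ (2 * M) := by gcongr; linarith
      _ = _ := by rw [mul_pow, pow_mul 1.5]; norm_num

variable {M : ℕ} {A ε z : ℝ}

/-- From `ε < 1 + A ≤ 2A = 6.25 * 0.32 A` one gets `z^(2M+1) ≤ 4^M * 6.25 ≤ 25^M`. -/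
theorem le_of_pow_le_single (hM : 1 ≤ M) (hA : 1 ≤ A) (hεA : ε < 1 + A)
    (h : z ^ (2 * M + 1) * (0.32 * A) ≤ 4 ^ M * ε) : z ≤ 5 := by
  have h1 : z ^ (2 * M + 1) ≤ 5 ^ (2 * M + 1) := by
    have h2 : z ^ (2 * M + 1) * (0.32 * A) ≤ 4 ^ M * 6.25 * (0.32 * A) := by
      refine h.trans ?_
      rw [mul_assoc]
      gcongr
      linarith
    have h3 := le_of_mul_le_mul_right h2 (by positivity)
    have h4 : (6.25 : ℝ) ≤ 6.25 ^ M := by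
      calc (6.25 : ℝ) = 6.25 ^ 1 := (pow_one _).symm
        _ ≤ 6.25 ^ M := pow_le_pow_right₀ (by norm_num) hM
    calc z ^ (2 * M + 1) ≤ 4 ^ M * 6.25 ^ M := h3.trans (by gcongr)
      _ = 5 ^ (2 * M) := by rw [← mul_pow, pow_mul]; norm_num
      _ ≤ 5 ^ (2 * M + 1) := pow_le_pow_right₀ (by norm_num) (by omega)
  exact le_of_pow_le_pow_left₀ (by omega) (by norm_num) h1

theorem single_step_error_le (hε : 0 ≤ ε)
    (h : z ^ (2 * M + 1) * (0.32 * A) ≤ 4 ^ M * ε) :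
    3.31 * A * (2 * (z / 41)) ^ (2 * M + 1) ≤ ε := by
  have e : 3.31 * A * (2 * (z / 41)) ^ (2 * M + 1) =
      3.31 / 0.32 * (2 / 41) ^ (2 * M + 1) * (z ^ (2 * M + 1) * (0.32 * A)) := by
    rw [show 2 * (z / 41) = 2 / 41 * z by ring, mul_pow]; ring
  have h1 : (16 / 1681 : ℝ) ^ M ≤ 1 := pow_le_one₀ (by norm_num) (by norm_num)
  rw [e]
  calc _ ≤ 3.31 / 0.32 * (2 / 41) ^ (2 * M + 1) * (4 ^ M * ε) := by gcongr
    _ = 3.31 / 0.32 * (2 / 41) * (16 / 1681) ^ M * ε := by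
        rw [pow_succ, pow_mul, show (16 / 1681 : ℝ) = (2 / 41) ^ 2 * 4 by norm_num, mul_pow]; ring
    _ ≤ 3.31 / 0.32 * (2 / 41) * 1 * ε := by gcongr
    _ ≤ ε := by linarith

theorem le_three_of_mul_pow_le {r : ℝ} (hr : 2 ≤ r) (hz : 0 ≤ z) (hM : 1 ≤ M) (hA : 1 ≤ A)
    (hεA : ε < 1 + A) (h : r * z ^ (2 * M + 1) * (0.32 * A) ≤ 2.25 ^ M * ε) : z ≤ 3 := by
  have h1 : z ^ (2 * M + 1) ≤ 3 ^ (2 * M + 1) := by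
    have h2 : r * z ^ (2 * M + 1) * (0.32 * A) ≤ 2.25 ^ M * 6.25 * (0.32 * A) := by
      refine h.trans ?_
      rw [mul_assoc]
      gcongr
      linarith
    have h3 := le_of_mul_le_mul_right h2 (by positivity)
    have h4 : (4 : ℝ) ≤ 4 ^ M := by
      calc (4 : ℝ) = 4 ^ 1 := (pow_one _).symm
        _ ≤ 4 ^ M := pow_le_pow_right₀ (by norm_num) hM
    have h5 : 0 ≤ z ^ (2 * M + 1) := by positivity
    have h6 : (0 : ℝ) < 2.25 ^ M := by positivity
    calc z ^ (2 * M + 1) ≤ 2.25 ^ M * 4 ^ M := by nlinarith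
      _ = 3 ^ (2 * M) := by rw [← mul_pow, pow_mul]; norm_num
      _ ≤ 3 ^ (2 * M + 1) := pow_le_pow_right₀ (by norm_num) (by omega)
  exact le_of_pow_le_pow_left₀ (by omega) (by norm_num) h1

theorem one_add_pow_le_exp {δ : ℝ} (hδ : 0 ≤ δ) (r : ℕ) : (1 + δ) ^ r ≤ Real.exp (r * δ) := by
  rw [Real.exp_nat_mul, add_comm]
  gcongr
  exact Real.add_one_le_exp δ

/-- Here `(2/41)² * 2.25 = 9/1681 ≤ 1/186`, so `rδ ≤ 0.505 ε / 186^M ≤ 1`, and `exp u - 1 ≤ u + u²`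
finishes. -/
theorem many_step_error_le {r : ℕ} (hz : 0 ≤ z) (hM : 1 ≤ M) (hA : 1 ≤ A) (hε : 0 ≤ ε)
    (h : r * z ^ (2 * M + 1) * (0.32 * A) ≤ 2.25 ^ M * ε) (hsmall : 0.505 * ε ≤ 186 ^ M) :
    (1 + 3.31 * A * (2 * (z / 41)) ^ (2 * M + 1)) ^ r - 1 ≤ ε := by
  set δ := 3.31 * A * (2 * (z / 41)) ^ (2 * M + 1) with hδ
  have hδ0 : 0 ≤ δ := by positivity
  have e : r * δ = 3.31 / 0.32 * (2 / 41) ^ (2 * M + 1) * (r * z ^ (2 * M + 1) * (0.32 * A)) := by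
    rw [hδ, show 2 * (z / 41) = 2 / 41 * z by ring, mul_pow]; ring
  have hu : r * δ ≤ 0.505 * ((1 / 186) ^ M * ε) := by
    rw [e]
    calc _ ≤ 3.31 / 0.32 * (2 / 41) ^ (2 * M + 1) * (2.25 ^ M * ε) := by gcongr
      _ = 3.31 / 0.32 * (2 / 41) * ((9 / 1681) ^ M * ε) := by
          rw [pow_succ, pow_mul, show (9 / 1681 : ℝ) = (2 / 41) ^ 2 * 2.25 by norm_num, mul_pow]
          ring
      _ ≤ 0.505 * ((1 / 186) ^ M * ε) :=
          mul_le_mul (by norm_num) (mul_le_mul_of_nonneg_right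
            (pow_le_pow_left₀ (by norm_num) (by norm_num) M) hε) (by positivity) (by norm_num)
  have hpow : (1 / 186 : ℝ) ^ M * 186 ^ M = 1 := by rw [← mul_pow]; norm_num
  have hu1 : r * δ ≤ 1 := by
    have h2 := mul_le_mul_of_nonneg_left hsmall (show (0 : ℝ) ≤ (1 / 186) ^ M by positivity)
    rw [hpow] at h2
    linarith
  have h186 : (1 / 186 : ℝ) ^ M ≤ 1 / 186 := by
    calc (1 / 186 : ℝ) ^ M ≤ (1 / 186) ^ 1 :=
          pow_le_pow_of_le_one (by norm_num) (by norm_num) hM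
      _ = _ := pow_one _
  have hu2 : r * δ ≤ 0.505 * (1 / 186 * ε) := hu.trans (by gcongr)
  have hu0 : 0 ≤ r * δ := by positivity
  have h3 := (abs_le.1 (Real.abs_exp_sub_one_sub_id_le
    (show |(r : ℝ) * δ| ≤ 1 by rwa [abs_of_nonneg hu0]))).2
  have h4 := one_add_pow_le_exp hδ0 r
  nlinarith

/-- For `ε` this large `A ≥ 10000`, so `ε/(0.32 A) ≤ 3.13`. The bound free of `A` then makes `rδ ≤
4M`, and `exp(4M) ≤ 186^M` is already below `ε`. -/
theorem many_step_error_le' {r : ℕ} (hr : 2 ≤ r) (hz : 0 ≤ z) (hM : 2 ≤ M)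
    (hεA : ε < 1 + A) (h : r * z ^ (2 * M + 1) * (0.32 * A) ≤ 2.25 ^ M * ε)
    (hlarge : 186 ^ M < 0.505 * ε) :
    z ≤ 1.6 ∧ (1 + 21 * M * 5 ^ M * (8.5 * (z / 41)) ^ (2 * M + 1)) ^ r - 1 ≤ ε := by
  have h186 : (186 : ℝ) ^ 2 ≤ 186 ^ M := pow_le_pow_right₀ (by norm_num) hM
  have hA1 : 10000 ≤ A := by linarith
  have hr2 : (2 : ℝ) ≤ r := by exact_mod_cast hr
  have hM2 : (2 : ℝ) ≤ M := by exact_mod_cast hM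
  have h2 : r * z ^ (2 * M + 1) ≤ 3.13 * 2.25 ^ M := by
    have h3 : r * z ^ (2 * M + 1) * (0.32 * A) ≤ 3.13 * 2.25 ^ M * (0.32 * A) := by
      refine h.trans ?_
      rw [mul_comm (3.13 : ℝ), mul_assoc]
      gcongr
      linarith
    exact le_of_mul_le_mul_right h3 (by positivity)
  have h5 : 0 ≤ z ^ (2 * M + 1) := by positivity
  refine ⟨?_, ?_⟩
  · have h6 : (0 : ℝ) < 2.25 ^ M := by positivity
    have h7 : z ^ (2 * M + 1) ≤ 1.6 ^ (2 * M + 1) := by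
      calc z ^ (2 * M + 1) ≤ 1.6 * 2.25 ^ M := by nlinarith
        _ ≤ 1.6 * 2.56 ^ M := by gcongr; norm_num
        _ = 1.6 ^ (2 * M + 1) := by rw [pow_succ, pow_mul, mul_comm]; norm_num
    exact le_of_pow_le_pow_left₀ (by omega) (by norm_num) h7
  · set δ := 21 * M * 5 ^ M * (8.5 * (z / 41)) ^ (2 * M + 1) with hδ
    have hδ0 : 0 ≤ δ := by positivity
    have e : r * δ = 21 * M * 5 ^ M * (8.5 / 41) ^ (2 * M + 1) * (r * z ^ (2 * M + 1)) := by
      rw [hδ, show 8.5 * (z / 41) = 8.5 / 41 * z by ring, mul_pow]; ring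
    have h8 : r * δ ≤ (M : ℝ) * 4 := by
      have h9 : (812.8125 / 1681 : ℝ) ^ M ≤ (812.8125 / 1681) ^ 2 :=
        pow_le_pow_of_le_one (by norm_num) (by norm_num) hM
      have h10 : (812.8125 / 1681 : ℝ) ^ M = 5 ^ M * ((8.5 / 41) ^ 2) ^ M * 2.25 ^ M := by
        rw [← mul_pow, ← mul_pow]; norm_num
      rw [e]
      calc _ ≤ 21 * (M : ℝ) * 5 ^ M * (8.5 / 41) ^ (2 * M + 1) * (3.13 * 2.25 ^ M) := by gcongr
        _ = (M : ℝ) * (21 * 3.13 * (8.5 / 41) * (812.8125 / 1681) ^ M) := by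
            rw [pow_succ, pow_mul, h10]
            ring
        _ ≤ (M : ℝ) * (21 * 3.13 * (8.5 / 41) * (812.8125 / 1681) ^ 2) := by gcongr
        _ ≤ (M : ℝ) * 4 := mul_le_mul_of_nonneg_left (by norm_num) (by positivity)
    have h9 : Real.exp ((M : ℝ) * 4) ≤ 186 ^ M := by
      rw [Real.exp_nat_mul]
      gcongr
      have h10 : Real.exp 4 = Real.exp 1 ^ 4 := by rw [← Real.exp_nat_mul]; norm_num
      rw [h10]
      calc Real.exp 1 ^ 4 ≤ 3 ^ 4 := by
            gcongr
            have := Real.exp_one_lt_d9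
            linarith
        _ ≤ 186 := by norm_num
    have h11 := (one_add_pow_le_exp hδ0 r).trans ((Real.exp_le_exp.2 h8).trans h9)
    linarith

end StepNumber

end

/-! ### Assembly of the global error bound. -/

theorem mainTheorem6 {d : ℕ} (H : ℝ → CMat d) (t₀ t : ℝ) (ht : t₀ < t)
    (hHerm : ∀ τ ∈ Icc t₀ t, (H τ).IsHermitian)
    (hSmooth : ContDiffOn ℝ ∞ H (Icc t₀ t))
    (Λ : ℝ → ℝ) (hΛ : IsLambdaBound H Λ t₀ t)
    (hΛdiff : DifferentiableOn ℝ Λ (Icc t₀ t))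
    (K : ℝ) (hK : 0 ≤ K)
    (hΛK : ∀ τ ∈ Icc t₀ t, |derivWithin Λ (Icc t₀ t) τ| ≤ K * Λ τ ^ 2)
    (M : ℕ) (hM : 1 ≤ M) (a : Fin M → ℝ) (k : Fin M → ℕ) (hak : IsMultiproductCoeff a k)
    (ε : ℝ) (hε : 0 < ε) :
    (∃ (r : ℕ) (mesh : Fin (r + 1) → ℝ),
      StrictMono mesh ∧ mesh 0 = t₀ ∧ mesh (Fin.last r) = t ∧
      ‖propagator H t₀ t -
          timeOrderedProd fun i : Fin r =>
            multiproductFormula H a k (mesh i.succ) (mesh i.castSucc)‖ ≤ ε ∧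
      (r : ℝ) ≤ max 1
        ((41 * (1 + 3 / 2 * K) * timeAverage Λ t₀ t * (t - t₀)) ^ (1 + 1 / (2 * (M : ℝ))) *
          (0.32 * l1Norm a / ε) ^ (1 / (2 * (M : ℝ))))) ∧
    timeAverage Λ t₀ t * (t - t₀) = ∫ τ in t₀..t, |Λ τ| := by
  have hnn : ∀ τ ∈ Icc t₀ t, 0 ≤ Λ τ := fun τ hτ => hΛ.nonneg hτ
  have havg : timeAverage Λ t₀ t * (t - t₀) = ∫ τ in t₀..t, Λ τ := by
    have : t - t₀ ≠ 0 := (sub_pos.2 ht).ne'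
    rw [timeAverage]
    field_simp
  refine ⟨?_, havg.trans (intervalIntegral.integral_congr fun τ hτ => ?_)⟩
  swap
  · rw [uIcc_of_le ht.le] at hτ
    exact (abs_of_nonneg (hnn τ hτ)).symm
  rw [mul_assoc (41 * (1 + 3 / 2 * K)), havg]
  have hHc : ContinuousOn H (Icc t₀ t) := hSmooth.continuousOn
  have hA := hak.one_le_l1Norm hM
  have hL : 0 ≤ ∫ τ in t₀..t, Λ τ := intervalIntegral.integral_nonneg ht.le hnn
  set L := ∫ τ in t₀..t, Λ τ with hLdef
  set c := 1 + 3 / 2 * K with hc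
  have hc0 : 0 < c := by positivity
  set A := l1Norm a with hAdef
  rcases le_or_gt (1 + A) ε with hεA | hεA
  · obtain ⟨mesh, hmono, h0, hr, -⟩ := exists_mesh ht hΛ.1 hnn le_rfl (Or.inl rfl)
    refine ⟨1, mesh, hmono, h0, hr, ?_, by simp⟩
    have e : (timeOrderedProd fun i : Fin 1 =>
        multiproductFormula H a k (mesh i.succ) (mesh i.castSucc)) =
        multiproductFormula H a k t t₀ := by
      have hr' : mesh 1 = t := hr
      simp [timeOrderedProd, h0, hr']
    rw [e]
    exact (norm_sub_le _ _).trans ((add_le_add (norm_propagator_le ht.le hHerm hHc)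
      (norm_multiproductFormula_le ht.le hHerm hak.1)).trans hεA)
  · have hx0 : 0 ≤ 41 * c * L := by positivity
    have hy0 : 0 ≤ 0.32 * A / ε := by positivity
    obtain ⟨r, hr1, hrX, hrp⟩ := exists_step_number
      (X := (41 * c * L) ^ (1 + 1 / (2 * (M : ℝ))) * (0.32 * A / ε) ^ (1 / (2 * (M : ℝ))))
      (by positivity) M
    have hrL : r = 1 ∨ 0 < L := by
      rcases hL.eq_or_lt with h | h
      · left
        rw [← h, mul_zero, Real.zero_rpow (by positivity), zero_mul,
          max_eq_left zero_le_one] at hrX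
        have : r ≤ 1 := by exact_mod_cast hrX
        omega
      · exact Or.inr h
    obtain ⟨mesh, hmono, h0, hr, hint⟩ := exists_mesh ht hΛ.1 hnn hr1 hrL
    refine ⟨r, mesh, hmono, h0, hr, ?_, hrX⟩
    rw [rpow_bound_pow hx0 hy0 hM] at hrp
    have hr0 : (0 : ℝ) < r := by exact_mod_cast hr1
    -- Then `z / 41` is `c` times the integral of `Λ` over one step, the bound for `θ`.
    set z := 41 * c * L / r with hz
    have hz0 : 0 ≤ z := by positivity
    have hxz : 41 * c * L = r * z := by rw [hz]; field_simp
    rw [hxz, ← mul_div_assoc, div_le_iff₀ hε, div_le_iff₀ hε] at hrp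
    have hlo : ∀ i : Fin r, t₀ ≤ mesh i.castSucc := fun i => by
      rw [← h0]; exact hmono.monotone (Fin.zero_le _)
    have hhi : ∀ i : Fin r, mesh i.succ ≤ t := fun i => by
      rw [← hr]; exact hmono.monotone (Fin.le_last _)
    have hlt : ∀ i : Fin r, mesh i.castSucc < mesh i.succ := fun i =>
      hmono Fin.castSucc_lt_succ
    have hθ : z ≤ 5 → ∀ i : Fin r,
        Λ (mesh i.castSucc) * (mesh i.succ - mesh i.castSucc) ≤ z / 41 := fun hz5 i => by
      have hcl : c * (L / r) = z / 41 := by rw [hz]; ring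
      have h1 := mul_sub_le_integral_mul_exp hΛ.1 hnn hΛdiff hK hΛK (hlo i) (hlt i).le (hhi i)
      rw [hint i] at h1
      refine (h1.trans (mul_exp_le hK (by positivity) ?_)).trans hcl.le
      exact hcl.le.trans (by linarith)
    have herr : ∀ δ : ℝ, (∀ i : Fin r, ‖multiproductFormula H a k (mesh i.succ) (mesh i.castSucc) -
        propagator H (mesh i.castSucc) (mesh i.succ)‖ ≤ δ) → (1 + δ) ^ r - 1 ≤ ε →
        ‖propagator H t₀ t - timeOrderedProd fun i : Fin r =>
          multiproductFormula H a k (mesh i.succ) (mesh i.castSucc)‖ ≤ ε := fun δ hδ hδε => by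
      rw [propagator_eq_timeOrderedProd ht.le hHerm hHc mesh hmono.monotone h0 hr]
      refine (norm_timeOrderedProd_sub_le (fun i => ?_) hδ).trans hδε
      have hsub := Icc_subset_Icc (hlo i) (hhi i)
      exact norm_propagator_le (hlt i).le (fun τ hτ => hHerm τ (hsub hτ)) (hHc.mono hsub)
    have hnaive : z ≤ 5 → (1 + 3.31 * A * (2 * (z / 41)) ^ (2 * M + 1)) ^ r - 1 ≤ ε →
        ‖propagator H t₀ t - timeOrderedProd fun i : Fin r =>
          multiproductFormula H a k (mesh i.succ) (mesh i.castSucc)‖ ≤ ε := fun hz5 =>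
      herr _ fun i => norm_multiproductFormula_sub_le hSmooth hΛ hM hak (hlo i) (hlt i) (hhi i)
        (hθ hz5 i) (by linarith)
    rcases hrp with ⟨hr1', hp⟩ | ⟨hr2, hp⟩
    · rw [hr1', Nat.cast_one, one_mul] at hp
      refine hnaive (le_of_pow_le_single hM hA hεA hp) ?_
      rw [hr1', pow_one, add_sub_cancel_left]
      exact single_step_error_le hε.le hp
    · have hp' : r * z ^ (2 * M + 1) * (0.32 * A) ≤ 2.25 ^ M * ε := by
        have h1 : (0 : ℝ) < (r : ℝ) ^ (2 * M) := by positivity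
        refine le_of_mul_le_mul_right ?_ h1
        calc _ = (r * z) ^ (2 * M + 1) * (0.32 * A) := by rw [mul_pow, pow_succ (r : ℝ)]; ring
          _ ≤ _ := hp
          _ = _ := by ring
      have hr2' : (2 : ℝ) ≤ r := by exact_mod_cast hr2
      have hz3 := le_three_of_mul_pow_le hr2' hz0 hM hA hεA hp'
      rcases le_or_gt (0.505 * ε) (186 ^ M) with hs | hs
      · exact hnaive (by linarith) (many_step_error_le hz0 hM hA hε.le hp' hs)
      -- For `M = 1` the only weight is `1`, so `ε < 2` and this regime is empty.
      · have hM2 : 2 ≤ M := by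
          by_contra hlt2
          obtain rfl : M = 1 := by omega
          have h1 : a 0 = 1 := by simpa using hak.2 0
          have hA1 : A = 1 := by simp [hAdef, l1Norm, h1]
          rw [pow_one] at hs
          linarith
        obtain ⟨hz1, hb⟩ := many_step_error_le' hr2 hz0 hM2 hεA hp' hs
        exact herr _ (fun i => norm_multiproductFormula_sub_le' hSmooth hΛ hM hak (hlo i) (hlt i)
          (hhi i) (hθ (by linarith) i) (by linarith)) hb
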